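/- Let $F$ be a non-archimedean local field of characteristic $0$ with ring of integers $\mathcal O$, maximal ideal $\mathfrak p$, uniformiser $\varpi$, residue field of odd characteristic with $q$ elements, and absolute value normalised by $|\varpi|=q^{-1}$. Let $\psi$ be an unramified additive character of $F$ (trivial on $\mathcal O$ but not on $\mathfrak p^{-1}$). Put $G=\mathrm{GL}_2(F)$, $K_0=\mathrm{GL}_2(\mathcal O)$, $K(0)=K_0$, $K(l)=1+\mathrm{Mat}_2(\mathfrak p^l)$ for $l\ge 1$, let $D$ be the diagonal torus, $w=\begin{pmatrix}0&1\\-1&0\end{pmatrix}$, and normalise the Haar measure on $G$ by $\mathrm{vol}(K_0)=1$. Let $K_H(m,m')$ be the group of $k\in K_0$ with $k_{21}\in\mathfrak p^m$, $k_{12}\in\mathfrak p^{m'}$, let $n\ge 1$ and $H(2n)=K_H(2n,2n)$. For a closed subgroup $H\le K_0$ and $g\in K_0$ let $d_H(g)=0$ if $g\in H$, and $d_H(g)=q^{-l}$ if $g\in HK(l)\setminus HK(l+1)$. Let $\pi$ be an irreducible unitary smooth representation of $G$ with trivial central character and exponent conductor $a(\pi)=\min\{m\ge 0:\pi^{K_H(m,0)}\neq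 0\}=4n$, let $v^\circ\in\pi$ be a unit vector fixed by $H(2n)$, and let $V_{\mathrm{new}}$ be the $K_0$-representation generated by $v^\circ$. For $\tau\in\mathrm{Mat}_2(\mathfrak p^{-2n})$ write $\theta_\tau(k)=\psi(\mathrm{tr}(\tau(k-1)))$, $k\in K(n)$. Let $v\in\pi$ be a unit vector and $T\le G$ a torus given in one of the following two ways. (i) $\pi\cong\chi\boxplus\chi^{-1}$ (normalised parabolic induction) for a unitary character $\chi$ of $F^\times$ with conductor exponent $a(\chi)=2n$. Let $b_\chi\in\mathcal O^\times$ satisfy $\chi(1+\varpi^n x)=\psi(b_\chi x\varpi^{-n})$ for all $x\in\mathcal O$, let $c_1=\begin{pmatrix}b_\chi&-\frac12\\1&\frac1{2b_\chi}\end{pmatrix}$, and let $v_{\mathrm{ML}}\ne0$ be a standard microlocal lift vector, that is, $\pi(\mathrm{diag}(t_1,t_2)k)v_{\mathrm{ML}}=\chi(t_1/t_2)\,\theta_\tau(k)\,v_{\mathrm{ML}}$ for all $t_1,t_2\in\mathcal O^\times$ and $k\in K(n)$, where $\tau=\varpi^{-2n}\mathrm{diag}(b_\chi,-b_\chi)$.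 Then $v=\pi(c_1)v_{\mathrm{ML}}/\|v_{\mathrm{ML}}\|$ and $T=c_1Dc_1^{-1}$. (ii) $\pi\cong\mathrm{c\text{-}Ind}_J^G\Lambda$ is supercuspidal, where $E=F(\sqrt\delta)$ with $\delta\in\mathcal O^\times$ a non-square, $E$ is embedded in $\mathrm{Mat}_2(F)$ by $a+b\sqrt\delta\mapsto\begin{pmatrix}a&b\\b\delta&a\end{pmatrix}$, $\theta$ is a unitary character of $E^\times$ trivial on $F^\times$ with $a(\theta)=2n$, $\beta\in\mathfrak p_E^{-2n}$ satisfies $\theta(1+u)=\psi(\mathrm{Tr}_{E/F}(\beta u))$ for $u\in\mathfrak p_E^n$, $J=E^\times K(n)$ and $\Lambda(xk)=\theta(x)\theta_\beta(k)$ for $x\in E^\times$, $k\in K(n)$. Let $v_{\mathrm{MV}}\neq0$ be a minimal vector, that is, $\pi(xk)v_{\mathrm{MV}}=\theta(x)\theta_\beta(k)v_{\mathrm{MV}}$ for $x\in 1+\mathfrak p_E$, $k\in K(n)$. Then $v=v_{\mathrm{MV}}/\|v_{\mathrm{MV}}\|$ and $T=E^\times$. Put $\mathcal U=(T\cap K_0)K(n)$,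 $f(g)=\dim(V_{\mathrm{new}})\,\langle v,\pi(g)v\rangle\,\mathbf 1_{K_0}(g)$, and $$I_\gamma(|f|)=\frac1{\mathrm{vol}(H(2n))^2}\int_{H(2n)}\int_{H(2n)}|f|(x^{-1}\gamma y)\,dx\,dy .$$ Then there is an absolute constant $C>0$ such that, for all such data and all $\gamma\in K_0$, $$I_\gamma(|f|)\le C\,\frac{q^{1-n}}{\mathrm{vol}(\mathcal U)}\max_{\gamma'\in\{\gamma,w\gamma\}}\min\Bigl(\frac{q^{-n/2}}{d_{H(2n)}(\gamma')^{1/2}},1\Bigr).$$ Moreover, for every $\pi$ as above (irreducible, unitary, smooth, with trivial central character and $a(\pi)=4n$) and every $\gamma\in K_0$, $$|\langle v^\circ,\pi(\gamma)v^\circ\rangle|\le C\,q\max_{\gamma'\in\{\gamma,w\gamma\}}\min\Bigl(\frac{q^{-n/2}}{d_{H(2n)}(\gamma')^{1/2}},1\Bigr).$$ Here the minimum is read as $1$ when $d_{H(2n)}(\gamma')=0$. -/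

import Mathlib

open MeasureTheory Matrix
open scoped Pointwise

universe u v

noncomputable section

namespace PadicNewform

section Field

variable (F : Type u) [NontriviallyNormedField F] [IsUltrametricDist F]

/-- The residue field `𝔨 = 𝒪/𝔭` of the valuation ring `𝒪 = {x : ‖x‖ ≤ 1}`. -/
abbrev residueField : Type u :=
  IsLocalRing.ResidueField (NormedField.valuation (K := F)).valuationSubring

/-- `q`, the cardinality of the residue field. -/
def residueCard : ℕ := Nat.card (residueField F)

/-- The absolute value is the normalised one: a uniformiser has absolute value `q⁻¹`. With this
normalisation `𝔭 ^ k = {x : ‖x‖ ≤ q ^ (-k)}` for every integer `k`. -/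
def NormalizedNorm : Prop :=
  ∃ ϖ : F, ‖ϖ‖ = (residueCard F : ℝ)⁻¹ ∧ ∀ x : F, ‖x‖ < 1 → ‖x‖ ≤ ‖ϖ‖

end Field

section Groups

set_option linter.unusedSectionVars false

variable {F : Type u} [NontriviallyNormedField F] [IsUltrametricDist F]

theorem norm_det_eq_one_inv {g : GL (Fin 2) F} (h : ‖(g : Matrix (Fin 2) (Fin 2) F).det‖ = 1) :
    ‖((g⁻¹ : GL (Fin 2) F) : Matrix (Fin 2) (Fin 2) F).det‖ = 1 := by
  have h1 : ((g⁻¹ : GL (Fin 2) F) : Matrix (Fin 2) (Fin 2) F).det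
      * (g : Matrix (Fin 2) (Fin 2) F).det = 1 := by
    rw [← Matrix.det_mul, ← Units.val_mul]; simp
  have h2 := congrArg norm h1
  rw [norm_mul, h, mul_one, norm_one] at h2
  exact h2

theorem inv_entries (g : GL (Fin 2) F) :
    ((g⁻¹ : GL (Fin 2) F) : Matrix (Fin 2) (Fin 2) F)
      = (g : Matrix (Fin 2) (Fin 2) F).det⁻¹ • !![g 1 1, -g 0 1; -g 1 0, g 0 0] := by
  rw [Matrix.coe_units_inv, Matrix.inv_def, Matrix.adjugate_fin_two, Ring.inverse_eq_inv']

theorem norm_add_le_of {a b : F} {r : ℝ} (ha : ‖a‖ ≤ r) (hb : ‖b‖ ≤ r) : ‖a + b‖ ≤ r :=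
  (IsUltrametricDist.norm_add_le_max a b).trans (max_le ha hb)

theorem norm_mul_le_of {a b : F} {r : ℝ} (ha : ‖a‖ ≤ 1) (hb : ‖b‖ ≤ r) : ‖a * b‖ ≤ r := by
  rw [norm_mul]
  exact (mul_le_of_le_one_left (norm_nonneg _) ha).trans hb

theorem norm_mul_le_of' {a b : F} {r : ℝ} (ha : ‖a‖ ≤ r) (hb : ‖b‖ ≤ 1) : ‖a * b‖ ≤ r := by
  rw [mul_comm]; exact norm_mul_le_of hb ha

variable (F) in
/-- `K₀ = GL₂(𝒪)`. -/
def maximalCompact : Subgroup (GL (Fin 2) F) where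
  carrier := {g | (∀ i j, ‖g i j‖ ≤ 1) ∧ ‖(g : Matrix (Fin 2) (Fin 2) F).det‖ = 1}
  one_mem' := by
    refine ⟨fun i j => ?_, by simp⟩
    fin_cases i <;> fin_cases j <;> simp
  mul_mem' := by
    rintro a b ⟨ha, ha'⟩ ⟨hb, hb'⟩
    refine ⟨fun i j => ?_, by simp [Matrix.det_mul, ha', hb']⟩
    rw [Units.val_mul, Matrix.mul_apply, Fin.sum_univ_two]
    exact norm_add_le_of (norm_mul_le_of (ha _ _) (hb _ _)) (norm_mul_le_of (ha _ _) (hb _ _))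
  inv_mem' := by
    rintro a ⟨ha, ha'⟩
    refine ⟨fun i j => ?_, norm_det_eq_one_inv ha'⟩
    rw [inv_entries]
    fin_cases i <;> fin_cases j <;> simp [ha', ha]

variable (F) in
/-- The principal congruence subgroup `K(l)` of `K₀`: `K(0) = K₀`, and
`K(l) = 1 + Mat₂(𝔭 ^ l)` for `l ≥ 1`. -/
def principalCongruence (l : ℕ) : Subgroup (GL (Fin 2) F) where
  carrier := {g | g ∈ maximalCompact F ∧
    ∀ i j, ‖((g : Matrix (Fin 2) (Fin 2) F) - 1) i j‖ ≤ (residueCard F : ℝ) ^ (-(l : ℤ))}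
  one_mem' := by
    refine ⟨one_mem _, fun i j => ?_⟩
    simp only [Units.val_one, sub_self, Matrix.zero_apply, norm_zero]
    positivity
  mul_mem' := by
    rintro a b ⟨ha, ha'⟩ ⟨hb, hb'⟩
    refine ⟨mul_mem ha hb, fun i j => ?_⟩
    have h : ((a * b : GL (Fin 2) F) : Matrix (Fin 2) (Fin 2) F) - 1
        = (a : Matrix (Fin 2) (Fin 2) F) * ((b : Matrix (Fin 2) (Fin 2) F) - 1)
          + ((a : Matrix (Fin 2) (Fin 2) F) - 1) := by
      rw [Units.val_mul]; noncomm_ring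
    rw [h, Matrix.add_apply, Matrix.mul_apply, Fin.sum_univ_two]
    exact norm_add_le_of (norm_add_le_of (norm_mul_le_of (ha.1 _ _) (hb' _ _))
      (norm_mul_le_of (ha.1 _ _) (hb' _ _))) (ha' _ _)
  inv_mem' := by
    rintro a ⟨ha, ha'⟩
    have hi := inv_mem ha
    refine ⟨hi, fun i j => ?_⟩
    have h : ((a⁻¹ : GL (Fin 2) F) : Matrix (Fin 2) (Fin 2) F) - 1
        = -(((a⁻¹ : GL (Fin 2) F) : Matrix (Fin 2) (Fin 2) F)
            * ((a : Matrix (Fin 2) (Fin 2) F) - 1)) := by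
      rw [mul_sub, ← Units.val_mul]; simp
    rw [h, Matrix.neg_apply, norm_neg, Matrix.mul_apply, Fin.sum_univ_two]
    exact norm_add_le_of (norm_mul_le_of (hi.1 _ _) (ha' _ _))
      (norm_mul_le_of (hi.1 _ _) (ha' _ _))

variable (F) in
/-- `K_H(m, m')`: matrices in `GL₂(𝒪)` with lower left entry in `𝔭 ^ m` and upper right entry in
`𝔭 ^ m'`. -/
def heckeGroup (m m' : ℕ) : Subgroup (GL (Fin 2) F) where
  carrier := {g | g ∈ maximalCompact F ∧ ‖g 1 0‖ ≤ (residueCard F : ℝ) ^ (-(m : ℤ)) ∧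
    ‖g 0 1‖ ≤ (residueCard F : ℝ) ^ (-(m' : ℤ))}
  one_mem' := by
    refine ⟨one_mem _, ?_, ?_⟩ <;> simp
  mul_mem' := by
    rintro a b ⟨ha, ha', ha''⟩ ⟨hb, hb', hb''⟩
    refine ⟨mul_mem ha hb, ?_, ?_⟩ <;>
      rw [Units.val_mul, Matrix.mul_apply, Fin.sum_univ_two]
    · exact norm_add_le_of (norm_mul_le_of' ha' (hb.1 _ _)) (norm_mul_le_of (ha.1 _ _) hb')
    · exact norm_add_le_of (norm_mul_le_of (ha.1 _ _) hb'') (norm_mul_le_of' ha'' (hb.1 _ _))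
  inv_mem' := by
    rintro a ⟨ha, ha', ha''⟩
    refine ⟨inv_mem ha, ?_, ?_⟩ <;> rw [inv_entries]
    · simpa [ha.2] using ha'
    · simpa [ha.2] using ha''

/-- The upper triangular matrix with diagonal entries `t₁, t₂` and upper right entry `x`. -/
def upperTri (t₁ t₂ : Fˣ) (x : F) : GL (Fin 2) F :=
  GeneralLinearGroup.mkOfDetNeZero !![(t₁ : F), x; 0, (t₂ : F)] (by simp [Matrix.det_fin_two])

variable (F) in
/-- The long Weyl element. -/
def weyl : GL (Fin 2) F :=
  GeneralLinearGroup.mkOfDetNeZero !![0, 1; -1, 0] (by simp [Matrix.det_fin_two])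

variable (F) in
/-- The diagonal torus `D`. -/
def diagonalTorus : Subgroup (GL (Fin 2) F) where
  carrier := {g | g 0 1 = 0 ∧ g 1 0 = 0}
  one_mem' := by simp
  mul_mem' := by
    rintro a b ⟨ha, ha'⟩ ⟨hb, hb'⟩
    constructor <;> rw [Units.val_mul, Matrix.mul_apply, Fin.sum_univ_two] <;>
      simp [ha, ha', hb, hb']
  inv_mem' := by
    rintro a ⟨ha, ha'⟩
    constructor <;> rw [inv_entries] <;> simp [ha, ha']

/-- The group `E^×` for `E = F(√δ)`, embedded in `GL₂(F)` by sending `a + b √δ` to the matrix with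
rows `(a, b)` and `(b δ, a)`. -/
def quadraticTorus (δ : F) : Subgroup (GL (Fin 2) F) where
  carrier := {g | g 1 1 = g 0 0 ∧ g 1 0 = g 0 1 * δ}
  one_mem' := by simp
  mul_mem' := by
    rintro a b ⟨ha, ha'⟩ ⟨hb, hb'⟩
    constructor <;> rw [Units.val_mul] <;>
      simp only [Matrix.mul_apply, Fin.sum_univ_two, ha, ha', hb, hb'] <;> ring
  inv_mem' := by
    rintro a ⟨ha, ha'⟩
    constructor <;> rw [inv_entries] <;> simp [ha, ha', mul_assoc]

/-- The matrix with rows `(b, -1/2)` and `(1, 1/(2b))`, of determinant one. -/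
def shiftMatrix [CharZero F] (b : Fˣ) : GL (Fin 2) F :=
  GeneralLinearGroup.mkOfDetNeZero !![(b : F), -(1 / 2); 1, 1 / (2 * (b : F))] (by
    have hb : (b : F) ≠ 0 := b.ne_zero
    have h2 : (2 : F) ≠ 0 := two_ne_zero
    have h : (!![(b : F), -(1 / 2); 1, 1 / (2 * (b : F))]).det = 1 := by
      rw [Matrix.det_fin_two_of]; field_simp; norm_num
    rw [h]; exact one_ne_zero)

/-- The set `T(𝒪) · K(n)` for a torus `T`, where `T(𝒪) = T ∩ GL₂(𝒪)`. -/
def thickenedTorus (T : Subgroup (GL (Fin 2) F)) (n : ℕ) : Set (GL (Fin 2) F) :=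
  ((T ⊓ maximalCompact F : Subgroup (GL (Fin 2) F)) : Set (GL (Fin 2) F)) *
    (principalCongruence F n : Set (GL (Fin 2) F))

open Classical in
/-- The distance `d_H(g)` of `g ∈ K₀` to a (closed) subgroup `H ≤ K₀`: it is `q ^ (-l)` if
`g ∈ H K(l) ∖ H K(l+1)`, and `0` if there is no such `l`, that is, if `g ∈ H`. -/
def subgroupDist (H : Subgroup (GL (Fin 2) F)) (g : GL (Fin 2) F) : ℝ :=
  if h : ∃ l : ℕ, g ∈ (H : Set (GL (Fin 2) F)) * (principalCongruence F l : Set (GL (Fin 2) F)) ∧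
      g ∉ (H : Set (GL (Fin 2) F)) * (principalCongruence F (l + 1) : Set (GL (Fin 2) F))
  then (residueCard F : ℝ) ^ (-(Nat.find h : ℤ)) else 0

/-- `min (q^{-n/2} d_{H(2n)}(g)^{-1/2}, 1)`, where `H(2n) = K_H(2n, 2n)`; it is `1` if the distance
is zero. -/
def decayFactor (n : ℕ) (g : GL (Fin 2) F) : ℝ :=
  if subgroupDist (heckeGroup F (2 * n) (2 * n)) g = 0 then 1
  else min ((residueCard F : ℝ) ^ (-(n : ℝ) / 2) /
    (subgroupDist (heckeGroup F (2 * n) (2 * n)) g) ^ (1 / 2 : ℝ)) 1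

end Groups

section Characters

variable {F : Type u} [NontriviallyNormedField F] [IsUltrametricDist F]

/-- `ψ` is unramified: trivial on `𝒪` but not on `𝔭⁻¹`. -/
def IsUnramified (ψ : AddChar F Circle) : Prop :=
  (∀ x : F, ‖x‖ ≤ 1 → ψ x = 1) ∧ ∃ x : F, ‖x‖ ≤ residueCard F ∧ ψ x ≠ 1

/-- `a(χ) = m` for a character `χ` of `F^×`: `m` is minimal such that `χ` is trivial on the units
congruent to `1` modulo `𝔭 ^ m`. -/
def HasCondExp (χ : Fˣ →* Circle) (m : ℕ) : Prop :=
  IsLeast {k : ℕ | ∀ t : Fˣ, ‖(t : F)‖ = 1 → ‖(t : F) - 1‖ ≤ (residueCard F : ℝ) ^ (-(k : ℤ)) →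
    χ t = 1} m

/-- `a(θ) = m` for a character `θ` of `E^×`, `E = F(√δ)` unramified over `F`. The units of `E`
congruent to `1` modulo `𝔭_E ^ k` are the elements of `E^× ∩ K(k)`. -/
def HasQuadraticCondExp {δ : F} (θ : quadraticTorus δ →* Circle) (m : ℕ) : Prop :=
  IsLeast {k : ℕ | ∀ x : quadraticTorus δ,
    (x : GL (Fin 2) F) ∈ principalCongruence F k → θ x = 1} m

/-- `θ_τ(k) = ψ(tr(τ (k - 1)))`, a character of `K(r)` for `τ ∈ Mat₂(𝔭 ^ (-2r))`. -/
def latticeCharacter (ψ : AddChar F Circle) (τ : Matrix (Fin 2) (Fin 2) F) (k : GL (Fin 2) F) :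
    Circle :=
  ψ (τ * ((k : Matrix (Fin 2) (Fin 2) F) - 1)).trace

end Characters

section Representations

set_option linter.unusedSectionVars false

variable {F : Type u} [NontriviallyNormedField F] [IsUltrametricDist F]

/-- A function on `GL₂(F)` is smooth (on the right) if it is right invariant under an open
subgroup. -/
def RightSmooth (f : GL (Fin 2) F → ℂ) : Prop :=
  ∃ W : Subgroup (GL (Fin 2) F), IsOpen (W : Set (GL (Fin 2) F)) ∧ ∀ g, ∀ k ∈ W, f (g * k) = f g

theorem RightSmooth.add {f f' : GL (Fin 2) F → ℂ} (hf : RightSmooth f) (hf' : RightSmooth f') :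
    RightSmooth (f + f') := by
  obtain ⟨W, hW, h⟩ := hf
  obtain ⟨W', hW', h'⟩ := hf'
  exact ⟨W ⊓ W', hW.inter hW', fun g k hk => by
    simp [h g k hk.1, h' g k hk.2]⟩

/-- The space of the principal series `χ ⊞ χ⁻¹` for a unitary character `χ`: smooth functions with
`f(b g) = χ(t₁/t₂) |t₁/t₂|^{1/2} f(g)` for `b` upper triangular with diagonal `(t₁, t₂)`. The group
acts by right translation. -/
def principalSeries (χ : Fˣ →* Circle) : Submodule ℂ (GL (Fin 2) F → ℂ) where
  carrier := {f | RightSmooth f ∧ ∀ (t₁ t₂ : Fˣ) (x : F) (g : GL (Fin 2) F),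
    f (upperTri t₁ t₂ x * g) =
      (χ (t₁ / t₂) : ℂ) * ((‖(t₁ : F) / (t₂ : F)‖ ^ (1 / 2 : ℝ) : ℝ) : ℂ) * f g}
  zero_mem' := ⟨⟨⊤, isOpen_univ, by simp⟩, by simp⟩
  add_mem' := by
    rintro f f' ⟨hf, h⟩ ⟨hf', h'⟩
    refine ⟨hf.add hf', fun t₁ t₂ x g => ?_⟩
    rw [Pi.add_apply, Pi.add_apply, h, h', mul_add]
  smul_mem' := by
    rintro c f ⟨⟨W, hW, hf⟩, h⟩
    refine ⟨⟨W, hW, fun g k hk => by simp [hf g k hk]⟩, fun t₁ t₂ x g => ?_⟩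
    rw [Pi.smul_apply, Pi.smul_apply, h, smul_eq_mul, smul_eq_mul]; ring

/-- The space of the compactly induced representation `c-Ind_J^G(Λ)`, where `J = E^× K(r)` and
`Λ(x k) = θ(x) θ_β(k)` for `x ∈ E^×`, `k ∈ K(r)`: smooth functions with `f(j g) = Λ(j) f(g)` whose
support is compact modulo `J`. The group acts by right translation. -/
def compactInduction (ψ : AddChar F Circle) (r : ℕ) {δ : F} (θ : quadraticTorus δ →* Circle)
    (β : Matrix (Fin 2) (Fin 2) F) : Submodule ℂ (GL (Fin 2) F → ℂ) where
  carrier := {f | RightSmooth f ∧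
    (∀ (x : quadraticTorus δ), ∀ k ∈ principalCongruence F r, ∀ g : GL (Fin 2) F,
      f ((x : GL (Fin 2) F) * k * g) = (θ x : ℂ) * (latticeCharacter ψ β k : ℂ) * f g) ∧
    ∃ Ω : Set (GL (Fin 2) F), IsCompact Ω ∧ Function.support f ⊆
      (quadraticTorus δ : Set (GL (Fin 2) F)) * (principalCongruence F r : Set (GL (Fin 2) F)) * Ω}
  zero_mem' := ⟨⟨⊤, isOpen_univ, by simp⟩, by simp, ∅, isCompact_empty, by simp⟩
  add_mem' := by
    rintro f f' ⟨hf, h, Ω, hΩ, hs⟩ ⟨hf', h', Ω', hΩ', hs'⟩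
    refine ⟨hf.add hf', fun x k hk g => ?_, Ω ∪ Ω', hΩ.union hΩ', ?_⟩
    · rw [Pi.add_apply, Pi.add_apply, h x k hk, h' x k hk, mul_add]
    · refine (Function.support_add f f').trans (Set.union_subset ?_ ?_)
      · exact hs.trans (Set.mul_subset_mul_left Set.subset_union_left)
      · exact hs'.trans (Set.mul_subset_mul_left Set.subset_union_right)
  smul_mem' := by
    rintro c f ⟨⟨W, hW, hf⟩, h, Ω, hΩ, hs⟩
    refine ⟨⟨W, hW, fun g k hk => by simp [hf g k hk]⟩, fun x k hk g => ?_, Ω, hΩ, ?_⟩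
    · rw [Pi.smul_apply, Pi.smul_apply, h x k hk, smul_eq_mul, smul_eq_mul]; ring
    · exact (Function.support_const_smul_subset c f).trans hs

variable {V : Type v} [NormedAddCommGroup V] [InnerProductSpace ℂ V]

/-- `π` is equivalent to the representation of `GL₂(F)` by right translation on `S`. -/
def EquivRightTranslation (π : Representation ℂ (GL (Fin 2) F) V)
    (S : Submodule ℂ (GL (Fin 2) F → ℂ)) : Prop :=
  ∃ φ : V ≃ₗ[ℂ] S, ∀ (g : GL (Fin 2) F) (v : V) (h : GL (Fin 2) F),
    (φ (π g v) : GL (Fin 2) F → ℂ) h = (φ v : GL (Fin 2) F → ℂ) (h * g)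

/-- `π` is an irreducible unitary smooth representation with trivial central character. Its space
`V` is a pre-Hilbert space (the smooth vectors; no completeness is required). -/
structure IsIrreducibleUnitary (π : Representation ℂ (GL (Fin 2) F) V) : Prop where
  irreducible : π.IsIrreducible
  smooth : ∀ v : V, IsOpen {g : GL (Fin 2) F | π g v = v}
  unitary : ∀ (g : GL (Fin 2) F) (v w : V), inner ℂ (π g v) (π g w) = inner ℂ v w
  central : ∀ (z : Fˣ) (v : V), π (upperTri z z 0) v = v

/-- The exponent conductor of `π` is `m`: `m` is minimal such that `π` has a non-zero vector fixed
by `K_H(m) = K_H(m, 0)`. -/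
def HasConductor (π : Representation ℂ (GL (Fin 2) F) V) (m : ℕ) : Prop :=
  IsLeast {k : ℕ | ∃ v : V, v ≠ 0 ∧ ∀ g ∈ heckeGroup F k 0, π g v = v} m

/-- `v` is the normalised `K_H(2n, 2n)`-invariant generalised new-vector (`π` of conductor `4n`). -/
def IsNewVector (π : Representation ℂ (GL (Fin 2) F) V) (n : ℕ) (v : V) : Prop :=
  ‖v‖ = 1 ∧ ∀ g ∈ heckeGroup F (2 * n) (2 * n), π g v = v

/-- The `K₀`-representation generated by a vector. -/
def generatedType (π : Representation ℂ (GL (Fin 2) F) V) (v : V) : Submodule ℂ V :=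
  Submodule.span ℂ {w | ∃ k ∈ maximalCompact F, w = π k v}

/-- `π = χ ⊞ χ⁻¹` with `a(χ) = 2n`, `v = π(c₁) v_ML / ‖v_ML‖` for the standard microlocal lift vector
`v_ML`, and `T = c₁ D c₁⁻¹`. Here `χ(1 + ϖ^n x) = ψ(b x ϖ^{-n})` for `x ∈ 𝒪`, the matrix `c₁` is
`shiftMatrix b`, and `v_ML` is a non-zero vector on which `D(𝒪) K(n)` acts by the character
`diag(t₁, t₂) k ↦ χ(t₁/t₂) θ_τ(k)`, `τ = ϖ^{-2n} diag(b, -b)`. -/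
def IsMicrolocalLiftTest [CharZero F] (ψ : AddChar F Circle) (ϖ : F)
    (π : Representation ℂ (GL (Fin 2) F) V) (n : ℕ) (v : V) (T : Subgroup (GL (Fin 2) F)) : Prop :=
  ∃ (χ : Fˣ →* Circle) (b : Fˣ) (vML : V),
    Continuous χ ∧ HasCondExp χ (2 * n) ∧ EquivRightTranslation π (principalSeries χ) ∧
    ‖(b : F)‖ = 1 ∧
    (∀ (x : F) (t : Fˣ), ‖x‖ ≤ 1 → (t : F) = 1 + ϖ ^ n * x →
      χ t = ψ ((b : F) * x * ϖ ^ (-(n : ℤ)))) ∧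
    vML ≠ 0 ∧
    (∀ t₁ t₂ : Fˣ, ‖(t₁ : F)‖ = 1 → ‖(t₂ : F)‖ = 1 → ∀ k ∈ principalCongruence F n,
      π (upperTri t₁ t₂ 0 * k) vML = ((χ (t₁ / t₂) : ℂ) *
        (latticeCharacter ψ (ϖ ^ (-(2 * n : ℤ)) • !![(b : F), 0; 0, -(b : F)]) k : ℂ)) • vML) ∧
    v = ((‖vML‖⁻¹ : ℝ) : ℂ) • π (shiftMatrix b) vML ∧
    T = (diagonalTorus F).map (MulAut.conj (shiftMatrix b)).toMonoidHom

/-- `π = c-Ind_J^G(Λ)` is the supercuspidal representation attached to a character `θ` of `E^×`,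
where `E = F(√δ)` is the unramified quadratic extension, `θ` is trivial on `F^×`, `a(θ) = 2n`, and
`θ(1 + u) = ψ_E(β u)` for `u ∈ 𝔭_E^n` (with `β ∈ 𝔭_E^{-2n}`); `v = v_MV / ‖v_MV‖` for a minimal vector
`v_MV`, i.e. a non-zero vector on which `J¹ = (1 + 𝔭_E) K(n)` acts by the character
`x k ↦ θ(x) θ_β(k)`; and `T = E^×`. -/
def IsMinimalVectorTest (ψ : AddChar F Circle)
    (π : Representation ℂ (GL (Fin 2) F) V) (n : ℕ) (v : V) (T : Subgroup (GL (Fin 2) F)) : Prop :=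
  ∃ (δ : F) (θ : quadraticTorus δ →* Circle) (β₀ β₁ : F) (vMV : V),
    ‖δ‖ = 1 ∧ ¬ IsSquare δ ∧ Continuous θ ∧
    (∀ x : quadraticTorus δ, (x : GL (Fin 2) F) 0 1 = 0 → θ x = 1) ∧
    HasQuadraticCondExp θ (2 * n) ∧
    ‖β₀‖ ≤ (residueCard F : ℝ) ^ (2 * n) ∧ ‖β₁‖ ≤ (residueCard F : ℝ) ^ (2 * n) ∧
    (∀ x : quadraticTorus δ, (x : GL (Fin 2) F) ∈ principalCongruence F n →
      θ x = latticeCharacter ψ !![β₀, β₁; β₁ * δ, β₀] (x : GL (Fin 2) F)) ∧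
    EquivRightTranslation π (compactInduction ψ n θ !![β₀, β₁; β₁ * δ, β₀]) ∧
    vMV ≠ 0 ∧
    (∀ x : quadraticTorus δ, (x : GL (Fin 2) F) ∈ principalCongruence F 1 →
      ∀ k ∈ principalCongruence F n,
        π ((x : GL (Fin 2) F) * k) vMV =
          ((θ x : ℂ) * (latticeCharacter ψ !![β₀, β₁; β₁ * δ, β₀] k : ℂ)) • vMV) ∧
    v = ((‖vMV‖⁻¹ : ℝ) : ℂ) • vMV ∧
    T = quadraticTorus δ

open Classical in
/-- The truncated matrix coefficient `f(g) = dim(V_new) ⟨v, π(g) v⟩ 1_{K₀}(g)`, where `V_new` is the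
`K₀`-type generated by the new-vector `vnew`. (Mathlib's `inner ℂ` is linear in the second
variable, so `⟨v, π(g) v⟩` is written `inner ℂ (π g v) v`.) -/
def testFunction (π : Representation ℂ (GL (Fin 2) F) V) (vnew v : V) (g : GL (Fin 2) F) : ℂ :=
  if g ∈ maximalCompact F then (Module.finrank ℂ (generatedType π vnew) : ℂ) * inner ℂ (π g v) v
  else 0

/-- `I_γ(φ) = vol(H)^{-2} ∫_H ∫_H φ(x⁻¹ γ y) dx dy`, for `H = H(2n) = K_H(2n, 2n)`. -/
def orbitalIntegral [MeasurableSpace (GL (Fin 2) F)] (μ : Measure (GL (Fin 2) F)) (n : ℕ)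
    (γ : GL (Fin 2) F) (φ : GL (Fin 2) F → ℝ) : ℝ :=
  (μ.real (heckeGroup F (2 * n) (2 * n) : Set (GL (Fin 2) F)) ^ 2)⁻¹ *
    ∫ y in (heckeGroup F (2 * n) (2 * n) : Set (GL (Fin 2) F)),
      ∫ x in (heckeGroup F (2 * n) (2 * n) : Set (GL (Fin 2) F)), φ (x⁻¹ * γ * y) ∂μ ∂μ

end Representations

end PadicNewform

end

/-! Both bounds depend on γ only through the products γ₀₀γ₁₀ and γ₀₁γ₁₁. If both are at most q^(-j)
in absolute value with j ≤ n, then γ or wγ is congruent to a unit diagonal matrix modulo 𝔭^j, and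
the maximum of decay factors is at least q^(-(n-j)/2) (`rpow_le_max_decayFactor`). So it is enough
to save q^(-(n-j)/2), where q^(-j) is the larger product, or j = n if both products are at most
q^(-n).

Orbital integral. In both cases v is an eigenvector of K(n) with character θ_β, β = β₀ + β₁√δ, with
δ a unit and |β₁| ≥ q^(2n). In the microlocal case the shift by c₁ gives this shape with the square
δ = b⁻². If g ∈ K₀ and ⟨v, π(g)v⟩ ≠ 0, then g commutes with √δ modulo 𝔭^n
(`mem_toralGroup_of_inner_ne_zero`), and such g form exactly 𝒰 (`thickenedTorus_quadraticTorus`).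
Hence |f| ≤ dim(V_new)·1_𝒰, and I_γ is bounded by counting pairs (x, y) in H(2n) with x⁻¹γy ∈ 𝒰.
Given y, the x fill at most one coset of H(2n) ∩ 𝒰, a proportion O(q^(-n)). Eliminating x leaves
γ₀₀γ₁₀u² ≡ δγ₀₁γ₁₁w² modulo 𝔭^n for the diagonal entries u, w of y (`norm_quadratic_le`). This fixes
u/w up to sign modulo 𝔭^(n-j), so the y have proportion O(q^(-(n-j))). Finally dim(V_new)·vol(𝒰) is
bounded: vol(𝒰) ≤ 2q^(-2n) by counting cosets, and dim(V_new) ≤ 2q^(2n) because a K(2n)-invariant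
function in the induced model is determined by that many values.

New-vector. Modulo 𝔭^(2n), K(n) is additive. The vector v° is fixed by the diagonal directions,
hence π(γ⁻¹)v° by the direction X = γ⁻¹E₁₁γ, and the coefficient is at most ‖p‖, where p is the
projection of v° to the vectors fixed in that direction. Conjugating by diag(s, 1), which fixes v°,
gives projections p_s of the same length. Two of them are orthogonal once s² and s'² are far enough
apart (`inner_eq_zero_of_ne`): a vector fixed in both directions X_s, X_s' and in the diagonal ones
is fixed by the upper unipotents with entry in 𝔭^(2n-1). Such a vector is orthogonal to v°, for
otherwise the conductor would be smaller than 4n (`inner_newVector_eq_zero`). Bessel's inequality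
for q^(n-j-1) values of s gives |⟨v°, π(γ)v°⟩|² ≤ q^(-(n-j-1)). -/

noncomputable section

namespace PadicNewform

/-! ### Norms, residue systems, squares and characters of the local field. -/

section FieldFacts

variable {F : Type u} [NontriviallyNormedField F] [IsUltrametricDist F]

theorem mem_valuationSubring_iff (x : F) :
    x ∈ (NormedField.valuation (K := F)).valuationSubring ↔ ‖x‖ ≤ 1 := by
  rw [Valuation.mem_valuationSubring_iff, NormedField.valuation_apply, ← NNReal.coe_le_coe]
  simp

theorem residue_eq_zero_iff (x : (NormedField.valuation (K := F)).valuationSubring) :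
    IsLocalRing.residue _ x = 0 ↔ ‖(x : F)‖ < 1 := by
  have hx := (mem_valuationSubring_iff (x : F)).1 x.2
  rw [IsLocalRing.residue_eq_zero_iff, IsLocalRing.mem_maximalIdeal, mem_nonunits_iff]
  constructor
  · intro h
    refine lt_of_le_of_ne hx fun h1 => h ?_
    have h0 : (x : F) ≠ 0 := norm_ne_zero_iff.1 (by rw [h1]; exact one_ne_zero)
    exact IsUnit.of_mul_eq_one (a := x)
      ⟨(x : F)⁻¹, (mem_valuationSubring_iff _).2 (by rw [norm_inv, h1, inv_one])⟩
      (Subtype.ext (mul_inv_cancel₀ h0))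
  · intro h hu
    obtain ⟨y, hy⟩ := hu.exists_right_inv
    have h1 := congrArg
      (fun z : (NormedField.valuation (K := F)).valuationSubring => ‖(z : F)‖) hy
    have hy1 := (mem_valuationSubring_iff (y : F)).1 y.2
    simp only [MulMemClass.coe_mul, norm_mul, OneMemClass.coe_one, norm_one] at h1
    nlinarith [norm_nonneg (x : F), norm_nonneg (y : F)]

/-- An infinite residue field would have `Nat.card` equal to 0, so the uniformiser would have norm 0
and no nonzero element could have norm below 1. Normalisation alone therefore forces finiteness. -/
theorem two_le_residueCard (h : NormalizedNorm F) : 2 ≤ residueCard F := by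
  obtain ⟨ϖ, h1, h2⟩ := h
  have h0 : residueCard F ≠ 0 := by
    intro h0
    rw [h0, Nat.cast_zero, _root_.inv_zero, norm_eq_zero] at h1
    obtain ⟨x, hx⟩ := NormedField.exists_norm_lt_one F
    have := h2 x hx.2
    rw [h1, norm_zero] at this
    linarith [hx.1]
  have : Finite (residueField F) := Nat.finite_of_card_ne_zero h0
  exact Finite.one_lt_card

theorem one_lt_residueCard (h : NormalizedNorm F) : (1 : ℝ) < residueCard F := by
  exact_mod_cast two_le_residueCard h

theorem residueCard_pos (h : NormalizedNorm F) : (0 : ℝ) < residueCard F :=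
  zero_lt_one.trans (one_lt_residueCard h)

theorem finite_residueField (h : NormalizedNorm F) : Finite (residueField F) :=
  Nat.finite_of_card_ne_zero (by have := two_le_residueCard h; unfold residueCard at this; omega)

theorem exists_norm_eq_zpow (h : NormalizedNorm F) (k : ℤ) :
    ∃ x : F, x ≠ 0 ∧ ‖x‖ = (residueCard F : ℝ) ^ k := by
  obtain ⟨ϖ, h1, -⟩ := id h
  have hϖ : ϖ ≠ 0 := by
    rw [← norm_pos_iff, h1]; exact inv_pos.2 (residueCard_pos h)
  exact ⟨ϖ ^ (-k), zpow_ne_zero _ hϖ, by rw [norm_zpow, h1, _root_.inv_zpow', neg_neg]⟩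

/-- Discreteness of the value group: scale by an element of norm q^k and use that the uniformiser
has the largest norm below 1. -/
theorem norm_le_zpow_of_lt (h : NormalizedNorm F) {x : F} {k : ℤ}
    (hx : ‖x‖ < (residueCard F : ℝ) ^ k) : ‖x‖ ≤ (residueCard F : ℝ) ^ (k - 1) := by
  have hq := residueCard_pos h
  obtain ⟨y, hy0, hy⟩ := exists_norm_eq_zpow h k
  obtain ⟨ϖ, h1, h2⟩ := id h
  have hy' : 0 < ‖y‖ := norm_pos_iff.2 hy0
  have := h2 (x / y) (by rw [norm_div, div_lt_one hy', hy]; exact hx)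
  rw [norm_div, h1, div_le_iff₀ hy', hy] at this
  rwa [zpow_sub_one₀ hq.ne', mul_comm]

theorem zpow_le_norm_of_lt (h : NormalizedNorm F) {x : F} {k : ℤ}
    (hx : (residueCard F : ℝ) ^ k < ‖x‖) : (residueCard F : ℝ) ^ (k + 1) ≤ ‖x‖ := by
  by_contra! hc
  have := norm_le_zpow_of_lt h hc
  rw [add_sub_cancel_right] at this
  linarith

theorem exists_norm_eq_zpow_neg (h : NormalizedNorm F) {x : F} {n : ℕ} (hx : ‖x‖ ≤ 1)
    (hn : (residueCard F : ℝ) ^ (-(n : ℤ)) < ‖x‖) :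
    ∃ j < n, ‖x‖ = (residueCard F : ℝ) ^ (-(j : ℤ)) := by
  induction n with
  | zero => simp at hn; linarith
  | succ n ih =>
    rcases lt_or_ge ((residueCard F : ℝ) ^ (-(n : ℤ))) ‖x‖ with h1 | h1
    · obtain ⟨j, hj, h⟩ := ih h1
      exact ⟨j, by omega, h⟩
    · refine ⟨n, by omega, le_antisymm h1 ?_⟩
      have := zpow_le_norm_of_lt h hn
      simpa using this

theorem norm_two (h : ringChar (residueField F) ≠ 2) : ‖(2 : F)‖ = 1 := by
  have h2 : ‖(2 : F)‖ ≤ 1 := by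
    rw [← one_add_one_eq_two]; exact norm_add_le_of norm_one.le norm_one.le
  refine le_antisymm h2 (not_lt.1 fun hlt => h ?_)
  have := (residue_eq_zero_iff (F := F) 2).2 hlt
  rw [map_ofNat] at this
  exact CharP.ringChar_of_prime_eq_zero Nat.prime_two (by exact_mod_cast this)

/-- A finite set of representatives of `𝒪 / 𝔭 ^ m`. -/
structure IsResidueSystem (s : Finset F) (m : ℕ) : Prop where
  card_eq : s.card = residueCard F ^ m
  norm_le : ∀ x ∈ s, ‖x‖ ≤ 1
  complete : ∀ x : F, ‖x‖ ≤ 1 → ∃ r ∈ s, ‖x - r‖ ≤ (residueCard F : ℝ) ^ (-(m : ℤ))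
  eq_of_norm_sub_le : ∀ x ∈ s, ∀ y ∈ s, ‖x - y‖ ≤ (residueCard F : ℝ) ^ (-(m : ℤ)) → x = y

theorem norm_sub_le_of {a b : F} {r : ℝ} (ha : ‖a‖ ≤ r) (hb : ‖b‖ ≤ r) : ‖a - b‖ ≤ r := by
  rw [sub_eq_add_neg]; exact norm_add_le_of ha (by rwa [norm_neg])

theorem zpow_neg_le_one (h : NormalizedNorm F) (m : ℕ) :
    (residueCard F : ℝ) ^ (-(m : ℤ)) ≤ 1 :=
  zpow_le_one_of_nonpos₀ (one_lt_residueCard h).le (by omega)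

theorem exists_residueSystem_one (h : NormalizedNorm F) :
    ∃ s : Finset F, IsResidueSystem s 1 := by
  classical
  have := finite_residueField h
  have := Fintype.ofFinite (residueField F)
  have hs := IsLocalRing.residue_surjective
    (R := (NormedField.valuation (K := F)).valuationSubring)
  have hr := Function.rightInverse_surjInv hs
  set σ := Function.surjInv hs with hσ
  have key : ∀ x y : (NormedField.valuation (K := F)).valuationSubring,
      ‖(x : F) - y‖ ≤ (residueCard F : ℝ) ^ (-((1 : ℕ) : ℤ)) ↔
        IsLocalRing.residue _ x = IsLocalRing.residue _ y := by
    intro x y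
    rw [← sub_eq_zero, ← map_sub, residue_eq_zero_iff]
    constructor
    · intro hle
      refine hle.trans_lt ?_
      simpa using inv_lt_one_of_one_lt₀ (one_lt_residueCard h)
    · intro hlt
      exact norm_le_zpow_of_lt h (k := 0) (by simpa using hlt)
  have hinj : Function.Injective fun a => (σ a : F) :=
    Subtype.val_injective.comp (Function.injective_surjInv hs)
  refine ⟨Finset.univ.image fun a => (σ a : F), ?_, ?_, ?_, ?_⟩
  · rw [Finset.card_image_of_injective _ hinj, Finset.card_univ, pow_one, residueCard,
      Nat.card_eq_fintype_card]
  · simp only [Finset.mem_image, Finset.mem_univ, true_and]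
    rintro _ ⟨a, rfl⟩
    exact (mem_valuationSubring_iff _).1 (σ a).2
  · intro x hx
    refine ⟨_, Finset.mem_image_of_mem _ (Finset.mem_univ
      (IsLocalRing.residue _ (⟨x, (mem_valuationSubring_iff _).2 hx⟩ :
        (NormedField.valuation (K := F)).valuationSubring))), ?_⟩
    exact (key ⟨x, _⟩ _).2 (hr _).symm
  · simp only [Finset.mem_image, Finset.mem_univ, true_and]
    rintro _ ⟨a, rfl⟩ _ ⟨b, rfl⟩ hab
    have := (key _ _).1 hab
    rw [hr, hr] at this
    rw [this]

/-- Expansion in ϖ-adic digits: a + ϖb, with a a representative modulo 𝔭 and b one modulo 𝔭^m. -/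
theorem exists_residueSystem (h : NormalizedNorm F) (m : ℕ) :
    ∃ s : Finset F, IsResidueSystem s m := by
  classical
  have hq := residueCard_pos h
  induction m with
  | zero =>
    refine ⟨{0}, by simp, by simp, fun x hx => ⟨0, by simp, by simpa using hx⟩, by simp⟩
  | succ m ih =>
    obtain ⟨s, hs⟩ := ih
    obtain ⟨t, ht⟩ := exists_residueSystem_one h
    obtain ⟨ϖ, hϖ0, hϖ⟩ := exists_norm_eq_zpow h (-1)
    have hϖp : 0 < ‖ϖ‖ := norm_pos_iff.2 hϖ0
    have hϖ1 : ‖ϖ‖ ≤ 1 := by rw [hϖ]; exact zpow_neg_le_one h 1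
    have e : (residueCard F : ℝ) ^ (-((m + 1 : ℕ) : ℤ))
        = ‖ϖ‖ * (residueCard F : ℝ) ^ (-(m : ℤ)) := by
      rw [hϖ, ← zpow_add₀ hq.ne']; congr 1; push_cast; ring
    have key : ∀ a ∈ t, ∀ b ∈ s, ∀ a' ∈ t, ∀ b' ∈ s,
        ‖(a + ϖ * b) - (a' + ϖ * b')‖ ≤ (residueCard F : ℝ) ^ (-((m + 1 : ℕ) : ℤ)) →
          a = a' ∧ b = b' := by
      intro a ha b hb a' ha' b' hb' hab
      have h1 : a = a' := by
        refine ht.eq_of_norm_sub_le a ha a' ha' ?_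
        have : a - a' = ((a + ϖ * b) - (a' + ϖ * b')) - ϖ * (b - b') := by ring
        rw [this]
        refine norm_sub_le_of (hab.trans ?_) ?_
        · exact zpow_le_zpow_right₀ (one_lt_residueCard h).le (by push_cast; omega)
        · exact norm_mul_le_of' hϖ.le (norm_sub_le_of (hs.norm_le _ hb) (hs.norm_le _ hb'))
      refine ⟨h1, hs.eq_of_norm_sub_le b hb b' hb' ?_⟩
      have : (a + ϖ * b) - (a' + ϖ * b') = ϖ * (b - b') := by rw [h1]; ring
      rw [this, norm_mul, e] at hab
      exact le_of_mul_le_mul_left hab hϖp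
    refine ⟨(t ×ˢ s).image fun p => p.1 + ϖ * p.2, ?_, ?_, ?_, ?_⟩
    · rw [Finset.card_image_of_injOn, Finset.card_product, hs.card_eq, ht.card_eq]
      · ring
      · rintro ⟨a, b⟩ hab ⟨a', b'⟩ hab' heq
        simp only [Finset.coe_product, Set.mem_prod, Finset.mem_coe] at hab hab'
        obtain ⟨h1, h2⟩ := key a hab.1 b hab.2 a' hab'.1 b' hab'.2 (by
          simp only at heq
          rw [heq, sub_self, norm_zero]; positivity)
        rw [h1, h2]
    · simp only [Finset.mem_image, Finset.mem_product]
      rintro _ ⟨p, hp, rfl⟩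
      exact norm_add_le_of (ht.norm_le _ hp.1) (norm_mul_le_of hϖ1 (hs.norm_le _ hp.2))
    · intro x hx
      obtain ⟨a, ha, hxa⟩ := ht.complete x hx
      obtain ⟨b, hb, hxb⟩ := hs.complete ((x - a) / ϖ) (by
        rw [norm_div, div_le_one hϖp, hϖ]; exact hxa)
      refine ⟨a + ϖ * b, Finset.mem_image.2 ⟨(a, b), by simp [ha, hb], rfl⟩, ?_⟩
      have : x - (a + ϖ * b) = ϖ * ((x - a) / ϖ - b) := by field_simp; ring
      rw [this, norm_mul, e]
      exact mul_le_mul_of_nonneg_left hxb hϖp.le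
    · simp only [Finset.mem_image, Finset.mem_product]
      rintro _ ⟨p, hp, rfl⟩ _ ⟨p', hp', rfl⟩ hpp
      obtain ⟨h1, h2⟩ := key _ hp.1 _ hp.2 _ hp'.1 _ hp'.2 hpp
      rw [h1, h2]

/-- Representatives of the units modulo `𝔭 ^ m`; there are at least `q ^ m / 2` of them. -/
theorem exists_unitSystem (h : NormalizedNorm F) (m : ℕ) :
    ∃ s : Finset Fˣ, residueCard F ^ m ≤ 2 * s.card ∧ (∀ x ∈ s, ‖(x : F)‖ = 1) ∧
      ∀ x ∈ s, ∀ y ∈ s, ‖(x : F) - y‖ ≤ (residueCard F : ℝ) ^ (-(m : ℤ)) → x = y := by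
  classical
  have hq := residueCard_pos h
  cases m with
  | zero => exact ⟨{1}, by simp, by simp, by simp⟩
  | succ m =>
    obtain ⟨s, hs⟩ := exists_residueSystem h (m + 1)
    obtain ⟨t, ht⟩ := exists_residueSystem h m
    obtain ⟨ϖ, hϖ0, hϖ⟩ := exists_norm_eq_zpow h (-1)
    have hϖp : 0 < ‖ϖ‖ := norm_pos_iff.2 hϖ0
    have e : (residueCard F : ℝ) ^ (-((m + 1 : ℕ) : ℤ))
        = ‖ϖ‖ * (residueCard F : ℝ) ^ (-(m : ℤ)) := by
      rw [hϖ, ← zpow_add₀ hq.ne']; congr 1; push_cast; ring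
    -- Division by ϖ injects the non-unit classes modulo 𝔭^(m+1) into 𝒪/𝔭^m, so they number at most
    -- q^m ≤ q^(m+1)/2.
    have hnon : ∀ x ∈ s.filter (fun x => ¬ ‖x‖ = 1), ∃ r ∈ t,
        ‖x / ϖ - r‖ ≤ (residueCard F : ℝ) ^ (-(m : ℤ)) := by
      intro x hx
      rw [Finset.mem_filter] at hx
      refine ht.complete _ ?_
      rw [norm_div, div_le_one hϖp, hϖ]
      exact norm_le_zpow_of_lt h (k := 0)
        (by simpa using lt_of_le_of_ne (hs.norm_le x hx.1) hx.2)
    choose! f hf hf' using hnon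
    have hcard : (s.filter (fun x => ¬ ‖x‖ = 1)).card ≤ residueCard F ^ m := by
      rw [← ht.card_eq]
      refine Finset.card_le_card_of_injOn f hf ?_
      intro x hx y hy hxy
      refine hs.eq_of_norm_sub_le x (Finset.mem_filter.1 hx).1 y (Finset.mem_filter.1 hy).1 ?_
      have : x - y = ϖ * ((x / ϖ - f x) - (y / ϖ - f y)) := by
        rw [hxy]; field_simp; ring
      rw [this, norm_mul, e]
      exact mul_le_mul_of_nonneg_left (norm_sub_le_of (hf' x hx) (hf' y hy)) hϖp.le
    have hsum := Finset.card_filter_add_card_filter_not (s := s) (fun x => ‖x‖ = 1)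
    rw [hs.card_eq] at hsum
    have hq2 : 2 * residueCard F ^ m ≤ residueCard F ^ (m + 1) := by
      rw [pow_succ, mul_comm]; exact Nat.mul_le_mul_left _ (two_le_residueCard h)
    refine ⟨((s.filter (fun x => ‖x‖ = 1)).subtype (· ≠ 0)).map
      (⟨fun x => Units.mk0 x.1 x.2, fun x y hxy => Subtype.ext (by simpa using hxy)⟩), ?_, ?_, ?_⟩
    · rw [Finset.card_map, Finset.card_subtype, Finset.filter_true_of_mem]
      · omega
      · intro x hx
        rw [Finset.mem_filter] at hx
        rw [← norm_ne_zero_iff, hx.2]; exact one_ne_zero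
    · simp only [Finset.mem_map, Finset.mem_subtype, Finset.mem_filter]
      rintro _ ⟨x, hx, rfl⟩
      exact hx.2
    · simp only [Finset.mem_map, Finset.mem_subtype, Finset.mem_filter]
      rintro _ ⟨x, hx, rfl⟩ _ ⟨y, hy, rfl⟩ hxy
      exact Units.ext (hs.eq_of_norm_sub_le _ hx.1 _ hy.1 hxy)

/-- Fractional ideals are their own double duals under ψ: if z were larger, the products dz would
exhaust 𝔭⁻¹, on which ψ is nontrivial. -/
theorem norm_le_of_forall_addChar_eq_one (h : NormalizedNorm F) {ψ : AddChar F Circle}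
    (hψ : IsUnramified ψ) {z : F} {k : ℤ}
    (hz : ∀ d : F, ‖d‖ ≤ (residueCard F : ℝ) ^ (-k) → ψ (d * z) = 1) :
    ‖z‖ ≤ (residueCard F : ℝ) ^ k := by
  have hq := residueCard_pos h
  by_contra! hlt
  have h1 := zpow_le_norm_of_lt h hlt
  have hz0 : z ≠ 0 := norm_pos_iff.1 ((zpow_pos hq _).trans hlt)
  obtain ⟨x, hx, hx'⟩ := hψ.2
  refine hx' ?_
  rw [← div_mul_cancel₀ x hz0]
  refine hz _ ?_
  rw [norm_div, div_le_iff₀ (norm_pos_iff.2 hz0)]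
  calc ‖x‖ ≤ (residueCard F : ℝ) ^ (-k) * (residueCard F : ℝ) ^ (k + 1) := by
        rw [← zpow_add₀ hq.ne']; simpa using hx
    _ ≤ _ := mul_le_mul_of_nonneg_left h1 (zpow_pos hq _).le

/-- Elements close to `1` are squares. -/
theorem isSquare_one_add [CompleteSpace F] (h2 : ‖(2 : F)‖ = 1) {u : F} (hu : ‖u‖ < 1) :
    IsSquare (1 + u) := by
  have h20 : (2 : F) ≠ 0 := norm_ne_zero_iff.1 (by rw [h2]; exact one_ne_zero)
  set s : Set F := Metric.closedBall 0 ‖u‖ with hs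
  have hsc : IsComplete s := Metric.isClosed_closedBall.isComplete
  -- A fixed point y of x ↦ (u - x²)/2 satisfies (1 + y)² = 1 + u, and the map contracts the ball of
  -- radius |u| since 2 is a unit.
  have hmaps : Set.MapsTo (fun x : F => (u - x ^ 2) / 2) s s := by
    intro x hx
    rw [hs, mem_closedBall_zero_iff] at hx ⊢
    rw [norm_div, h2, div_one]
    refine norm_sub_le_of le_rfl ?_
    rw [pow_two]
    exact norm_mul_le_of (hx.trans hu.le) hx
  have hcontr : ContractingWith ‖u‖₊ (hmaps.restrict _ s s) := by
    refine ⟨by exact_mod_cast hu, LipschitzWith.of_dist_le_mul ?_⟩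
    rintro ⟨x, hx⟩ ⟨y, hy⟩
    rw [hs, mem_closedBall_zero_iff] at hx hy
    rw [Subtype.dist_eq, Subtype.dist_eq, Set.MapsTo.val_restrict_apply,
      Set.MapsTo.val_restrict_apply, dist_eq_norm, dist_eq_norm]
    have : (u - x ^ 2) / 2 - (u - y ^ 2) / 2 = -((x + y) * (x - y) / 2) := by ring
    rw [this, norm_neg, norm_div, h2, div_one, norm_mul]
    exact mul_le_mul_of_nonneg_right (norm_add_le_of hx hy) (norm_nonneg _)
  obtain ⟨y, -, hy, -⟩ := hcontr.exists_fixedPoint' hsc hmaps (x := 0)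
    (by rw [hs, mem_closedBall_zero_iff, norm_zero]; exact norm_nonneg _)
    (edist_ne_top _ _)
  refine ⟨1 + y, ?_⟩
  have hy' : (u - y ^ 2) / 2 = y := hy
  field_simp at hy'
  linear_combination hy'

/-- The norm form t² - δy² is anisotropic modulo 𝔭. If y were a unit, so would t be, and δy²/t²
would lie in 1 + 𝔭, hence be a square, making δ a square. -/
theorem norm_lt_one_of_norm_sq_sub_lt [CompleteSpace F] (h2 : ‖(2 : F)‖ = 1) {δ : F}
    (hδ : ‖δ‖ = 1) (hsq : ¬ IsSquare δ) {t y : F} (ht : ‖t‖ ≤ 1) (hy : ‖y‖ ≤ 1)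
    (hty : ‖t ^ 2 - δ * y ^ 2‖ < 1) : ‖t‖ < 1 ∧ ‖y‖ < 1 := by
  have hy1 : ‖y‖ < 1 := by
    refine lt_of_le_of_ne hy fun hy1 => hsq ?_
    have ht1 : ‖t‖ = 1 := by
      refine le_antisymm ht (not_lt.1 fun hlt => ?_)
      have h3 : ‖t ^ 2‖ < 1 := by rw [norm_pow]; exact pow_lt_one₀ (norm_nonneg _) hlt two_ne_zero
      have h4 : ‖δ * y ^ 2‖ < 1 := by
        have : δ * y ^ 2 = t ^ 2 - (t ^ 2 - δ * y ^ 2) := by ring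
        rw [this, sub_eq_add_neg]
        refine (IsUltrametricDist.norm_add_le_max _ _).trans_lt (max_lt h3 ?_)
        rwa [norm_neg]
      rw [norm_mul, norm_pow, hδ, hy1] at h4
      norm_num at h4
    have ht0 : t ≠ 0 := norm_ne_zero_iff.1 (by rw [ht1]; exact one_ne_zero)
    have hy0 : y ≠ 0 := norm_ne_zero_iff.1 (by rw [hy1]; exact one_ne_zero)
    obtain ⟨r, hr⟩ := isSquare_one_add h2 (u := -((t ^ 2 - δ * y ^ 2) / t ^ 2)) (by
      rw [norm_neg, norm_div, norm_pow, ht1]; simpa using hty)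
    refine ⟨r * t / y, ?_⟩
    have : δ = (1 + -((t ^ 2 - δ * y ^ 2) / t ^ 2)) * t ^ 2 / y ^ 2 := by field_simp; ring
    rw [this, hr]; field_simp
  refine ⟨?_, hy1⟩
  have h4 : ‖t ^ 2‖ < 1 := by
    have : t ^ 2 = δ * y ^ 2 + (t ^ 2 - δ * y ^ 2) := by ring
    rw [this]
    refine (IsUltrametricDist.norm_add_le_max _ _).trans_lt (max_lt ?_ hty)
    rw [norm_mul, hδ, one_mul, norm_pow]
    exact pow_lt_one₀ (norm_nonneg _) hy1 two_ne_zero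
  rw [norm_pow] at h4
  exact (pow_lt_one_iff_of_nonneg (norm_nonneg _) two_ne_zero).1 h4

end FieldFacts

end PadicNewform

end

noncomputable section

namespace PadicNewform

/-! ### Integral matrices, congruence subgroups and the distance to H(2n). -/

section MatrixFacts

set_option linter.unusedSectionVars false

variable {F : Type u} [NontriviallyNormedField F] [IsUltrametricDist F]

/-- All entries of `M` have norm at most `r`. -/
def EntriesLE (M : Matrix (Fin 2) (Fin 2) F) (r : ℝ) : Prop := ∀ i j, ‖M i j‖ ≤ r

namespace EntriesLE

variable {M N : Matrix (Fin 2) (Fin 2) F} {r s : ℝ}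

theorem mono (hM : EntriesLE M r) (h : r ≤ s) : EntriesLE M s := fun i j => (hM i j).trans h

theorem add (hM : EntriesLE M r) (hN : EntriesLE N r) : EntriesLE (M + N) r :=
  fun i j => norm_add_le_of (hM i j) (hN i j)

theorem sub (hM : EntriesLE M r) (hN : EntriesLE N r) : EntriesLE (M - N) r :=
  fun i j => norm_sub_le_of (hM i j) (hN i j)

theorem neg (hM : EntriesLE M r) : EntriesLE (-M) r :=
  fun i j => by rw [Matrix.neg_apply, norm_neg]; exact hM i j

theorem smul (hM : EntriesLE M r) {c : F} (hc : ‖c‖ ≤ s) (hs : 0 ≤ s) :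
    EntriesLE (c • M) (s * r) := fun i j => by
  rw [Matrix.smul_apply, smul_eq_mul, norm_mul]
  exact mul_le_mul hc (hM i j) (norm_nonneg _) hs

theorem mul (hM : EntriesLE M r) (hN : EntriesLE N s) (hr : 0 ≤ r) : EntriesLE (M * N) (r * s) :=
  fun i j => by
    rw [Matrix.mul_apply, Fin.sum_univ_two]
    refine norm_add_le_of ?_ ?_ <;> rw [norm_mul] <;>
      exact mul_le_mul (hM _ _) (hN _ _) (norm_nonneg _) hr

theorem mul_left (hM : EntriesLE M 1) (hN : EntriesLE N r) : EntriesLE (M * N) r := by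
  simpa using hM.mul hN zero_le_one

theorem mul_right (hM : EntriesLE M r) (hN : EntriesLE N 1) : EntriesLE (M * N) r := by
  have hr : 0 ≤ r := (norm_nonneg _).trans (hM 0 0)
  simpa using hM.mul hN hr

theorem zero (hr : 0 ≤ r) : EntriesLE (0 : Matrix (Fin 2) (Fin 2) F) r := fun i j => by
  simpa using hr

theorem of (h00 : ‖M 0 0‖ ≤ r) (h01 : ‖M 0 1‖ ≤ r) (h10 : ‖M 1 0‖ ≤ r) (h11 : ‖M 1 1‖ ≤ r) :
    EntriesLE M r := by
  intro i j
  fin_cases i <;> fin_cases j <;> assumption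

theorem adjugate (hM : EntriesLE M r) : EntriesLE M.adjugate r := by
  rw [Matrix.adjugate_fin_two]
  refine EntriesLE.of ?_ ?_ ?_ ?_ <;> simp [hM _ _]

end EntriesLE

theorem norm_eq_one_of_norm_sub_lt {a b : F} (ha : ‖a‖ = 1) (hab : ‖b - a‖ < 1) : ‖b‖ = 1 := by
  have : b = a + (b - a) := by ring
  rw [this, IsUltrametricDist.norm_add_eq_max_of_norm_ne_norm (by rw [ha]; exact hab.ne'), ha]
  exact max_eq_left hab.le

theorem mem_maximalCompact_iff {g : GL (Fin 2) F} :
    g ∈ maximalCompact F ↔ EntriesLE (g : Matrix (Fin 2) (Fin 2) F) 1 ∧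
      ‖(g : Matrix (Fin 2) (Fin 2) F).det‖ = 1 := Iff.rfl

theorem mem_principalCongruence_iff {g : GL (Fin 2) F} {l : ℕ} :
    g ∈ principalCongruence F l ↔ g ∈ maximalCompact F ∧
      EntriesLE ((g : Matrix (Fin 2) (Fin 2) F) - 1) ((residueCard F : ℝ) ^ (-(l : ℤ))) := Iff.rfl

theorem entriesLE_coe {g : GL (Fin 2) F} (hg : g ∈ maximalCompact F) :
    EntriesLE (g : Matrix (Fin 2) (Fin 2) F) 1 := hg.1

theorem entriesLE_coe_inv {g : GL (Fin 2) F} (hg : g ∈ maximalCompact F) :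
    EntriesLE ((g⁻¹ : GL (Fin 2) F) : Matrix (Fin 2) (Fin 2) F) 1 := (inv_mem hg).1

theorem coe_mul_coe_inv (g : GL (Fin 2) F) :
    (g : Matrix (Fin 2) (Fin 2) F) * ((g⁻¹ : GL (Fin 2) F) : Matrix (Fin 2) (Fin 2) F) = 1 := by
  rw [← Units.val_mul, mul_inv_cancel, Units.val_one]

theorem coe_inv_mul_coe (g : GL (Fin 2) F) :
    ((g⁻¹ : GL (Fin 2) F) : Matrix (Fin 2) (Fin 2) F) * (g : Matrix (Fin 2) (Fin 2) F) = 1 := by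
  rw [← Units.val_mul, inv_mul_cancel, Units.val_one]

theorem exists_mem_maximalCompact {M : Matrix (Fin 2) (Fin 2) F} (hM : EntriesLE M 1)
    (hd : ‖M.det‖ = 1) :
    ∃ g ∈ maximalCompact F, (g : Matrix (Fin 2) (Fin 2) F) = M :=
  ⟨GeneralLinearGroup.mkOfDetNeZero M (norm_ne_zero_iff.1 (by rw [hd]; exact one_ne_zero)),
    ⟨hM, hd⟩, rfl⟩

theorem zpow_neg_lt_one (h : NormalizedNorm F) {m : ℕ} (hm : 1 ≤ m) :
    (residueCard F : ℝ) ^ (-(m : ℤ)) < 1 :=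
  zpow_lt_one_of_neg₀ (one_lt_residueCard h) (by omega)

theorem norm_det_sub_lt (h : NormalizedNorm F) {m : ℕ} (hm : 1 ≤ m)
    {M N : Matrix (Fin 2) (Fin 2) F} (hM : EntriesLE M 1) (hN : EntriesLE N 1)
    (hMN : EntriesLE (N - M) ((residueCard F : ℝ) ^ (-(m : ℤ)))) : ‖N.det - M.det‖ < 1 := by
  refine lt_of_le_of_lt ?_ (zpow_neg_lt_one h hm)
  have : N.det - M.det = N 0 0 * (N - M) 1 1 + (N - M) 0 0 * M 1 1
      - (N 0 1 * (N - M) 1 0 + (N - M) 0 1 * M 1 0) := by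
    simp only [Matrix.det_fin_two, Matrix.sub_apply]; ring
  rw [this]
  exact norm_sub_le_of
    (norm_add_le_of (norm_mul_le_of (hN _ _) (hMN _ _)) (norm_mul_le_of' (hMN _ _) (hM _ _)))
    (norm_add_le_of (norm_mul_le_of (hN _ _) (hMN _ _)) (norm_mul_le_of' (hMN _ _) (hM _ _)))

theorem entriesLE_one : EntriesLE (1 : Matrix (Fin 2) (Fin 2) F) 1 := by
  refine EntriesLE.of ?_ ?_ ?_ ?_ <;> simp

/-- Matrices congruent to an element of `K₀` lie in `K₀`. -/
theorem exists_mem_maximalCompact_of_sub (h : NormalizedNorm F) {m : ℕ} (hm : 1 ≤ m)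
    {g : GL (Fin 2) F} (hg : g ∈ maximalCompact F) {N : Matrix (Fin 2) (Fin 2) F}
    (hN : EntriesLE (N - (g : Matrix (Fin 2) (Fin 2) F)) ((residueCard F : ℝ) ^ (-(m : ℤ)))) :
    ∃ k ∈ maximalCompact F, (k : Matrix (Fin 2) (Fin 2) F) = N := by
  have hN1 : EntriesLE N 1 := by
    have : N = g + (N - g) := by abel
    rw [this]; exact EntriesLE.add hg.1 (hN.mono (zpow_neg_le_one h m))
  exact exists_mem_maximalCompact hN1
    (norm_eq_one_of_norm_sub_lt hg.2 (norm_det_sub_lt h hm hg.1 hN1 hN))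

theorem exists_coe_eq_one_add (h : NormalizedNorm F) {m : ℕ} (hm : 1 ≤ m)
    {Y : Matrix (Fin 2) (Fin 2) F} (hY : EntriesLE Y ((residueCard F : ℝ) ^ (-(m : ℤ)))) :
    ∃ k ∈ principalCongruence F m, (k : Matrix (Fin 2) (Fin 2) F) = 1 + Y := by
  obtain ⟨k, hk, hkY⟩ := exists_mem_maximalCompact_of_sub h hm (one_mem _) (N := 1 + Y)
    (by simpa using hY)
  exact ⟨k, mem_principalCongruence_iff.2 ⟨hk, by rwa [hkY, add_sub_cancel_left]⟩, hkY⟩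

theorem conj_sub_one (k g : GL (Fin 2) F) :
    ((k * g * k⁻¹ : GL (Fin 2) F) : Matrix (Fin 2) (Fin 2) F) - 1
      = (k : Matrix (Fin 2) (Fin 2) F) * ((g : Matrix (Fin 2) (Fin 2) F) - 1)
        * ((k⁻¹ : GL (Fin 2) F) : Matrix (Fin 2) (Fin 2) F) := by
  rw [mul_sub, sub_mul, mul_one, coe_mul_coe_inv]; simp

theorem conj_mem_principalCongruence {k g : GL (Fin 2) F} {l : ℕ} (hk : k ∈ maximalCompact F)
    (hg : g ∈ principalCongruence F l) : k * g * k⁻¹ ∈ principalCongruence F l := by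
  refine ⟨mul_mem (mul_mem hk hg.1) (inv_mem hk), ?_⟩
  change EntriesLE _ _
  rw [conj_sub_one]
  exact ((entriesLE_coe hk).mul_left hg.2).mul_right (entriesLE_coe_inv hk)

theorem principalCongruence_anti (h : NormalizedNorm F) {l m : ℕ} (hlm : l ≤ m) :
    principalCongruence F m ≤ principalCongruence F l := fun _ hg =>
  ⟨hg.1, EntriesLE.mono hg.2 (zpow_le_zpow_right₀ (one_lt_residueCard h).le (by omega))⟩

theorem principalCongruence_le_heckeGroup (m : ℕ) :
    principalCongruence F m ≤ heckeGroup F m m := fun g hg =>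
  ⟨hg.1, by simpa using hg.2 1 0, by simpa using hg.2 0 1⟩

/-- `g ∈ H K(l)` as soon as `g ≡ h` modulo `𝔭 ^ l` with `h ∈ H`. -/
theorem inv_mul_mem_principalCongruence {g k : GL (Fin 2) F} {l : ℕ} (hg : g ∈ maximalCompact F)
    (hk : k ∈ maximalCompact F)
    (hgk : EntriesLE ((k : Matrix (Fin 2) (Fin 2) F) - (g : Matrix (Fin 2) (Fin 2) F))
      ((residueCard F : ℝ) ^ (-(l : ℤ)))) :
    g⁻¹ * k ∈ principalCongruence F l := by
  refine ⟨mul_mem (inv_mem hg) hk, ?_⟩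
  have : ((g⁻¹ * k : GL (Fin 2) F) : Matrix (Fin 2) (Fin 2) F) - 1
      = ((g⁻¹ : GL (Fin 2) F) : Matrix (Fin 2) (Fin 2) F)
        * ((k : Matrix (Fin 2) (Fin 2) F) - (g : Matrix (Fin 2) (Fin 2) F)) := by
    rw [mul_sub, coe_inv_mul_coe, Units.val_mul]
  change EntriesLE _ _
  rw [this]
  exact (entriesLE_coe_inv hg).mul_left hgk

theorem subgroupDist_nonneg (H : Subgroup (GL (Fin 2) F)) (g : GL (Fin 2) F) :
    0 ≤ subgroupDist H g := by
  unfold subgroupDist; split_ifs <;> positivity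

theorem subgroupDist_heckeGroup_le (h : NormalizedNorm F) (m j : ℕ) {g : GL (Fin 2) F}
    (hg : g ∈ maximalCompact F) (h00 : ‖g 0 0‖ = 1) (h11 : ‖g 1 1‖ = 1)
    (h01 : ‖g 0 1‖ ≤ (residueCard F : ℝ) ^ (-(j : ℤ)))
    (h10 : ‖g 1 0‖ ≤ (residueCard F : ℝ) ^ (-(j : ℤ))) :
    subgroupDist (heckeGroup F m m) g ≤ (residueCard F : ℝ) ^ (-(j : ℤ)) := by
  classical
  unfold subgroupDist
  split_ifs with hex
  · refine zpow_le_zpow_right₀ (one_lt_residueCard h).le (neg_le_neg ?_)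
    by_contra! hlt
    refine (Nat.find_spec hex).2 ?_
    obtain ⟨k, hk, hkM⟩ := exists_mem_maximalCompact (F := F) (M := !![g 0 0, 0; 0, g 1 1])
      (EntriesLE.of (by simp [h00]) (by simp) (by simp) (by simp [h11]))
      (by simp [Matrix.det_fin_two, h00, h11])
    -- The diagonal part of g is in H and agrees with g modulo 𝔭^j, so g ∈ H K(j), against the
    -- failure at a level at most j.
    refine ⟨k, ⟨hk, ?_, ?_⟩, k⁻¹ * g, ?_, by simp⟩
    · rw [hkM]; simp
    · rw [hkM]; simp
    · refine principalCongruence_anti h (by omega : _ ≤ j)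
        (inv_mul_mem_principalCongruence hk hg ?_)
      rw [hkM]
      exact EntriesLE.of (by simp) (by simpa using h01) (by simpa using h10) (by simp)
  · positivity

/-- The decay factor is antitone in the distance, and q^(-n/2)·(q^(-j))^(-1/2) = q^(-(n-j)/2). The
convention at distance 0 gives 1, which is at least as large. -/
theorem rpow_le_decayFactor (h : NormalizedNorm F) {n j : ℕ} (hj : j ≤ n) {g : GL (Fin 2) F}
    (hg : subgroupDist (heckeGroup F (2 * n) (2 * n)) g ≤ (residueCard F : ℝ) ^ (-(j : ℤ))) :
    (residueCard F : ℝ) ^ (-((n - j : ℕ) : ℝ) / 2) ≤ decayFactor n g := by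
  have hq := one_lt_residueCard h
  have hq0 := residueCard_pos h
  have h1 : (residueCard F : ℝ) ^ (-((n - j : ℕ) : ℝ) / 2) ≤ 1 :=
    Real.rpow_le_one_of_one_le_of_nonpos hq.le
      (by have : (0 : ℝ) ≤ (n - j : ℕ) := Nat.cast_nonneg _
          linarith)
  unfold decayFactor
  split_ifs with h0
  · exact h1
  · refine le_min ?_ h1
    have hpos := lt_of_le_of_ne (subgroupDist_nonneg _ g) (Ne.symm h0)
    rw [le_div_iff₀ (Real.rpow_pos_of_pos hpos _)]
    calc _ ≤ (residueCard F : ℝ) ^ (-((n - j : ℕ) : ℝ) / 2)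
          * ((residueCard F : ℝ) ^ (-(j : ℤ))) ^ (1 / 2 : ℝ) :=
        mul_le_mul_of_nonneg_left (Real.rpow_le_rpow hpos.le hg (by norm_num)) (by positivity)
      _ = _ := by
        rw [← Real.rpow_intCast, ← Real.rpow_mul hq0.le, ← Real.rpow_add hq0]
        congr 1
        push_cast [Nat.cast_sub hj]
        ring

theorem coe_weyl : ((weyl F : GL (Fin 2) F) : Matrix (Fin 2) (Fin 2) F) = !![0, 1; -1, 0] := rfl

theorem weyl_mem_maximalCompact : weyl F ∈ maximalCompact F := by
  refine ⟨?_, by rw [coe_weyl]; simp [Matrix.det_fin_two]⟩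
  change EntriesLE _ _
  rw [coe_weyl]
  refine EntriesLE.of ?_ ?_ ?_ ?_ <;> simp

/-- A unit determinant cannot be a difference of two non-unit products. -/
theorem norm_mul_diag_or_antidiag {g : GL (Fin 2) F} (hg : g ∈ maximalCompact F) :
    (‖g 0 0‖ = 1 ∧ ‖g 1 1‖ = 1) ∨ (‖g 0 1‖ = 1 ∧ ‖g 1 0‖ = 1) := by
  have aux : ∀ {a b : F}, ‖a‖ ≤ 1 → ‖b‖ ≤ 1 → 1 ≤ ‖a * b‖ → ‖a‖ = 1 ∧ ‖b‖ = 1 := by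
    intro a b ha hb hab
    rw [norm_mul] at hab
    constructor <;> nlinarith [norm_nonneg a, norm_nonneg b]
  have h2 := hg.2
  rw [Matrix.det_fin_two, sub_eq_add_neg] at h2
  have h3 := IsUltrametricDist.norm_add_le_max ((g : Matrix (Fin 2) (Fin 2) F) 0 0 * g 1 1)
    (-(g 0 1 * g 1 0))
  rw [h2, norm_neg] at h3
  rcases le_max_iff.1 h3 with h4 | h4
  · exact Or.inl (aux (hg.1 _ _) (hg.1 _ _) h4)
  · exact Or.inr (aux (hg.1 _ _) (hg.1 _ _) h4)

/-- When the diagonal entries are units, the two products have the sizes of the off-diagonal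
entries. When the antidiagonal entries are units, left multiplication by w returns to that case.
This is the only place where the maximum over γ and wγ is produced. -/
theorem rpow_le_max_decayFactor (h : NormalizedNorm F) {n j : ℕ} (hj : j ≤ n) {g : GL (Fin 2) F}
    (hg : g ∈ maximalCompact F)
    (h0 : ‖g 0 0 * g 1 0‖ ≤ (residueCard F : ℝ) ^ (-(j : ℤ)))
    (h1 : ‖g 0 1 * g 1 1‖ ≤ (residueCard F : ℝ) ^ (-(j : ℤ))) :
    (residueCard F : ℝ) ^ (-((n - j : ℕ) : ℝ) / 2)
      ≤ max (decayFactor n g) (decayFactor n (weyl F * g)) := by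
  rw [norm_mul] at h0 h1
  rcases norm_mul_diag_or_antidiag hg with ⟨ha, hb⟩ | ⟨ha, hb⟩
  · refine le_max_of_le_left (rpow_le_decayFactor h hj (subgroupDist_heckeGroup_le h _ _ hg ha hb
      ?_ ?_))
    · simpa [hb] using h1
    · simpa [ha] using h0
  · refine le_max_of_le_right (rpow_le_decayFactor h hj (subgroupDist_heckeGroup_le h _ _
      (mul_mem weyl_mem_maximalCompact hg) ?_ ?_ ?_ ?_)) <;>
    simp only [Units.val_mul, coe_weyl, Matrix.mul_apply, Fin.sum_univ_two] <;>
    simp [ha, hb]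
    · simpa [ha] using h1
    · simpa [hb] using h0

end MatrixFacts

end PadicNewform

end

noncomputable section

namespace PadicNewform

/-! ### The additive structure of K(n)/K(2n) and projections to fixed vectors. -/

section LatticeGroups

set_option linter.unusedSectionVars false

variable {F : Type u} [NontriviallyNormedField F] [IsUltrametricDist F]

theorem zpow_neg_mul_self (n : ℕ) :
    (residueCard F : ℝ) ^ (-(n : ℤ)) * (residueCard F : ℝ) ^ (-(n : ℤ))
      = (residueCard F : ℝ) ^ (-((2 * n : ℕ) : ℤ)) := by
  simp only [_root_.zpow_neg, _root_.zpow_natCast, two_mul, _root_.pow_add, mul_inv]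

/-- The elements of `K(n)` congruent modulo `𝔭 ^ (2n)` to some `1 + Y`, `Y ∈ L`. -/
def latticeGroup (n : ℕ) (L : AddSubgroup (Matrix (Fin 2) (Fin 2) F)) :
    Subgroup (GL (Fin 2) F) where
  carrier := {g | g ∈ principalCongruence F n ∧ ∃ Y ∈ L,
    EntriesLE ((g : Matrix (Fin 2) (Fin 2) F) - 1 - Y)
      ((residueCard F : ℝ) ^ (-((2 * n : ℕ) : ℤ)))}
  one_mem' := ⟨one_mem _, 0, zero_mem _, by
    rw [Units.val_one, sub_self, sub_self]; exact EntriesLE.zero (by positivity)⟩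
  mul_mem' := by
    rintro a b ⟨ha, Y, hY, haY⟩ ⟨hb, Z, hZ, hbZ⟩
    refine ⟨mul_mem ha hb, Y + Z, add_mem hY hZ, ?_⟩
    -- The cross term (a - 1)(b - 1) lies in 𝔭^(2n), so multiplication in K(n) is addition modulo
    -- 𝔭^(2n).
    have : ((a * b : GL (Fin 2) F) : Matrix (Fin 2) (Fin 2) F) - 1 - (Y + Z)
        = ((a : Matrix (Fin 2) (Fin 2) F) - 1 - Y) + ((b : Matrix (Fin 2) (Fin 2) F) - 1 - Z)
          + ((a : Matrix (Fin 2) (Fin 2) F) - 1) * ((b : Matrix (Fin 2) (Fin 2) F) - 1) := by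
      rw [Units.val_mul]; noncomm_ring
    rw [this]
    refine (haY.add hbZ).add ?_
    rw [← zpow_neg_mul_self]
    exact EntriesLE.mul ha.2 hb.2 (by positivity)
  inv_mem' := by
    rintro a ⟨ha, Y, hY, haY⟩
    refine ⟨inv_mem ha, -Y, neg_mem hY, ?_⟩
    have : ((a⁻¹ : GL (Fin 2) F) : Matrix (Fin 2) (Fin 2) F) - 1 - -Y
        = -((a : Matrix (Fin 2) (Fin 2) F) - 1 - Y)
          - (((a⁻¹ : GL (Fin 2) F) : Matrix (Fin 2) (Fin 2) F) - 1)
            * ((a : Matrix (Fin 2) (Fin 2) F) - 1) := by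
      rw [sub_mul, mul_sub, coe_inv_mul_coe]; noncomm_ring
    rw [this]
    refine haY.neg.sub ?_
    rw [← zpow_neg_mul_self]
    exact EntriesLE.mul (inv_mem ha).2 ha.2 (by positivity)

theorem latticeGroup_le_maximalCompact (n : ℕ) (L : AddSubgroup (Matrix (Fin 2) (Fin 2) F)) :
    latticeGroup n L ≤ maximalCompact F := fun _ hg => hg.1.1

/-- K(n) acts trivially by conjugation on K(n)/K(2n): the commutator of two matrices with entries in
𝔭^n has entries in 𝔭^(2n). -/
theorem conj_mem_latticeGroup {n : ℕ} {L : AddSubgroup (Matrix (Fin 2) (Fin 2) F)}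
    {k g : GL (Fin 2) F} (hk : k ∈ principalCongruence F n) (hg : g ∈ latticeGroup n L) :
    k * g * k⁻¹ ∈ latticeGroup n L := by
  obtain ⟨hg1, Y, hY, hgY⟩ := hg
  refine ⟨mul_mem (mul_mem hk hg1) (inv_mem hk), Y, hY, ?_⟩
  have : ((k * g * k⁻¹ : GL (Fin 2) F) : Matrix (Fin 2) (Fin 2) F) - 1 - Y
      = ((g : Matrix (Fin 2) (Fin 2) F) - 1 - Y)
        + (((k : Matrix (Fin 2) (Fin 2) F) - 1) * ((g : Matrix (Fin 2) (Fin 2) F) - 1)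
          - ((g : Matrix (Fin 2) (Fin 2) F) - 1) * ((k : Matrix (Fin 2) (Fin 2) F) - 1))
        * ((k⁻¹ : GL (Fin 2) F) : Matrix (Fin 2) (Fin 2) F) := by
    have e : ((k : Matrix (Fin 2) (Fin 2) F) - 1) * ((g : Matrix (Fin 2) (Fin 2) F) - 1)
          - ((g : Matrix (Fin 2) (Fin 2) F) - 1) * ((k : Matrix (Fin 2) (Fin 2) F) - 1)
        = (k : Matrix (Fin 2) (Fin 2) F) * ((g : Matrix (Fin 2) (Fin 2) F) - 1)
          - ((g : Matrix (Fin 2) (Fin 2) F) - 1) * (k : Matrix (Fin 2) (Fin 2) F) := by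
      noncomm_ring
    rw [conj_sub_one, e, sub_mul _ _ ((k⁻¹ : GL (Fin 2) F) : Matrix (Fin 2) (Fin 2) F),
      mul_assoc ((g : Matrix (Fin 2) (Fin 2) F) - 1), coe_mul_coe_inv, mul_one]
    abel
  rw [this]
  refine hgY.add (EntriesLE.mul_right ?_ (entriesLE_coe_inv hk.1))
  rw [← zpow_neg_mul_self]
  exact (EntriesLE.mul hk.2 hg1.2 (by positivity)).sub
    (EntriesLE.mul hg1.2 hk.2 (by positivity))

/-- The multiples of `X` by elements of `𝔭 ^ k`. -/
def lineLattice (k : ℕ) (X : Matrix (Fin 2) (Fin 2) F) :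
    AddSubgroup (Matrix (Fin 2) (Fin 2) F) where
  carrier := {Y | ∃ d : F, ‖d‖ ≤ (residueCard F : ℝ) ^ (-(k : ℤ)) ∧ Y = d • X}
  zero_mem' := ⟨0, by rw [norm_zero]; positivity, by simp⟩
  add_mem' := by
    rintro _ _ ⟨d, hd, rfl⟩ ⟨e, he, rfl⟩
    exact ⟨d + e, norm_add_le_of hd he, by rw [add_smul]⟩
  neg_mem' := by
    rintro _ ⟨d, hd, rfl⟩
    exact ⟨-d, by rwa [norm_neg], by rw [neg_smul]⟩

variable {V : Type v} [NormedAddCommGroup V] [InnerProductSpace ℂ V]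
  {π : Representation ℂ (GL (Fin 2) F) V}

theorem map_mul_apply (π : Representation ℂ (GL (Fin 2) F) V) (g k : GL (Fin 2) F) (v : V) :
    π (g * k) v = π g (π k v) := by rw [map_mul]; rfl

theorem map_inv_apply_apply (π : Representation ℂ (GL (Fin 2) F) V) (g : GL (Fin 2) F) (v : V) :
    π g⁻¹ (π g v) = v := by rw [← map_mul_apply, inv_mul_cancel, map_one]; rfl

theorem map_apply_inv_apply (π : Representation ℂ (GL (Fin 2) F) V) (g : GL (Fin 2) F) (v : V) :
    π g (π g⁻¹ v) = v := by rw [← map_mul_apply, mul_inv_cancel, map_one]; rfl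

theorem inner_map_eq (hu : ∀ (g : GL (Fin 2) F) (v w : V), inner ℂ (π g v) (π g w) = inner ℂ v w)
    (g : GL (Fin 2) F) (v w : V) : inner ℂ (π g v) w = inner ℂ v (π g⁻¹ w) := by
  rw [← hu g v, map_apply_inv_apply]

theorem norm_map_eq (hu : ∀ (g : GL (Fin 2) F) (v w : V), inner ℂ (π g v) (π g w) = inner ℂ v w)
    (g : GL (Fin 2) F) (v : V) : ‖π g v‖ = ‖v‖ := by
  rw [@norm_eq_sqrt_re_inner ℂ, @norm_eq_sqrt_re_inner ℂ, hu]

/-- The translates by `K₀` of a vector fixed by a congruence subgroup are finite in number. -/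
theorem finite_orbit (h : NormalizedNorm F) {m : ℕ} {v : V}
    (hv : ∀ g ∈ principalCongruence F m, π g v = v) :
    {w | ∃ k ∈ maximalCompact F, w = π k v}.Finite := by
  obtain ⟨s, hs⟩ := exists_residueSystem h m
  choose r hr hr' using hs.complete
  -- The vector π(k)v depends only on the entries of k modulo 𝔭^m, for which there are finitely many
  -- choices.
  let f : maximalCompact F → (Fin 2 → Fin 2 → s) := fun k i j => ⟨r (k.1 i j) (k.2.1 i j), hr _ _⟩
  have hf : ∀ k k' : maximalCompact F, f k = f k' → π k.1 v = π k'.1 v := by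
    intro k k' hkk
    have h1 : k.1⁻¹ * k'.1 ∈ principalCongruence F m := by
      refine inv_mul_mem_principalCongruence k.2 k'.2 fun i j => ?_
      have h2 : r (k.1 i j) (k.2.1 i j) = r (k'.1 i j) (k'.2.1 i j) :=
        congrArg Subtype.val (congrFun (congrFun hkk i) j)
      have h3 := norm_sub_le_of (hr' (k'.1 i j) (k'.2.1 i j)) (hr' (k.1 i j) (k.2.1 i j))
      rwa [h2, sub_sub_sub_cancel_right] at h3
    have h4 := hv _ h1
    rw [map_mul_apply] at h4
    rw [← h4, map_apply_inv_apply, h4]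
  have hrange : {w | ∃ k ∈ maximalCompact F, w = π k v}
      = Set.range fun k : maximalCompact F => π k.1 v := by
    ext w
    constructor
    · rintro ⟨k, hk, rfl⟩; exact ⟨⟨k, hk⟩, rfl⟩
    · rintro ⟨k, rfl⟩; exact ⟨k.1, k.2, rfl⟩
  rw [hrange]
  have hfac : Function.FactorsThrough (fun k : maximalCompact F => π k.1 v) f :=
    fun k k' hkk => hf k k' hkk
  have : Set.range (fun k : maximalCompact F => π k.1 v)
      ⊆ Set.range (Function.extend f (fun k : maximalCompact F => π k.1 v) 0) := by
    rintro _ ⟨k, rfl⟩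
    exact ⟨f k, hfac.extend_apply _ _⟩
  exact (Set.finite_range _).subset this

/-- The orthogonal projection of `v` to the vectors fixed by `Γ`. -/
theorem exists_projection
    (hu : ∀ (g : GL (Fin 2) F) (v w : V), inner ℂ (π g v) (π g w) = inner ℂ v w)
    (Γ : Subgroup (GL (Fin 2) F)) {v : V} (hfin : {w | ∃ k ∈ Γ, w = π k v}.Finite) :
    ∃ p : V, (∀ g ∈ Γ, π g p = p) ∧
      (∀ w : V, (∀ g ∈ Γ, π g w = w) → (inner ℂ p w : ℂ) = inner ℂ v w) ∧
      ∀ b : GL (Fin 2) F, (∀ g ∈ Γ, b * g * b⁻¹ ∈ Γ) → (∀ g ∈ Γ, b⁻¹ * g * b ∈ Γ) →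
        π b v = v → π b p = p := by
  classical
  -- The projection is the average over the distinct points of the finite orbit, so neither
  -- completeness of V nor a measure on Γ is needed.
  set O := hfin.toFinset with hO
  have hmem : ∀ w, w ∈ O ↔ ∃ k ∈ Γ, w = π k v := fun w => hfin.mem_toFinset
  have hOpos : O.Nonempty := ⟨v, (hmem v).2 ⟨1, one_mem _, by simp⟩⟩
  have hcard : (O.card : ℂ) ≠ 0 := by exact_mod_cast hOpos.card_pos.ne'
  have hinj : ∀ b : GL (Fin 2) F, Function.Injective (π b) := fun b x y hxy => by
    rw [← map_inv_apply_apply π b x, hxy, map_inv_apply_apply]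
  have hsum : ∀ b : GL (Fin 2) F, (∀ x ∈ O, π b x ∈ O) → π b (∑ x ∈ O, x) = ∑ x ∈ O, x := by
    intro b hb
    have himg : O.image (π b) = O := by
      refine Finset.eq_of_subset_of_card_le (Finset.image_subset_iff.2 hb) ?_
      rw [Finset.card_image_of_injective _ (hinj b)]
    rw [map_sum]
    conv_rhs => rw [← himg, Finset.sum_image (fun x _ y _ hxy => hinj b hxy)]
  refine ⟨(O.card : ℂ)⁻¹ • ∑ x ∈ O, x, fun g hg => ?_, fun w hw => ?_, fun b hb hb' hbv => ?_⟩
  · rw [map_smul, hsum g]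
    intro x hx
    obtain ⟨k, hk, rfl⟩ := (hmem x).1 hx
    exact (hmem _).2 ⟨g * k, mul_mem hg hk, by rw [map_mul_apply]⟩
  · have : ∀ x ∈ O, (inner ℂ x w : ℂ) = inner ℂ v w := by
      intro x hx
      obtain ⟨k, hk, rfl⟩ := (hmem x).1 hx
      rw [inner_map_eq hu, hw _ (inv_mem hk)]
    rw [inner_smul_left, sum_inner, Finset.sum_congr rfl this, Finset.sum_const, nsmul_eq_mul]
    simp only [map_inv₀, Complex.conj_natCast]
    rw [← mul_assoc, inv_mul_cancel₀ hcard, one_mul]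
  · rw [map_smul, hsum b]
    intro x hx
    obtain ⟨k, hk, rfl⟩ := (hmem x).1 hx
    refine (hmem _).2 ⟨b * k * b⁻¹, hb k hk, ?_⟩
    conv_rhs => rw [← hbv]
    rw [← map_mul_apply, ← map_mul_apply, inv_mul_cancel_right]

/-- `w` is fixed by all elements of `K(n)` congruent to `1 + Y` modulo `𝔭 ^ (2n)`. -/
def IsFixedMod (π : Representation ℂ (GL (Fin 2) F) V) (n : ℕ) (w : V)
    (Y : Matrix (Fin 2) (Fin 2) F) : Prop :=
  ∀ g ∈ principalCongruence F n, EntriesLE ((g : Matrix (Fin 2) (Fin 2) F) - 1 - Y)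
    ((residueCard F : ℝ) ^ (-((2 * n : ℕ) : ℤ))) → π g w = w

/-- Any lift of 1 + Y + Z is a lift of 1 + Y times a lift of 1 + Z, because YZ vanishes modulo
𝔭^(2n). -/
theorem IsFixedMod.add (h : NormalizedNorm F) {n : ℕ} (hn : 1 ≤ n) {w : V}
    {Y Z : Matrix (Fin 2) (Fin 2) F} (hY' : EntriesLE Y ((residueCard F : ℝ) ^ (-(n : ℤ))))
    (hZ' : EntriesLE Z ((residueCard F : ℝ) ^ (-(n : ℤ))))
    (hY : IsFixedMod π n w Y) (hZ : IsFixedMod π n w Z) : IsFixedMod π n w (Y + Z) := by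
  intro g hg hgYZ
  obtain ⟨k, hk, hkY⟩ := exists_coe_eq_one_add h hn hY'
  have h1 : π k w = w := hY k hk (by
    rw [hkY, add_sub_cancel_left, sub_self]; exact EntriesLE.zero (by positivity))
  have h2 : π (k⁻¹ * g) w = w := by
    refine hZ _ (mul_mem (inv_mem hk) hg) ?_
    have : ((k⁻¹ * g : GL (Fin 2) F) : Matrix (Fin 2) (Fin 2) F) - 1 - Z
        = ((k⁻¹ : GL (Fin 2) F) : Matrix (Fin 2) (Fin 2) F)
          * (((g : Matrix (Fin 2) (Fin 2) F) - 1 - (Y + Z)) - Y * Z) := by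
      have e : ((g : Matrix (Fin 2) (Fin 2) F) - 1 - (Y + Z)) - Y * Z
          = (g : Matrix (Fin 2) (Fin 2) F) - (k : Matrix (Fin 2) (Fin 2) F)
            - (k : Matrix (Fin 2) (Fin 2) F) * Z := by
        rw [hkY]; noncomm_ring
      rw [e, mul_sub, mul_sub, ← mul_assoc, coe_inv_mul_coe, Units.val_mul, one_mul]
    rw [this]
    refine (entriesLE_coe_inv hk.1).mul_left (hgYZ.sub ?_)
    rw [← zpow_neg_mul_self]
    exact hY'.mul hZ' (by positivity)
  rw [map_mul_apply] at h2
  rw [← map_apply_inv_apply π k (π g w), h2, h1]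

theorem IsFixedMod.conj {n : ℕ} {w : V} {Y : Matrix (Fin 2) (Fin 2) F} {k : GL (Fin 2) F}
    (hk : k ∈ maximalCompact F) (hY : IsFixedMod π n w Y) :
    IsFixedMod π n (π k w) ((k : Matrix (Fin 2) (Fin 2) F) * Y
      * ((k⁻¹ : GL (Fin 2) F) : Matrix (Fin 2) (Fin 2) F)) := by
  intro g hg hgY
  have h1 : π (k⁻¹ * g * k) w = w := by
    have h2 := conj_mem_principalCongruence (inv_mem hk) hg
    rw [inv_inv] at h2
    refine hY _ h2 ?_
    have h3 := conj_sub_one k⁻¹ g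
    rw [inv_inv] at h3
    have : ((k⁻¹ * g * k : GL (Fin 2) F) : Matrix (Fin 2) (Fin 2) F) - 1 - Y
        = ((k⁻¹ : GL (Fin 2) F) : Matrix (Fin 2) (Fin 2) F)
          * ((g : Matrix (Fin 2) (Fin 2) F) - 1 - (k : Matrix (Fin 2) (Fin 2) F) * Y
            * ((k⁻¹ : GL (Fin 2) F) : Matrix (Fin 2) (Fin 2) F))
          * (k : Matrix (Fin 2) (Fin 2) F) := by
      rw [h3, mul_sub _ ((g : Matrix (Fin 2) (Fin 2) F) - 1), sub_mul _ _
        (k : Matrix (Fin 2) (Fin 2) F)]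
      congr 1
      rw [mul_assoc, mul_assoc, mul_assoc, coe_inv_mul_coe, mul_one, ← mul_assoc,
        coe_inv_mul_coe, one_mul]
    rw [this]
    exact ((entriesLE_coe_inv hk).mul_left hgY).mul_right (entriesLE_coe hk)
  have h4 : π k (π (k⁻¹ * g * k) w) = π k w := by rw [h1]
  rwa [← map_mul_apply, ← mul_assoc, ← mul_assoc, mul_inv_cancel, one_mul, map_mul_apply] at h4

theorem forall_mem_latticeGroup_iff {n : ℕ} {w : V}
    {L : AddSubgroup (Matrix (Fin 2) (Fin 2) F)} :
    (∀ g ∈ latticeGroup n L, π g w = w) ↔ ∀ Y ∈ L, IsFixedMod π n w Y :=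
  ⟨fun h Y hY g hg hgY => h g ⟨hg, Y, hY, hgY⟩, fun h g hg => by
    obtain ⟨hg1, Y, hY, hgY⟩ := hg
    exact h Y hY g hg1 hgY⟩

theorem IsFixedMod.principalCongruence (h : NormalizedNorm F) {n : ℕ} {w : V}
    (hw : IsFixedMod π n w 0) : ∀ g ∈ principalCongruence F (2 * n), π g w = w := by
  intro g hg
  refine hw g (principalCongruence_anti h (by omega) hg) ?_
  rw [sub_zero]; exact hg.2

end LatticeGroups

end PadicNewform

end

noncomputable section

namespace PadicNewform

/-! ### Orthogonality to the new-vector forced by the conductor. -/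

section NewVector

set_option linter.unusedSectionVars false

variable {F : Type u} [NontriviallyNormedField F] [IsUltrametricDist F]

theorem coe_upperTri (t₁ t₂ : Fˣ) (x : F) :
    ((upperTri t₁ t₂ x : GL (Fin 2) F) : Matrix (Fin 2) (Fin 2) F) = !![(t₁ : F), x; 0, (t₂ : F)] :=
  rfl

theorem upperTri_mem_maximalCompact {t₁ t₂ : Fˣ} {x : F} (h₁ : ‖(t₁ : F)‖ = 1)
    (h₂ : ‖(t₂ : F)‖ = 1) (hx : ‖x‖ ≤ 1) : upperTri t₁ t₂ x ∈ maximalCompact F := by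
  refine mem_maximalCompact_iff.2 ⟨?_, by rw [coe_upperTri]; simp [Matrix.det_fin_two, h₁, h₂]⟩
  rw [coe_upperTri]
  exact EntriesLE.of h₁.le hx (by simp) h₂.le

theorem upperTri_zero_mem_heckeGroup {t₁ t₂ : Fˣ} (h₁ : ‖(t₁ : F)‖ = 1)
    (h₂ : ‖(t₂ : F)‖ = 1) (m m' : ℕ) : upperTri t₁ t₂ 0 ∈ heckeGroup F m m' :=
  ⟨upperTri_mem_maximalCompact h₁ h₂ (by simp), by rw [coe_upperTri]; simp,
    by rw [coe_upperTri]; simp⟩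

variable {V : Type v} [NormedAddCommGroup V] [InnerProductSpace ℂ V]
  {π : Representation ℂ (GL (Fin 2) F) V}

/-- A vector of `π` fixed by `K_H(2n, 2n-1)` vanishes. -/
theorem eq_zero_of_fixed_heckeGroup (h : NormalizedNorm F) {n : ℕ} (hn : 1 ≤ n)
    (hcond : HasConductor π (4 * n)) {p : V}
    (hp : ∀ g ∈ heckeGroup F (2 * n) (2 * n - 1), π g p = p) : p = 0 := by
  have hq := residueCard_pos h
  by_contra hp0
  obtain ⟨c, hc0, hc⟩ := exists_norm_eq_zpow h (-((2 * n - 1 : ℕ) : ℤ))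
  -- Conjugation by diag(c, 1) with |c| = q^(-(2n-1)) carries K_H(4n-1, 0) into K_H(2n, 2n-1), so a
  -- nonzero p would give conductor at most 4n - 1.
  set a : GL (Fin 2) F := upperTri (Units.mk0 c hc0) 1 0 with ha
  have hle := hcond.2 (show 4 * n - 1 ∈ _ from ⟨π a⁻¹ p, ?_, ?_⟩)
  · omega
  · intro h0
    rw [← map_apply_inv_apply π a p, h0, map_zero] at hp0
    exact hp0 rfl
  · rintro g ⟨hg, hg10, -⟩
    have hmat : ((a * g * a⁻¹ : GL (Fin 2) F) : Matrix (Fin 2) (Fin 2) F)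
        = !![g 0 0, c * g 0 1; g 1 0 / c, g 1 1] := by
      rw [Units.val_mul, Units.val_mul, inv_entries, ha, coe_upperTri,
        Matrix.eta_fin_two (g : Matrix (Fin 2) (Fin 2) F)]
      ext i j
      fin_cases i <;> fin_cases j <;> simp [Matrix.det_fin_two] <;> field_simp
    have h10 : ‖g 1 0 / c‖ ≤ (residueCard F : ℝ) ^ (-((2 * n : ℕ) : ℤ)) := by
      rw [norm_div, div_le_iff₀ (norm_pos_iff.2 hc0), hc, ← zpow_add₀ hq.ne']
      refine hg10.trans (le_of_eq ?_)
      congr 1; omega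
    have h01 : ‖c * g 0 1‖ ≤ (residueCard F : ℝ) ^ (-((2 * n - 1 : ℕ) : ℤ)) :=
      norm_mul_le_of' hc.le (hg.1 _ _)
    have hmem : a * g * a⁻¹ ∈ heckeGroup F (2 * n) (2 * n - 1) := by
      refine ⟨mem_maximalCompact_iff.2 ⟨?_, ?_⟩, ?_, ?_⟩
      · rw [hmat]
        exact EntriesLE.of (hg.1 _ _) (h01.trans (zpow_neg_le_one h _))
          (h10.trans (zpow_neg_le_one h _)) (hg.1 _ _)
      · have := hg.2
        rw [Matrix.det_fin_two] at this
        rw [hmat, Matrix.det_fin_two_of, ← this]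
        congr 2
        field_simp
      · rw [hmat]; exact h10
      · rw [hmat]; exact h01
    have h1 := hp _ hmem
    rw [map_mul_apply, map_mul_apply] at h1
    conv_rhs => rw [← h1]
    rw [map_inv_apply_apply]

theorem IsNewVector.fixed_principalCongruence {n : ℕ} {v : V} (hv : IsNewVector π n v) :
    ∀ g ∈ principalCongruence F (2 * n), π g v = v := fun g hg =>
  hv.2 g (principalCongruence_le_heckeGroup _ hg)

/-- Vectors fixed by the upper triangular unipotent matrices with entry in `𝔭 ^ (2n-1)` are
orthogonal to the new-vector. -/
theorem inner_newVector_eq_zero (h : NormalizedNorm F) {n : ℕ} (hn : 1 ≤ n)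
    (hu : ∀ (g : GL (Fin 2) F) (v w : V), inner ℂ (π g v) (π g w) = inner ℂ v w)
    (hcond : HasConductor π (4 * n)) {v w : V} (hv : IsNewVector π n v)
    (hw : ∀ y : F, ‖y‖ ≤ (residueCard F : ℝ) ^ (-((2 * n - 1 : ℕ) : ℤ)) →
      IsFixedMod π n w (y • !![0, 1; 0, 0])) : (inner ℂ w v : ℂ) = 0 := by
  have hq := one_lt_residueCard h
  set L : AddSubgroup (Matrix (Fin 2) (Fin 2) F) := lineLattice (2 * n - 1) !![0, 1; 0, 0] with hL
  obtain ⟨p, hp, hpin, hpn⟩ := exists_projection hu (latticeGroup n L) (v := v)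
    ((finite_orbit h hv.fixed_principalCongruence).subset (by
      rintro w ⟨k, hk, rfl⟩
      exact ⟨k, latticeGroup_le_maximalCompact n L hk, rfl⟩))
  have hHp : ∀ g ∈ heckeGroup F (2 * n) (2 * n), π g p = p := by
    -- H(2n) normalises the group: since b₁₀ ∈ 𝔭^(2n), bE₁₂b⁻¹ ≡ (b₀₀²/det b)E₁₂ modulo 𝔭^(2n). The
    -- projection p of v therefore stays fixed by H(2n).
    have key : ∀ b ∈ heckeGroup F (2 * n) (2 * n), ∀ g ∈ latticeGroup n L,
        b * g * b⁻¹ ∈ latticeGroup n L := by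
      rintro b hb g ⟨hg, Y, ⟨y, hy, rfl⟩, hgY⟩
      have hbd := hb.1.2
      have hbd0 : (b : Matrix (Fin 2) (Fin 2) F).det ≠ 0 :=
        norm_ne_zero_iff.1 (by rw [hbd]; exact one_ne_zero)
      have hy1 : ‖y‖ ≤ 1 := hy.trans (zpow_neg_le_one h _)
      refine ⟨conj_mem_principalCongruence hb.1 hg,
        (y * (b 0 0 ^ 2 / (b : Matrix (Fin 2) (Fin 2) F).det)) • !![0, 1; 0, 0],
        ⟨_, norm_mul_le_of' hy ?_, rfl⟩, ?_⟩
      · rw [norm_div, hbd, div_one, norm_pow]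
        exact pow_le_one₀ (norm_nonneg _) (hb.1.1 _ _)
      · have e : ((b * g * b⁻¹ : GL (Fin 2) F) : Matrix (Fin 2) (Fin 2) F) - 1
            - (y * (b 0 0 ^ 2 / (b : Matrix (Fin 2) (Fin 2) F).det)) • !![0, 1; 0, 0]
            = (b : Matrix (Fin 2) (Fin 2) F)
              * ((g : Matrix (Fin 2) (Fin 2) F) - 1 - y • !![0, 1; 0, 0])
              * ((b⁻¹ : GL (Fin 2) F) : Matrix (Fin 2) (Fin 2) F)
            + (y * (b : Matrix (Fin 2) (Fin 2) F).det⁻¹ * b 1 0)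
              • !![-(b 0 0), 0; -(b 1 0), b 0 0] := by
          rw [conj_sub_one, mul_sub _ _ (y • _), sub_mul]
          have : y • !![0, 1; 0, 0] = !![0, y; 0, 0] := by
            ext i j; fin_cases i <;> fin_cases j <;> simp
          rw [sub_add, sub_right_inj, this, inv_entries]
          ext i j
          fin_cases i <;> fin_cases j <;>
            simp [Matrix.mul_apply, Fin.sum_univ_two] <;> field_simp <;> ring
        rw [e]
        refine (((entriesLE_coe hb.1).mul_left hgY).mul_right (entriesLE_coe_inv hb.1)).add ?_
        have h10 : ‖y * (b : Matrix (Fin 2) (Fin 2) F).det⁻¹ * b 1 0‖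
            ≤ (residueCard F : ℝ) ^ (-((2 * n : ℕ) : ℤ)) := by
          refine norm_mul_le_of ?_ hb.2.1
          rw [norm_mul, norm_inv, hbd, inv_one, mul_one]; exact hy1
        have := EntriesLE.smul (M := !![-(b 0 0), 0; -(b 1 0), b 0 0]) (r := 1)
          (EntriesLE.of (by simpa using hb.1.1 0 0) (by simp) (by simpa using hb.1.1 1 0)
            (by simpa using hb.1.1 0 0)) h10 (by positivity)
        rwa [mul_one] at this
    intro b hb
    refine hpn b (key b hb) (fun g hg => ?_) (hv.2 b hb)
    simpa using key b⁻¹ (inv_mem hb) g hg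
  have hp0 : p = 0 := by
    refine eq_zero_of_fixed_heckeGroup h hn hcond ?_
    rintro g ⟨hg, hg10, hg01⟩
    have h11 : ‖g 1 1‖ = 1 := by
      rcases norm_mul_diag_or_antidiag hg with hd | hd
      · exact hd.2
      · have := zpow_neg_lt_one h (m := 2 * n) (by omega)
        linarith [hd.2]
    have h110 : g 1 1 ≠ 0 := norm_ne_zero_iff.1 (by rw [h11]; exact one_ne_zero)
    have hy : ‖g 0 1 / g 1 1‖ ≤ (residueCard F : ℝ) ^ (-((2 * n - 1 : ℕ) : ℤ)) := by
      rwa [norm_div, h11, div_one]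
    have hone := zpow_neg_le_one h (2 * n - 1)
    -- Removing this unipotent factor clears the upper right entry of g: H(2n) and the unipotents
    -- with entry in 𝔭^(2n-1) generate K_H(2n, 2n-1).
    set k : GL (Fin 2) F := upperTri 1 1 (g 0 1 / g 1 1) with hk
    have hkK : k ∈ maximalCompact F :=
      upperTri_mem_maximalCompact (by simp) (by simp) (hy.trans hone)
    have hkY : (k : Matrix (Fin 2) (Fin 2) F) - 1 = (g 0 1 / g 1 1) • !![0, 1; 0, 0] := by
      rw [hk, coe_upperTri]
      ext i j; fin_cases i <;> fin_cases j <;> simp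
    have hkL : k ∈ latticeGroup n L := by
      refine ⟨mem_principalCongruence_iff.2 ⟨hkK, ?_⟩, _, ⟨_, hy, rfl⟩, ?_⟩
      · rw [hkY]
        refine EntriesLE.of ?_ ?_ ?_ ?_
        · simp
        · have : ‖g 0 1 / g 1 1‖ ≤ (residueCard F : ℝ) ^ (-(n : ℤ)) :=
            -- Here n ≤ 2n - 1, which is where n ≥ 1 enters.
            hy.trans (zpow_le_zpow_right₀ hq.le (by omega))
          simpa using this
        · simp
        · simp
      · rw [hkY, sub_self]; exact EntriesLE.zero (by positivity)
    have hkg : k⁻¹ * g ∈ heckeGroup F (2 * n) (2 * n) := by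
      refine ⟨mul_mem (inv_mem hkK) hg, ?_, ?_⟩
      · rw [Units.val_mul, inv_entries, hk, coe_upperTri]
        simpa [Matrix.mul_apply, Fin.sum_univ_two, Matrix.det_fin_two] using hg10
      · rw [Units.val_mul, inv_entries, hk, coe_upperTri]
        simp [Matrix.mul_apply, Fin.sum_univ_two, Matrix.det_fin_two, h110]
        positivity
    have h1 := hHp _ hkg
    rw [map_mul_apply] at h1
    rw [← map_apply_inv_apply π k (π g p), h1, hp k hkL]
  have h1 := hpin w (forall_mem_latticeGroup_iff.2 (by
    rintro _ ⟨y, hy, rfl⟩; exact hw y hy))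
  rw [hp0, inner_zero_left] at h1
  rw [← inner_conj_symm, ← h1, map_zero]

end NewVector

end PadicNewform

end

noncomputable section

namespace PadicNewform

/-! ### Decay of the matrix coefficient of the new-vector. -/

section NewVectorCoefficient

set_option linter.unusedSectionVars false

variable {F : Type u} [NontriviallyNormedField F] [IsUltrametricDist F]
  {V : Type v} [NormedAddCommGroup V] [InnerProductSpace ℂ V]
  {π : Representation ℂ (GL (Fin 2) F) V}

/-- A Bessel inequality for a family of orthogonal projections of equal length. -/
theorem card_mul_norm_sq_le_one {ι : Type*} (s : Finset ι) (p : ι → V) {v : V} (hv : ‖v‖ = 1)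
    {c : ℝ} (hpn : ∀ i ∈ s, ‖p i‖ = c)
    (hpv : ∀ i ∈ s, (inner ℂ v (p i) : ℂ) = inner ℂ (p i) (p i))
    (horth : ∀ i ∈ s, ∀ j ∈ s, i ≠ j → (inner ℂ (p i) (p j) : ℂ) = 0) :
    (s.card : ℝ) * c ^ 2 ≤ 1 := by
  have hself : ∀ i ∈ s, (inner ℂ (p i) (p i) : ℂ) = ((c ^ 2 : ℝ) : ℂ) := by
    intro i hi
    rw [inner_self_eq_norm_sq_to_K, hpn i hi]; push_cast; rfl
  have h1 : (inner ℂ v (∑ i ∈ s, p i) : ℂ) = ((s.card * c ^ 2 : ℝ) : ℂ) := by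
    rw [inner_sum, Finset.sum_congr rfl fun i hi => (hpv i hi).trans (hself i hi),
      Finset.sum_const, nsmul_eq_mul]
    push_cast; rfl
  have h2 : ‖∑ i ∈ s, p i‖ ^ 2 = s.card * c ^ 2 := by
    have : (inner ℂ (∑ i ∈ s, p i) (∑ i ∈ s, p i) : ℂ) = ((s.card * c ^ 2 : ℝ) : ℂ) := by
      rw [sum_inner]
      have : ∀ i ∈ s, (inner ℂ (p i) (∑ j ∈ s, p j) : ℂ) = ((c ^ 2 : ℝ) : ℂ) := by
        intro i hi
        rw [inner_sum, Finset.sum_eq_single_of_mem i hi fun j hj hij => horth i hi j hj hij.symm,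
          hself i hi]
      rw [Finset.sum_congr rfl this, Finset.sum_const, nsmul_eq_mul]
      push_cast; rfl
    rw [inner_self_eq_norm_sq_to_K] at this
    apply Complex.ofReal_injective
    rw [← this]; push_cast; rfl
  -- With N projections, the sum S satisfies ⟨v, S⟩ = ‖S‖² = Nc², so Cauchy–Schwarz reads Nc² ≤ ‖S‖.
  have h3 := norm_inner_le_norm (𝕜 := ℂ) v (∑ i ∈ s, p i)
  rw [h1, hv, one_mul, Complex.norm_real, Real.norm_of_nonneg (by positivity)] at h3
  have h4 : 0 ≤ (s.card : ℝ) * c ^ 2 := by positivity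
  nlinarith [norm_nonneg (∑ i ∈ s, p i)]

/-- The conjugate of `X` by `diag(s, 1)`. -/
def diagConj (s : Fˣ) (X : Matrix (Fin 2) (Fin 2) F) : Matrix (Fin 2) (Fin 2) F :=
  !![X 0 0, s * X 0 1; X 1 0 / s, X 1 1]

theorem upperTri_mul_mul_inv (s : Fˣ) (X : Matrix (Fin 2) (Fin 2) F) :
    ((upperTri s 1 0 : GL (Fin 2) F) : Matrix (Fin 2) (Fin 2) F) * X
      * (((upperTri s 1 0)⁻¹ : GL (Fin 2) F) : Matrix (Fin 2) (Fin 2) F) = diagConj s X := by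
  rw [inv_entries, coe_upperTri, Matrix.eta_fin_two X, diagConj]
  ext i j
  fin_cases i <;> fin_cases j <;> simp [Matrix.det_fin_two] <;> field_simp

theorem upperTri_inv_mul_mul (s : Fˣ) (X : Matrix (Fin 2) (Fin 2) F) :
    (((upperTri s 1 0)⁻¹ : GL (Fin 2) F) : Matrix (Fin 2) (Fin 2) F) * diagConj s X
      * ((upperTri s 1 0 : GL (Fin 2) F) : Matrix (Fin 2) (Fin 2) F) = X := by
  rw [← upperTri_mul_mul_inv, ← mul_assoc, ← mul_assoc, coe_inv_mul_coe, one_mul, mul_assoc,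
    coe_inv_mul_coe, mul_one]

theorem entriesLE_diagConj {s : Fˣ} (hs : ‖(s : F)‖ = 1) {X : Matrix (Fin 2) (Fin 2) F}
    (hX : EntriesLE X 1) : EntriesLE (diagConj s X) 1 :=
  EntriesLE.of (hX 0 0) (by simpa [diagConj, hs] using hX 0 1)
    (by simpa [diagConj, hs] using hX 1 0) (hX 1 1)

theorem IsNewVector.isFixedMod_diag {n : ℕ} {v : V} (hv : IsNewVector π n v) (e₁ e₂ : F) :
    IsFixedMod π n v !![e₁, 0; 0, e₂] := by
  intro g hg hgY
  refine hv.2 g ⟨hg.1, ?_, ?_⟩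
  · simpa using hgY 1 0
  · simpa using hgY 0 1

/-- Vectors fixed by two different conjugates are orthogonal after projecting the new-vector. -/
theorem inner_eq_zero_of_ne (h : NormalizedNorm F) {n : ℕ} (hn : 1 ≤ n)
    (hu : ∀ (g : GL (Fin 2) F) (v w : V), inner ℂ (π g v) (π g w) = inner ℂ v w)
    (hcond : HasConductor π (4 * n)) {v : V} (hv : IsNewVector π n v) {j : ℕ} (hj : j < n)
    {X : Matrix (Fin 2) (Fin 2) F} (hX : EntriesLE X 1)
    (hX01 : (residueCard F : ℝ) ^ (-(j : ℤ)) ≤ ‖X 0 1‖) {s s' : Fˣ} (hs : ‖(s : F)‖ = 1)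
    (hs' : ‖(s' : F)‖ = 1)
    (hss : (residueCard F : ℝ) ^ (-((n - j - 1 : ℕ) : ℤ)) ≤ ‖(s : F) ^ 2 - s' ^ 2‖) {p p' : V}
    (hp : ∀ d : F, ‖d‖ ≤ (residueCard F : ℝ) ^ (-(n : ℤ)) → IsFixedMod π n p (d • diagConj s X))
    (hpd : ∀ e₁ e₂ : F, ‖e₁‖ ≤ (residueCard F : ℝ) ^ (-(n : ℤ)) →
      ‖e₂‖ ≤ (residueCard F : ℝ) ^ (-(n : ℤ)) → IsFixedMod π n p !![e₁, 0; 0, e₂])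
    (hp' : ∀ d : F, ‖d‖ ≤ (residueCard F : ℝ) ^ (-(n : ℤ)) →
      IsFixedMod π n p' (d • diagConj s' X))
    (hproj : ∀ w : V, (∀ d : F, ‖d‖ ≤ (residueCard F : ℝ) ^ (-(n : ℤ)) →
      IsFixedMod π n w (d • diagConj s' X)) → (inner ℂ p' w : ℂ) = inner ℂ v w) :
    (inner ℂ p p' : ℂ) = 0 := by
  have hq := residueCard_pos h
  set L : AddSubgroup (Matrix (Fin 2) (Fin 2) F) := lineLattice n (diagConj s' X) with hL
  have hfix : ∀ w : V, (∀ g ∈ latticeGroup n L, π g w = w) ↔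
      ∀ d : F, ‖d‖ ≤ (residueCard F : ℝ) ^ (-(n : ℤ)) →
        IsFixedMod π n w (d • diagConj s' X) := by
    intro w
    rw [forall_mem_latticeGroup_iff]
    constructor
    · intro hw d hd; exact hw _ ⟨d, hd, rfl⟩
    · rintro hw _ ⟨d, hd, rfl⟩; exact hw d hd
  have hp0 : IsFixedMod π n p 0 := by
    have := hp 0 (by rw [norm_zero]; positivity)
    rwa [zero_smul] at this
  -- Projecting p to the directions of p' keeps everything that fixes p, since K(n) normalises the
  -- lattice group. So r is fixed in both families of directions.
  obtain ⟨r, hr, hrin, hrn⟩ := exists_projection hu (latticeGroup n L) (v := p)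
    ((finite_orbit h (hp0.principalCongruence h)).subset (by
      rintro w ⟨k, hk, rfl⟩
      exact ⟨k, latticeGroup_le_maximalCompact n L hk, rfl⟩))
  have htrans : ∀ Y, IsFixedMod π n p Y → IsFixedMod π n r Y := by
    intro Y hY g hg hgY
    refine hrn g (fun k hk => conj_mem_latticeGroup hg hk) (fun k hk => ?_) (hY g hg hgY)
    simpa using conj_mem_latticeGroup (inv_mem hg) hk
  have hr' := (hfix r).1 hr
  have hrv : (inner ℂ r v : ℂ) = 0 := by
    refine inner_newVector_eq_zero h hn hu hcond hv fun y hy => ?_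
    have hX0 : X 0 1 ≠ 0 := norm_pos_iff.1 ((zpow_pos hq _).trans_le hX01)
    have hs0 : (s : F) ^ 2 - s' ^ 2 ≠ 0 := norm_pos_iff.1 ((zpow_pos hq _).trans_le hss)
    -- The combination dX_s + d'X_s' is to have lower left entry 0 and upper right entry y. The
    -- first condition forces d' = -ds'/s, and then dX₀₁(s² - s'²)/s = y. The bounds on X₀₁ and s² -
    -- s'² put d in 𝔭^n exactly because y ∈ 𝔭^(2n-1).
    set d : F := y * s / (((s : F) ^ 2 - s' ^ 2) * X 0 1) with hd
    have hdn : ‖d‖ ≤ (residueCard F : ℝ) ^ (-(n : ℤ)) := by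
      rw [hd, norm_div, norm_mul, hs, mul_one, norm_mul, div_le_iff₀ (by positivity)]
      calc ‖y‖ ≤ (residueCard F : ℝ) ^ (-((2 * n - 1 : ℕ) : ℤ)) := hy
        _ = (residueCard F : ℝ) ^ (-(n : ℤ)) * ((residueCard F : ℝ) ^ (-((n - j - 1 : ℕ) : ℤ))
            * (residueCard F : ℝ) ^ (-(j : ℤ))) := by
          rw [← zpow_add₀ hq.ne', ← zpow_add₀ hq.ne']; congr 1; omega
        _ ≤ _ := by gcongr
    set d' : F := -(d * s' / s) with hd'
    have hdn' : ‖d'‖ ≤ (residueCard F : ℝ) ^ (-(n : ℤ)) := by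
      rw [hd', norm_neg, norm_div, norm_mul, hs, hs', mul_one, div_one]; exact hdn
    have hY1 : EntriesLE (d • diagConj s X) ((residueCard F : ℝ) ^ (-(n : ℤ))) := by
      simpa using (entriesLE_diagConj hs hX).smul hdn (by positivity)
    have hY2 : EntriesLE (d' • diagConj s' X) ((residueCard F : ℝ) ^ (-(n : ℤ))) := by
      simpa using (entriesLE_diagConj hs' hX).smul hdn' (by positivity)
    have hY12 := IsFixedMod.add h hn hY1 hY2 (htrans _ (hp d hdn)) (hr' d' hdn')
    have hsum := hY1.add hY2
    -- The remaining diagonal part is corrected by diagonal directions, which also fix r.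
    have he : y • !![0, 1; 0, 0] = (d • diagConj s X + d' • diagConj s' X)
        + !![-((d • diagConj s X + d' • diagConj s' X) 0 0), 0; 0,
          -((d • diagConj s X + d' • diagConj s' X) 1 1)] := by
      ext i j
      fin_cases i <;> fin_cases j
      · simp
      · simp only [diagConj, hd', hd]
        simp
        field_simp
        ring
      · simp only [diagConj, hd']
        simp
        field_simp
        ring
      · simp
    rw [he]
    refine IsFixedMod.add h hn hsum ?_ hY12 (htrans _ (hpd _ _ ?_ ?_))
    · exact EntriesLE.of (hsum.neg 0 0) (by simp) (by simp) (hsum.neg 1 1)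
    · rw [norm_neg]; exact hsum 0 0
    · rw [norm_neg]; exact hsum 1 1
  -- Thus ⟨p, p'⟩ = ⟨r, p'⟩, and ⟨p', r⟩ = ⟨v, r⟩ = 0.
  rw [← hrin p' ((hfix p').2 hp'), ← inner_conj_symm, hproj r hr', inner_conj_symm, hrv]

/-- The factor s + s' is congruent to the unit 2s', which is why only s in a single class modulo 𝔭
are compared. -/
theorem norm_sq_sub_sq (h2 : ‖(2 : F)‖ = 1) {s s' : F} (hs' : ‖s'‖ = 1) (hss : ‖s - s'‖ < 1) :
    ‖s ^ 2 - s' ^ 2‖ = ‖s - s'‖ := by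
  have : s ^ 2 - s' ^ 2 = (s + s') * (s - s') := by ring
  rw [this, norm_mul, norm_eq_one_of_norm_sub_lt (a := 2 * s') (b := s + s')
    (by rw [norm_mul, h2, hs', one_mul]) (by convert hss using 2; ring), one_mul]

/-- Bessel's inequality for the conjugates of one projection by diag(s, 1), with s running through 1
+ 𝔭 modulo 𝔭^(n-j). These are q^(n-j-1) mutually orthogonal vectors whose common length dominates
the coefficient. -/
theorem norm_sq_inner_newVector_le (h : NormalizedNorm F) (h2 : ‖(2 : F)‖ = 1) {n : ℕ}
    (hn : 1 ≤ n) (hu : ∀ (g : GL (Fin 2) F) (v w : V), inner ℂ (π g v) (π g w) = inner ℂ v w)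
    (hcond : HasConductor π (4 * n)) {v : V} (hv : IsNewVector π n v) {j : ℕ} (hj : j < n)
    {γ : GL (Fin 2) F} (hγ : γ ∈ maximalCompact F)
    (hγj : (residueCard F : ℝ) ^ (-(j : ℤ)) ≤ ‖γ 0 1 * γ 1 1‖) :
    (residueCard F : ℝ) ^ (n - j - 1) * ‖(inner ℂ (π γ v) v : ℂ)‖ ^ 2 ≤ 1 := by
  have hq := residueCard_pos h
  -- The direction E₁₁ fixes v, so X fixes π(γ⁻¹)v. Its upper right entry has the size of γ₀₁γ₁₁.
  set X : Matrix (Fin 2) (Fin 2) F := ((γ⁻¹ : GL (Fin 2) F) : Matrix (Fin 2) (Fin 2) F)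
    * !![1, 0; 0, 0] * (γ : Matrix (Fin 2) (Fin 2) F) with hX
  have hE : EntriesLE (!![1, 0; 0, 0] : Matrix (Fin 2) (Fin 2) F) 1 :=
    EntriesLE.of (by simp) (by simp) (by simp) (by simp)
  have hX1 : EntriesLE X 1 := ((entriesLE_coe_inv hγ).mul_left hE).mul_left (entriesLE_coe hγ)
  have hXγ : (γ : Matrix (Fin 2) (Fin 2) F) * X
      * ((γ⁻¹ : GL (Fin 2) F) : Matrix (Fin 2) (Fin 2) F) = !![1, 0; 0, 0] := by
    rw [hX, ← mul_assoc, ← mul_assoc, coe_mul_coe_inv, one_mul, mul_assoc, coe_mul_coe_inv,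
      mul_one]
  have hX01 : ‖X 0 1‖ = ‖γ 0 1 * γ 1 1‖ := by
    rw [hX, inv_entries]
    simp [Matrix.mul_apply, Fin.sum_univ_two, hγ.2, mul_comm]
  set L : AddSubgroup (Matrix (Fin 2) (Fin 2) F) := lineLattice n X with hL
  have hfix : ∀ w : V, (∀ g ∈ latticeGroup n L, π g w = w) ↔
      ∀ d : F, ‖d‖ ≤ (residueCard F : ℝ) ^ (-(n : ℤ)) → IsFixedMod π n w (d • X) := by
    intro w
    rw [forall_mem_latticeGroup_iff]
    constructor
    · intro hw d hd; exact hw _ ⟨d, hd, rfl⟩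
    · rintro hw _ ⟨d, hd, rfl⟩; exact hw d hd
  obtain ⟨p, hp, hpin, hpn⟩ := exists_projection hu (latticeGroup n L) (v := v)
    ((finite_orbit h hv.fixed_principalCongruence).subset (by
      rintro w ⟨k, hk, rfl⟩
      exact ⟨k, latticeGroup_le_maximalCompact n L hk, rfl⟩))
  have hp' := (hfix p).1 hp
  have hpd : ∀ e₁ e₂ : F, IsFixedMod π n p !![e₁, 0; 0, e₂] := by
    intro e₁ e₂ g hg hgY
    refine hpn g (fun k hk => conj_mem_latticeGroup hg hk) (fun k hk => ?_)
      (hv.isFixedMod_diag e₁ e₂ g hg hgY)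
    simpa using conj_mem_latticeGroup (inv_mem hg) hk
  -- the coefficient is bounded by the length of the projection
  have hΦ : ‖(inner ℂ (π γ v) v : ℂ)‖ ≤ ‖p‖ := by
    have h1 : (inner ℂ p (π γ⁻¹ v) : ℂ) = inner ℂ v (π γ⁻¹ v) := by
      refine hpin _ ((hfix _).2 fun d hd => ?_)
      have h3 := (hv.isFixedMod_diag d 0).conj (inv_mem hγ)
      rw [inv_inv] at h3
      have h4 : ((γ⁻¹ : GL (Fin 2) F) : Matrix (Fin 2) (Fin 2) F) * !![d, 0; 0, 0]
          * (γ : Matrix (Fin 2) (Fin 2) F) = d • X := by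
        have : !![d, 0; 0, 0] = d • (!![1, 0; 0, 0] : Matrix (Fin 2) (Fin 2) F) := by
          ext i j; fin_cases i <;> fin_cases j <;> simp
        rw [this, hX, Matrix.mul_smul, Matrix.smul_mul]
      rwa [h4] at h3
    rw [inner_map_eq hu, ← h1]
    refine (norm_inner_le_norm _ _).trans ?_
    rw [norm_map_eq hu, hv.1, mul_one]
  -- its conjugates
  obtain ⟨R, hR⟩ := exists_residueSystem h (n - j - 1)
  obtain ⟨ϖ, hϖ0, hϖ⟩ := exists_norm_eq_zpow h (-1)
  have hϖ1 : ‖ϖ‖ < 1 := by rw [hϖ]; exact zpow_neg_lt_one h (m := 1) le_rfl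
  have hunit : ∀ r ∈ R, ∃ s : Fˣ, (s : F) = 1 + ϖ * r ∧ ‖(s : F)‖ = 1 := by
    intro r hr
    have h1 : ‖1 + ϖ * r‖ = 1 := by
      refine norm_eq_one_of_norm_sub_lt (a := 1) (by simp) ?_
      rw [add_sub_cancel_left]
      exact (norm_mul_le_of' le_rfl (hR.norm_le r hr)).trans_lt hϖ1
    exact ⟨Units.mk0 _ (norm_ne_zero_iff.1 (by rw [h1]; exact one_ne_zero)), rfl, h1⟩
  choose! s hs hs1 using hunit
  have htv : ∀ r ∈ R, π (upperTri (s r) 1 0) v = v := fun r hr =>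
    hv.2 _ (upperTri_zero_mem_heckeGroup (hs1 r hr) (by simp) _ _)
  have hP1 : ∀ r, ‖(s r : F)‖ = 1 → ∀ d : F, ‖d‖ ≤ (residueCard F : ℝ) ^ (-(n : ℤ)) →
      IsFixedMod π n (π (upperTri (s r) 1 0) p) (d • diagConj (s r) X) := by
    intro r hr d hd
    have := (hp' d hd).conj (upperTri_mem_maximalCompact hr (t₂ := 1) (x := 0) (by simp) (by simp))
    rwa [Matrix.mul_smul, Matrix.smul_mul, upperTri_mul_mul_inv] at this
  have hP2 : ∀ r, ‖(s r : F)‖ = 1 → ∀ e₁ e₂ : F,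
      IsFixedMod π n (π (upperTri (s r) 1 0) p) !![e₁, 0; 0, e₂] := by
    intro r hr e₁ e₂
    have := (hpd e₁ e₂).conj
      (upperTri_mem_maximalCompact hr (t₂ := 1) (x := 0) (by simp) (by simp))
    rw [upperTri_mul_mul_inv] at this
    simpa [diagConj] using this
  have hP3 : ∀ r ∈ R, ∀ w : V, (∀ d : F, ‖d‖ ≤ (residueCard F : ℝ) ^ (-(n : ℤ)) →
      IsFixedMod π n w (d • diagConj (s r) X)) →
      (inner ℂ (π (upperTri (s r) 1 0) p) w : ℂ) = inner ℂ v w := by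
    intro r hr w hw
    rw [inner_map_eq hu, hpin, ← inner_map_eq hu, htv r hr]
    refine (hfix _).2 fun d hd => ?_
    have := (hw d hd).conj (inv_mem
      (upperTri_mem_maximalCompact (hs1 r hr) (t₂ := 1) (x := 0) (by simp) (by simp)))
    rwa [inv_inv, Matrix.mul_smul, Matrix.smul_mul, upperTri_inv_mul_mul] at this
  have hbessel := card_mul_norm_sq_le_one R (fun r => π (upperTri (s r) 1 0) p) hv.1
    (fun r _ => norm_map_eq hu _ p)
    (fun r hr => (hP3 r hr _ (hP1 r (hs1 r hr))).symm) ?_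
  · rw [hR.card_eq] at hbessel
    push_cast at hbessel
    refine le_trans ?_ hbessel
    gcongr
  · intro r hr r' hr' hne
    refine inner_eq_zero_of_ne h hn hu hcond hv hj hX1 (hX01 ▸ hγj) (hs1 r hr) (hs1 r' hr') ?_
      (hP1 r (hs1 r hr)) (fun e₁ e₂ _ _ => hP2 r (hs1 r hr) e₁ e₂) (hP1 r' (hs1 r' hr'))
      (hP3 r' hr')
    -- Distinct r differ by more than q^(-(n-j-1)), hence by at least q times that; the factor ϖ in
    -- s - s' = ϖ(r - r') uses up this gain.
    have hlt : (residueCard F : ℝ) ^ (-((n - j - 1 : ℕ) : ℤ)) < ‖r - r'‖ := by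
      by_contra! hle
      exact hne (hR.eq_of_norm_sub_le r hr r' hr' hle)
    have h3 := zpow_le_norm_of_lt h hlt
    have hsub : (s r : F) - s r' = ϖ * (r - r') := by rw [hs r hr, hs r' hr']; ring
    rw [norm_sq_sub_sq h2 (hs1 r' hr'), hsub, norm_mul, hϖ]
    · calc (residueCard F : ℝ) ^ (-((n - j - 1 : ℕ) : ℤ))
          = (residueCard F : ℝ) ^ (-1 : ℤ)
            * (residueCard F : ℝ) ^ (-((n - j - 1 : ℕ) : ℤ) + 1) := by
            rw [← zpow_add₀ hq.ne']; congr 1; ring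
        _ ≤ _ := by gcongr
    · rw [hsub]
      exact (norm_mul_le_of' le_rfl (norm_sub_le_of (hR.norm_le r hr) (hR.norm_le r' hr'))).trans_lt
        hϖ1

theorem weyl_conj_mem_heckeGroup {m : ℕ} {g : GL (Fin 2) F} (hg : g ∈ heckeGroup F m m) :
    (weyl F)⁻¹ * g * weyl F ∈ heckeGroup F m m := by
  refine ⟨mul_mem (mul_mem (inv_mem weyl_mem_maximalCompact) hg.1) weyl_mem_maximalCompact, ?_, ?_⟩
  · rw [Units.val_mul, Units.val_mul, inv_entries, coe_weyl,
      Matrix.eta_fin_two (g : Matrix (Fin 2) (Fin 2) F)]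
    simpa [Matrix.mul_apply, Fin.sum_univ_two, Matrix.det_fin_two] using hg.2.2
  · rw [Units.val_mul, Units.val_mul, inv_entries, coe_weyl,
      Matrix.eta_fin_two (g : Matrix (Fin 2) (Fin 2) F)]
    simpa [Matrix.mul_apply, Fin.sum_univ_two, Matrix.det_fin_two] using hg.2.1

theorem IsNewVector.weyl {n : ℕ} {v : V}
    (hu : ∀ (g : GL (Fin 2) F) (v w : V), inner ℂ (π g v) (π g w) = inner ℂ v w)
    (hv : IsNewVector π n v) : IsNewVector π n (π (weyl F) v) := by
  refine ⟨by rw [norm_map_eq hu, hv.1], fun g hg => ?_⟩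
  have := hv.2 _ (weyl_conj_mem_heckeGroup hg)
  rw [map_mul_apply, map_mul_apply] at this
  rw [← map_apply_inv_apply π (PadicNewform.weyl F) (π g _), this]

theorem norm_inner_newVector_le (h : NormalizedNorm F) (h2 : ‖(2 : F)‖ = 1) {n : ℕ}
    (hn : 1 ≤ n) (hu : ∀ (g : GL (Fin 2) F) (v w : V), inner ℂ (π g v) (π g w) = inner ℂ v w)
    (hcond : HasConductor π (4 * n)) {v : V} (hv : IsNewVector π n v) {γ : GL (Fin 2) F}
    (hγ : γ ∈ maximalCompact F) :
    ‖(inner ℂ (π γ v) v : ℂ)‖ ≤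
      residueCard F * max (decayFactor n γ) (decayFactor n (weyl F * γ)) := by
  have hq := one_lt_residueCard h
  have hq0 := residueCard_pos h
  have hle1 : ‖(inner ℂ (π γ v) v : ℂ)‖ ≤ 1 := by
    refine (norm_inner_le_norm _ _).trans ?_
    rw [norm_map_eq hu, hv.1, mul_one]
  have final : ∀ j ≤ n, ‖γ 0 0 * γ 1 0‖ ≤ (residueCard F : ℝ) ^ (-(j : ℤ)) →
      ‖γ 0 1 * γ 1 1‖ ≤ (residueCard F : ℝ) ^ (-(j : ℤ)) →
      ‖(inner ℂ (π γ v) v : ℂ)‖ ≤ residueCard F * (residueCard F : ℝ) ^ (-((n - j : ℕ) : ℝ) / 2) →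
      ‖(inner ℂ (π γ v) v : ℂ)‖ ≤
        residueCard F * max (decayFactor n γ) (decayFactor n (weyl F * γ)) :=
    fun j hj h1 h2 h3 => h3.trans
      (mul_le_mul_of_nonneg_left (rpow_le_max_decayFactor h hj hγ h1 h2) hq0.le)
  -- Bessel gives |Φ|² ≤ q·q^(-(n-j)) for the coefficient Φ; the factor q^(1/2) is rounded up to q.
  have bound : ∀ j < n, (residueCard F : ℝ) ^ (n - j - 1) * ‖(inner ℂ (π γ v) v : ℂ)‖ ^ 2 ≤ 1 →
      ‖(inner ℂ (π γ v) v : ℂ)‖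
        ≤ residueCard F * (residueCard F : ℝ) ^ (-((n - j : ℕ) : ℝ) / 2) := by
    intro j hj hb
    refine abs_le_of_sq_le_sq' ?_ (by positivity) |>.2
    have e1 : ((residueCard F : ℝ) ^ (-((n - j : ℕ) : ℝ) / 2)) ^ 2
        = ((residueCard F : ℝ) ^ (n - j))⁻¹ := by
      rw [← Real.rpow_natCast, ← Real.rpow_mul hq0.le, ← Real.rpow_natCast,
        ← Real.rpow_neg hq0.le]
      congr 1; push_cast; ring
    rw [mul_pow, e1, ← div_eq_mul_inv, le_div_iff₀ (by positivity)]
    have e2 : (residueCard F : ℝ) ^ (n - j)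
        = (residueCard F : ℝ) ^ (n - j - 1) * residueCard F := by
      rw [← pow_succ]; congr 1; omega
    rw [e2, mul_comm, mul_right_comm]
    nlinarith
  set a := ‖γ 0 0 * γ 1 0‖ with ha
  set b := ‖γ 0 1 * γ 1 1‖ with hb
  have ha1 : a ≤ 1 := norm_mul_le_of (hγ.1 _ _) (hγ.1 _ _)
  have hb1 : b ≤ 1 := norm_mul_le_of (hγ.1 _ _) (hγ.1 _ _)
  by_cases hsmall : a ≤ (residueCard F : ℝ) ^ (-(n : ℤ)) ∧ b ≤ (residueCard F : ℝ) ^ (-(n : ℤ))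
  · refine final n le_rfl hsmall.1 hsmall.2 (hle1.trans ?_)
    simpa using hq.le
  rcases le_total a b with hab | hab
  · have hlt : (residueCard F : ℝ) ^ (-(n : ℤ)) < b := by
      by_contra! hc; exact hsmall ⟨hab.trans hc, hc⟩
    obtain ⟨j, hj, hbj⟩ := exists_norm_eq_zpow_neg h hb1 hlt
    exact final j hj.le (hab.trans hbj.le) hbj.le
      (bound j hj (norm_sq_inner_newVector_le h h2 hn hu hcond hv hj hγ hbj.ge))
  · have hlt : (residueCard F : ℝ) ^ (-(n : ℤ)) < a := by
      by_contra! hc; exact hsmall ⟨hc, hab.trans hc⟩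
    obtain ⟨j, hj, haj⟩ := exists_norm_eq_zpow_neg h ha1 hlt
    refine final j hj.le haj.le (hab.trans haj.le) (bound j hj ?_)
    -- Conjugation by w exchanges the two products, and the coefficient of γ at v equals that of
    -- wγw⁻¹ at the new-vector π(w)v.
    have hγ' : weyl F * γ * (weyl F)⁻¹ ∈ maximalCompact F :=
      mul_mem (mul_mem weyl_mem_maximalCompact hγ) (inv_mem weyl_mem_maximalCompact)
    have := norm_sq_inner_newVector_le h h2 hn hu hcond (hv.weyl hu) hj hγ' (by
      rw [Units.val_mul, Units.val_mul, inv_entries, coe_weyl]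
      refine haj.ge.trans (le_of_eq ?_)
      rw [Matrix.eta_fin_two (γ : Matrix (Fin 2) (Fin 2) F)]
      simp [Matrix.mul_apply, Fin.sum_univ_two, Matrix.det_fin_two, mul_comm])
    rwa [map_mul_apply, map_mul_apply, map_inv_apply_apply, hu] at this

end NewVectorCoefficient

end PadicNewform

end

noncomputable section

namespace PadicNewform

/-! ### The thickened torus as a commutant, and the support of the test function. -/

section ToralGroup

set_option linter.unusedSectionVars false

variable {F : Type u} [NontriviallyNormedField F] [IsUltrametricDist F]

/-- The elements of `K₀` commuting with `√δ` modulo `𝔭 ^ n`. -/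
def toralGroup (δ : F) (n : ℕ) : Subgroup (GL (Fin 2) F) where
  carrier := {g | g ∈ maximalCompact F ∧
    EntriesLE ((g : Matrix (Fin 2) (Fin 2) F) * !![0, 1; δ, 0]
      - !![0, 1; δ, 0] * (g : Matrix (Fin 2) (Fin 2) F)) ((residueCard F : ℝ) ^ (-(n : ℤ)))}
  one_mem' := ⟨one_mem _, by
    rw [Units.val_one, one_mul, mul_one, sub_self]; exact EntriesLE.zero (by positivity)⟩
  mul_mem' := by
    rintro a b ⟨ha, ha'⟩ ⟨hb, hb'⟩
    refine ⟨mul_mem ha hb, ?_⟩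
    have : ((a * b : GL (Fin 2) F) : Matrix (Fin 2) (Fin 2) F) * !![0, 1; δ, 0]
        - !![0, 1; δ, 0] * ((a * b : GL (Fin 2) F) : Matrix (Fin 2) (Fin 2) F)
        = (a : Matrix (Fin 2) (Fin 2) F) * ((b : Matrix (Fin 2) (Fin 2) F) * !![0, 1; δ, 0]
          - !![0, 1; δ, 0] * (b : Matrix (Fin 2) (Fin 2) F))
        + ((a : Matrix (Fin 2) (Fin 2) F) * !![0, 1; δ, 0]
          - !![0, 1; δ, 0] * (a : Matrix (Fin 2) (Fin 2) F)) * (b : Matrix (Fin 2) (Fin 2) F) := by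
      rw [Units.val_mul]; noncomm_ring
    rw [this]
    exact ((entriesLE_coe ha).mul_left hb').add (ha'.mul_right (entriesLE_coe hb))
  inv_mem' := by
    rintro a ⟨ha, ha'⟩
    refine ⟨inv_mem ha, ?_⟩
    have : ((a⁻¹ : GL (Fin 2) F) : Matrix (Fin 2) (Fin 2) F) * !![0, 1; δ, 0]
        - !![0, 1; δ, 0] * ((a⁻¹ : GL (Fin 2) F) : Matrix (Fin 2) (Fin 2) F)
        = -(((a⁻¹ : GL (Fin 2) F) : Matrix (Fin 2) (Fin 2) F)
          * ((a : Matrix (Fin 2) (Fin 2) F) * !![0, 1; δ, 0]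
            - !![0, 1; δ, 0] * (a : Matrix (Fin 2) (Fin 2) F))
          * ((a⁻¹ : GL (Fin 2) F) : Matrix (Fin 2) (Fin 2) F)) := by
      rw [mul_sub, sub_mul, ← mul_assoc, coe_inv_mul_coe, one_mul,
        mul_assoc _ (_ * _) ((a⁻¹ : GL (Fin 2) F) : Matrix (Fin 2) (Fin 2) F),
        mul_assoc _ _ ((a⁻¹ : GL (Fin 2) F) : Matrix (Fin 2) (Fin 2) F), coe_mul_coe_inv, mul_one,
        neg_sub]
    rw [this]
    exact (((entriesLE_coe_inv ha).mul_left ha').mul_right (entriesLE_coe_inv ha)).neg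

theorem mem_toralGroup_iff {δ : F} (hδ : ‖δ‖ = 1) {n : ℕ} {g : GL (Fin 2) F} :
    g ∈ toralGroup δ n ↔ g ∈ maximalCompact F ∧
      ‖g 0 0 - g 1 1‖ ≤ (residueCard F : ℝ) ^ (-(n : ℤ)) ∧
      ‖g 1 0 - δ * g 0 1‖ ≤ (residueCard F : ℝ) ^ (-(n : ℤ)) := by
  have e : (g : Matrix (Fin 2) (Fin 2) F) * !![0, 1; δ, 0]
      - !![0, 1; δ, 0] * (g : Matrix (Fin 2) (Fin 2) F)
      = !![-(g 1 0 - δ * g 0 1), g 0 0 - g 1 1; -(δ * (g 0 0 - g 1 1)), g 1 0 - δ * g 0 1] := by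
    rw [Matrix.eta_fin_two (g : Matrix (Fin 2) (Fin 2) F)]
    ext i j
    fin_cases i <;> fin_cases j <;> simp <;> ring
  change g ∈ maximalCompact F ∧ EntriesLE _ _ ↔ _
  rw [e]
  refine and_congr_right fun _ => ⟨fun h => ⟨h 0 1, h 1 1⟩, fun h => EntriesLE.of ?_ h.1 ?_ h.2⟩
  · change ‖-_‖ ≤ _
    rw [norm_neg]; exact h.2
  · change ‖-_‖ ≤ _
    rw [norm_neg, norm_mul, hδ, one_mul]; exact h.1

theorem principalCongruence_le_toralGroup {δ : F} (hδ : ‖δ‖ = 1) (n : ℕ) :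
    principalCongruence F n ≤ toralGroup δ n := by
  intro g hg
  have h00 := hg.2 0 0
  have h11 := hg.2 1 1
  have h10 := hg.2 1 0
  have h01 := hg.2 0 1
  simp only [Matrix.sub_apply, Matrix.one_apply_eq, ne_eq, one_ne_zero, zero_ne_one,
    not_false_eq_true, Matrix.one_apply_ne, sub_zero] at h00 h11 h10 h01
  refine (mem_toralGroup_iff hδ).2 ⟨hg.1, ?_, norm_sub_le_of h10 (norm_mul_le_of hδ.le h01)⟩
  have := norm_sub_le_of h00 h11
  rwa [sub_sub_sub_cancel_right] at this

/-- An almost commuting g is approximated by the torus element with the same top row. Nothing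
requires δ to be a non-square, so split and inert tori are treated together. -/
theorem thickenedTorus_quadraticTorus (h : NormalizedNorm F) {δ : F} (hδ : ‖δ‖ = 1) {n : ℕ}
    (hn : 1 ≤ n) : thickenedTorus (quadraticTorus δ) n = (toralGroup δ n : Set (GL (Fin 2) F)) := by
  have hpos : 0 ≤ (residueCard F : ℝ) ^ (-(n : ℤ)) := by positivity
  ext g
  constructor
  · rintro ⟨t, ⟨⟨ht1, ht2⟩, htK⟩, k, hk, rfl⟩
    refine mul_mem ((mem_toralGroup_iff hδ).2 ⟨htK, ?_, ?_⟩)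
      (principalCongruence_le_toralGroup hδ n hk)
    · rw [ht1, sub_self, norm_zero]; exact hpos
    · rw [ht2, mul_comm, sub_self, norm_zero]; exact hpos
  · intro hg
    obtain ⟨hgK, h1, h2⟩ := (mem_toralGroup_iff hδ).1 hg
    have hsub : EntriesLE (!![g 0 0, g 0 1; g 0 1 * δ, g 0 0] - (g : Matrix (Fin 2) (Fin 2) F))
        ((residueCard F : ℝ) ^ (-(n : ℤ))) := by
      refine EntriesLE.of ?_ ?_ ?_ ?_
      · simp
      · simp
      · rw [norm_sub_rev, mul_comm] at h2; exact h2
      · exact h1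
    obtain ⟨t, ht, htM⟩ := exists_mem_maximalCompact_of_sub h hn hgK hsub
    refine ⟨t, ⟨⟨?_, ?_⟩, ht⟩, t⁻¹ * g, inv_mul_mem_principalCongruence ht hgK ?_, by simp⟩
    · rw [htM]; simp
    · rw [htM]; simp
    · rw [htM, ← neg_sub]; exact hsub.neg

/-- Duality for matrix lattices under ψ∘tr, tested one entry at a time on elementary matrices. -/
theorem entriesLE_of_forall_addChar_trace_eq_one (h : NormalizedNorm F) {ψ : AddChar F Circle}
    (hψ : IsUnramified ψ) {k : ℤ} {M : Matrix (Fin 2) (Fin 2) F}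
    (hM : ∀ Y : Matrix (Fin 2) (Fin 2) F, EntriesLE Y ((residueCard F : ℝ) ^ (-k)) →
      ψ (M * Y).trace = 1) : EntriesLE M ((residueCard F : ℝ) ^ k) := by
  intro i j
  refine norm_le_of_forall_addChar_eq_one h hψ fun d hd => ?_
  have := hM (Matrix.single j i d) (fun a b => by
    rw [Matrix.single_apply]
    split_ifs
    · exact hd
    · rw [norm_zero]; positivity)
  rwa [Matrix.trace_mul_single, op_smul_eq_mul, mul_comm] at this

variable {V : Type v} [NormedAddCommGroup V] [InnerProductSpace ℂ V]
  {π : Representation ℂ (GL (Fin 2) F) V}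

theorem quadratic_eq_smul_add_smul (β₀ β₁ δ : F) :
    !![β₀, β₁; β₁ * δ, β₀] = β₀ • (1 : Matrix (Fin 2) (Fin 2) F) + β₁ • !![0, 1; δ, 0] := by
  ext i j; fin_cases i <;> fin_cases j <;> simp

/-- Matrix coefficients on `K₀` of an eigenvector of `K(n)` are supported near the torus. -/
theorem mem_toralGroup_of_inner_ne_zero (h : NormalizedNorm F) {ψ : AddChar F Circle}
    (hψ : IsUnramified ψ) {n : ℕ} (hn : 1 ≤ n)
    (hu : ∀ (g : GL (Fin 2) F) (v w : V), inner ℂ (π g v) (π g w) = inner ℂ v w)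
    {δ β₀ β₁ : F} (hβ : (residueCard F : ℝ) ^ (2 * n) ≤ ‖β₁‖) {v : V}
    (hv : ∀ k ∈ principalCongruence F n,
      π k v = (latticeCharacter ψ !![β₀, β₁; β₁ * δ, β₀] k : ℂ) • v)
    {g : GL (Fin 2) F} (hg : g ∈ maximalCompact F) (hgv : (inner ℂ (π g v) v : ℂ) ≠ 0) :
    g ∈ toralGroup δ n := by
  have hq := residueCard_pos h
  set β : Matrix (Fin 2) (Fin 2) F := !![β₀, β₁; β₁ * δ, β₀] with hβdef
  have key : EntriesLE ((g : Matrix (Fin 2) (Fin 2) F) * β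
      * ((g⁻¹ : GL (Fin 2) F) : Matrix (Fin 2) (Fin 2) F) - β) ((residueCard F : ℝ) ^ (n : ℤ)) := by
    refine entriesLE_of_forall_addChar_trace_eq_one h hψ fun Y hY => ?_
    obtain ⟨k, hk, hkY⟩ := exists_coe_eq_one_add h hn hY
    have hk' : g⁻¹ * k * g ∈ principalCongruence F n := by
      simpa using conj_mem_principalCongruence (inv_mem hg) hk
    -- Apply k to both sides of the pairing and write kg = g(g⁻¹kg): as v is an eigenvector for k
    -- and g⁻¹kg, a nonzero coefficient forces θ_β to agree on them.
    have h1 : (inner ℂ (π g v) v : ℂ) = (starRingEnd ℂ (latticeCharacter ψ β (g⁻¹ * k * g) : ℂ)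
        * (latticeCharacter ψ β k : ℂ)) * inner ℂ (π g v) v := by
      conv_lhs => rw [← hu k, ← map_mul_apply, hv k hk,
        show k * g = g * (g⁻¹ * k * g) by group, map_mul_apply, hv _ hk', map_smul,
        inner_smul_left, inner_smul_right]
      ring
    have h2 : starRingEnd ℂ (latticeCharacter ψ β (g⁻¹ * k * g) : ℂ)
        * (latticeCharacter ψ β k : ℂ) = 1 := by
      have := mul_right_cancel₀ hgv ((one_mul _).trans h1)
      exact this.symm
    rw [← Circle.coe_inv_eq_conj, ← Circle.coe_mul, Circle.coe_eq_one, inv_mul_eq_one] at h2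
    unfold latticeCharacter at h2
    have h3 := conj_sub_one g⁻¹ k
    rw [inv_inv] at h3
    rw [h3, hkY, add_sub_cancel_left] at h2
    have h4 : (((g : Matrix (Fin 2) (Fin 2) F) * β
        * ((g⁻¹ : GL (Fin 2) F) : Matrix (Fin 2) (Fin 2) F) - β) * Y).trace
        = (β * (((g⁻¹ : GL (Fin 2) F) : Matrix (Fin 2) (Fin 2) F) * Y
          * (g : Matrix (Fin 2) (Fin 2) F))).trace - (β * Y).trace := by
      rw [sub_mul, Matrix.trace_sub, mul_assoc, mul_assoc, Matrix.trace_mul_comm]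
      simp only [mul_assoc]
    rw [h4, AddChar.map_sub_eq_div, h2, div_self']
  refine ⟨hg, ?_⟩
  have hβ1 : β₁ ≠ 0 := norm_pos_iff.1 ((pow_pos hq _).trans_le hβ)
  -- The scalar β₀ drops out of gβg⁻¹ - β, and dividing by β₁ improves 𝔭^(-n) to 𝔭^n.
  have e : (g : Matrix (Fin 2) (Fin 2) F) * !![0, 1; δ, 0]
      - !![0, 1; δ, 0] * (g : Matrix (Fin 2) (Fin 2) F)
      = β₁⁻¹ • (((g : Matrix (Fin 2) (Fin 2) F) * β
        * ((g⁻¹ : GL (Fin 2) F) : Matrix (Fin 2) (Fin 2) F) - β)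
          * (g : Matrix (Fin 2) (Fin 2) F)) := by
    rw [sub_mul, mul_assoc _ _ (g : Matrix (Fin 2) (Fin 2) F), coe_inv_mul_coe, mul_one, hβdef,
      quadratic_eq_smul_add_smul, mul_add, add_mul, Matrix.mul_smul, Matrix.mul_smul,
      Matrix.smul_mul, Matrix.smul_mul, mul_one, one_mul, add_sub_add_left_eq_sub, ← smul_sub,
      smul_smul, inv_mul_cancel₀ hβ1, one_smul]
  rw [e]
  refine ((key.mul_right (entriesLE_coe hg)).smul (s := ((residueCard F : ℝ) ^ (2 * n))⁻¹) ?_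
    (by positivity)).mono (le_of_eq ?_)
  · rw [norm_inv]; exact inv_anti₀ (by positivity) hβ
  · rw [← zpow_natCast, ← _root_.zpow_neg, ← zpow_add₀ hq.ne']; congr 1; push_cast; ring

end ToralGroup

/-! ### Volumes of the toral group and of its intersection with H(2n). -/

section Volumes

set_option linter.unusedSectionVars false

variable {F : Type u} [NontriviallyNormedField F] [IsUltrametricDist F]

theorem isOpen_principalCongruence (h : NormalizedNorm F) (l : ℕ) :
    IsOpen (principalCongruence F l : Set (GL (Fin 2) F)) := by
  have hq := residueCard_pos h
  have hc : Continuous fun g : GL (Fin 2) F => (g : Matrix (Fin 2) (Fin 2) F) :=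
    Units.continuous_val
  have hball : ∀ r : ℝ, 0 < r → IsOpen {x : F | ‖x‖ ≤ r} := by
    intro r hr
    have := IsUltrametricDist.isOpen_closedBall (0 : F) hr.ne'
    simpa [Metric.closedBall] using this
  have hsph : IsOpen {x : F | ‖x‖ = 1} := by
    have := IsUltrametricDist.isOpen_sphere (0 : F) one_ne_zero
    simpa [Metric.sphere] using this
  have h1 : ∀ i j, IsOpen {g : GL (Fin 2) F | ‖(g : Matrix (Fin 2) (Fin 2) F) i j‖ ≤ 1} :=
    fun i j => (hball 1 one_pos).preimage (hc.matrix_elem i j)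
  have h2 : ∀ i j, IsOpen {g : GL (Fin 2) F | ‖((g : Matrix (Fin 2) (Fin 2) F) - 1) i j‖
      ≤ (residueCard F : ℝ) ^ (-(l : ℤ))} :=
    fun i j => (hball _ (zpow_pos hq _)).preimage ((hc.sub continuous_const).matrix_elem i j)
  have h3 : IsOpen {g : GL (Fin 2) F | ‖(g : Matrix (Fin 2) (Fin 2) F).det‖ = 1} :=
    hsph.preimage hc.matrix_det
  have : (principalCongruence F l : Set (GL (Fin 2) F))
      = ((⋂ i, ⋂ j, {g : GL (Fin 2) F | ‖(g : Matrix (Fin 2) (Fin 2) F) i j‖ ≤ 1})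
        ∩ {g : GL (Fin 2) F | ‖(g : Matrix (Fin 2) (Fin 2) F).det‖ = 1})
        ∩ ⋂ i, ⋂ j, {g : GL (Fin 2) F | ‖((g : Matrix (Fin 2) (Fin 2) F) - 1) i j‖
          ≤ (residueCard F : ℝ) ^ (-(l : ℤ))} := by
    ext g
    simp only [Set.mem_inter_iff, Set.mem_iInter, Set.mem_ofPred_eq, SetLike.mem_coe]
    exact Iff.rfl
  rw [this]
  exact ((isOpen_iInter_of_finite fun i => isOpen_iInter_of_finite fun j => h1 i j).inter h3).inter
    (isOpen_iInter_of_finite fun i => isOpen_iInter_of_finite fun j => h2 i j)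

theorem isOpen_of_principalCongruence_le (h : NormalizedNorm F) {l : ℕ}
    {B : Subgroup (GL (Fin 2) F)} (hB : principalCongruence F l ≤ B) :
    IsOpen (B : Set (GL (Fin 2) F)) :=
  Subgroup.isOpen_mono hB (isOpen_principalCongruence h l)

variable [MeasurableSpace (GL (Fin 2) F)] [BorelSpace (GL (Fin 2) F)]
  {μ : Measure (GL (Fin 2) F)} [μ.IsHaarMeasure]

/-- Disjoint cosets of `B` contained in `A` bound the volume of `B`. -/
theorem card_mul_measureReal_le {ι : Type*} (s : Finset ι) (g : ι → GL (Fin 2) F)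
    {B : Subgroup (GL (Fin 2) F)} (hB : IsOpen (B : Set (GL (Fin 2) F)))
    {A : Set (GL (Fin 2) F)} (hA : μ A ≠ ⊤) (hgA : ∀ i ∈ s, ∀ b ∈ B, g i * b ∈ A)
    (hg : ∀ i ∈ s, ∀ j ∈ s, (g i)⁻¹ * g j ∈ B → i = j) :
    s.card * μ.real (B : Set (GL (Fin 2) F)) ≤ μ.real A := by
  have hsub : (⋃ i ∈ s, g i • (B : Set (GL (Fin 2) F))) ⊆ A := by
    intro x hx
    simp only [Set.mem_iUnion] at hx
    obtain ⟨i, hi, b, hb, rfl⟩ := hx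
    exact hgA i hi b hb
  have hle := measureReal_mono hsub hA
  have hfin : ∀ i ∈ s, μ (g i • (B : Set (GL (Fin 2) F))) ≠ ⊤ := by
    intro i hi
    refine ne_top_of_le_ne_top hA (measure_mono ?_)
    rintro _ ⟨b, hb, rfl⟩
    exact hgA i hi b hb
  rw [measureReal_biUnion_finset ?_ (fun i _ => (hB.smul (g i)).measurableSet) hfin] at hle
  · have : ∀ i ∈ s, μ.real (g i • (B : Set (GL (Fin 2) F))) = μ.real (B : Set (GL (Fin 2) F)) :=
      fun i _ => by rw [measureReal_def, measureReal_def, measure_smul]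
    rwa [Finset.sum_congr rfl this, Finset.sum_const, nsmul_eq_mul] at hle
  · intro i hi j hj hij
    refine Set.disjoint_left.2 ?_
    rintro _ ⟨b, hb, rfl⟩ ⟨b', hb', hbb⟩
    refine hij (hg i hi j hj ?_)
    have hbb' : g j * b' = g i * b := hbb
    have : (g i)⁻¹ * g j = b * b'⁻¹ := by
      rw [inv_mul_eq_iff_eq_mul, ← mul_assoc, ← hbb', mul_inv_cancel_right]
    rw [this]
    exact mul_mem hb (inv_mem hb')

theorem measure_ne_top_of_le (hμ : μ (maximalCompact F : Set (GL (Fin 2) F)) = 1)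
    {B : Set (GL (Fin 2) F)} (hB : B ⊆ maximalCompact F) : μ B ≠ ⊤ :=
  ne_top_of_le_ne_top (by rw [hμ]; exact ENNReal.one_ne_top) (measure_mono hB)

theorem measureReal_pos_of_le (h : NormalizedNorm F)
    (hμ : μ (maximalCompact F : Set (GL (Fin 2) F)) = 1)
    {B : Subgroup (GL (Fin 2) F)} (hB : B ≤ maximalCompact F) {l : ℕ}
    (hl : principalCongruence F l ≤ B) : 0 < μ.real (B : Set (GL (Fin 2) F)) :=
  ENNReal.toReal_pos ((isOpen_of_principalCongruence_le h hl).measure_pos μ ⟨1, one_mem B⟩).ne'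
    (measure_ne_top_of_le hμ hB)

/-- The matrices with rows (t, x), (0, 1), for t a unit and x integral modulo 𝔭^n, lie in distinct
cosets, and there are at least q^(2n)/2 of them. -/
theorem measureReal_toralGroup_le (h : NormalizedNorm F)
    (hμ : μ (maximalCompact F : Set (GL (Fin 2) F)) = 1) {δ : F} (hδ : ‖δ‖ = 1) (n : ℕ) :
    (residueCard F : ℝ) ^ (2 * n) * μ.real (toralGroup δ n : Set (GL (Fin 2) F)) ≤ 2 := by
  obtain ⟨R, hR⟩ := exists_residueSystem h n
  obtain ⟨S, hS, hS1, hS2⟩ := exists_unitSystem h n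
  have key := card_mul_measureReal_le (μ := μ) (S ×ˢ R) (fun p => upperTri p.1 1 p.2)
    (isOpen_of_principalCongruence_le h (principalCongruence_le_toralGroup hδ n))
    (A := maximalCompact F) (measure_ne_top_of_le hμ subset_rfl) ?_ ?_
  · have h1 : μ.real (maximalCompact F : Set (GL (Fin 2) F)) = 1 := by
      rw [measureReal_def, hμ]; rfl
    rw [h1, Finset.card_product, hR.card_eq] at key
    push_cast at key
    have h2 : (residueCard F : ℝ) ^ n ≤ 2 * S.card := by exact_mod_cast hS
    have h3 : (0 : ℝ) ≤ μ.real (toralGroup δ n : Set (GL (Fin 2) F)) := measureReal_nonneg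
    have h4 : (0 : ℝ) ≤ (residueCard F : ℝ) ^ n := by positivity
    calc (residueCard F : ℝ) ^ (2 * n) * μ.real (toralGroup δ n : Set (GL (Fin 2) F))
        = (residueCard F : ℝ) ^ n * ((residueCard F : ℝ) ^ n
          * μ.real (toralGroup δ n : Set (GL (Fin 2) F))) := by ring
      _ ≤ (2 * S.card) * ((residueCard F : ℝ) ^ n
          * μ.real (toralGroup δ n : Set (GL (Fin 2) F))) :=
        mul_le_mul_of_nonneg_right h2 (by positivity)
      _ ≤ 2 := by linarith
  · rintro ⟨t, x⟩ hp b hb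
    rw [Finset.mem_product] at hp
    exact mul_mem (upperTri_mem_maximalCompact (hS1 _ hp.1) (by simp) (hR.norm_le _ hp.2)) hb.1
  · rintro ⟨t, x⟩ hp ⟨t', x'⟩ hp' hpp
    rw [Finset.mem_product] at hp hp'
    obtain ⟨-, h1, h2⟩ := (mem_toralGroup_iff hδ).1 hpp
    have ht := hS1 _ hp.1
    simp only at ht
    rw [Units.val_mul, inv_entries, coe_upperTri, coe_upperTri] at h1 h2
    have e1 : ‖(t' : F) - t‖ ≤ (residueCard F : ℝ) ^ (-(n : ℤ)) := by
      refine le_trans (le_of_eq ?_) h1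
      rw [← one_mul ‖(t' : F) - t‖, ← inv_one, ← ht, ← norm_inv, ← norm_mul]
      congr 1
      simp [Matrix.mul_apply, Fin.sum_univ_two, Matrix.det_fin_two]
      field_simp
    have e2 : ‖x - x'‖ ≤ (residueCard F : ℝ) ^ (-(n : ℤ)) := by
      refine le_trans (le_of_eq ?_) h2
      rw [← one_mul ‖x - x'‖, ← inv_one, ← ht, ← norm_inv, ← norm_mul,
        ← one_mul ‖(t : F)⁻¹ * (x - x')‖, ← hδ, ← norm_mul]
      congr 1
      simp [Matrix.mul_apply, Fin.sum_univ_two, Matrix.det_fin_two]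
      field_simp
      ring
    exact Prod.ext (hS2 _ hp'.1 _ hp.1 e1).symm (hR.eq_of_norm_sub_le _ hp.2 _ hp'.2 e2)

theorem principalCongruence_le_heckeGroup_inf_toralGroup (h : NormalizedNorm F) {δ : F}
    (hδ : ‖δ‖ = 1) {n m : ℕ} (hm : m ≤ 2 * n) :
    principalCongruence F (2 * n) ≤ heckeGroup F (2 * n) (2 * n) ⊓ toralGroup δ m :=
  le_inf (principalCongruence_le_heckeGroup _)
    ((principalCongruence_anti h hm).trans (principalCongruence_le_toralGroup hδ m))

/-- In H(2n) only the ratio of the diagonal entries is constrained; the matrices diag(t, 1) with t a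
unit modulo 𝔭^m separate at least q^m/2 cosets. -/
theorem measureReal_heckeGroup_inf_toralGroup_le (h : NormalizedNorm F)
    (hμ : μ (maximalCompact F : Set (GL (Fin 2) F)) = 1) {δ : F} (hδ : ‖δ‖ = 1) {n m : ℕ}
    (hm : m ≤ 2 * n) :
    (residueCard F : ℝ) ^ m * μ.real ((heckeGroup F (2 * n) (2 * n) ⊓ toralGroup δ m :
      Subgroup (GL (Fin 2) F)) : Set (GL (Fin 2) F))
      ≤ 2 * μ.real (heckeGroup F (2 * n) (2 * n) : Set (GL (Fin 2) F)) := by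
  obtain ⟨S, hS, hS1, hS2⟩ := exists_unitSystem h m
  have key := card_mul_measureReal_le (μ := μ) S (fun t => upperTri t 1 0)
    (isOpen_of_principalCongruence_le h
      (principalCongruence_le_heckeGroup_inf_toralGroup h hδ hm))
    (A := heckeGroup F (2 * n) (2 * n)) (measure_ne_top_of_le hμ fun g hg => hg.1) ?_ ?_
  · have h2 : (residueCard F : ℝ) ^ m ≤ 2 * S.card := by exact_mod_cast hS
    have h3 : (0 : ℝ) ≤ μ.real ((heckeGroup F (2 * n) (2 * n) ⊓ toralGroup δ m :
      Subgroup (GL (Fin 2) F)) : Set (GL (Fin 2) F)) := measureReal_nonneg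
    nlinarith
  · intro t ht b hb
    exact mul_mem (upperTri_zero_mem_heckeGroup (hS1 _ ht) (by simp) _ _) hb.1
  · intro t ht t' ht' htt
    obtain ⟨-, h1, -⟩ := (mem_toralGroup_iff hδ).1 htt.2
    have htn := hS1 _ ht
    rw [Units.val_mul, inv_entries, coe_upperTri, coe_upperTri] at h1
    refine (hS2 _ ht' _ ht (le_trans (le_of_eq ?_) h1)).symm
    rw [← one_mul ‖(t' : F) - t‖, ← inv_one, ← htn, ← norm_inv, ← norm_mul]
    congr 1
    simp [Matrix.mul_apply, Fin.sum_univ_two, Matrix.det_fin_two]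
    field_simp

end Volumes

end PadicNewform

end

noncomputable section

namespace PadicNewform

/-! ### Counting pairs (x, y) in H(2n) with x⁻¹γy in the toral group. -/

section OrbitalIntegral

set_option linter.unusedSectionVars false

variable {F : Type u} [NontriviallyNormedField F] [IsUltrametricDist F]

theorem norm_mul_sub_mul_le {a b c d : F} {r : ℝ} (ha : ‖a‖ ≤ 1) (hd : ‖d‖ ≤ 1)
    (hab : ‖a - b‖ ≤ r) (hcd : ‖c - d‖ ≤ r) : ‖a * c - b * d‖ ≤ r := by
  have : a * c - b * d = a * (c - d) + (a - b) * d := by ring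
  rw [this]
  exact norm_add_le_of (norm_mul_le_of ha hcd) (norm_mul_le_of' hab hd)

theorem norm_diag_eq_one_of_mem_heckeGroup (h : NormalizedNorm F) {m : ℕ} (hm : 1 ≤ m)
    {g : GL (Fin 2) F} (hg : g ∈ heckeGroup F m m) : ‖g 0 0‖ = 1 ∧ ‖g 1 1‖ = 1 := by
  rcases norm_mul_diag_or_antidiag hg.1 with hd | hd
  · exact hd
  · have := zpow_neg_lt_one h hm
    linarith [hd.2, hg.2.1]

/-- The condition on the diagonal entries of `y` imposed by `x⁻¹ γ y ∈ U`. -/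
theorem norm_quadratic_le (h : NormalizedNorm F) {δ : F} (hδ : ‖δ‖ = 1) {n : ℕ}
    {γ x y : GL (Fin 2) F} (hγ : γ ∈ maximalCompact F) (hx : x ∈ heckeGroup F (2 * n) (2 * n))
    (hy : y ∈ heckeGroup F (2 * n) (2 * n)) (hxy : x⁻¹ * γ * y ∈ toralGroup δ n) :
    ‖γ 0 0 * γ 1 0 * y 0 0 ^ 2 - δ * (γ 0 1 * γ 1 1) * y 1 1 ^ 2‖
      ≤ (residueCard F : ℝ) ^ (-(n : ℤ)) := by
  have hle : (residueCard F : ℝ) ^ (-((2 * n : ℕ) : ℤ)) ≤ (residueCard F : ℝ) ^ (-(n : ℤ)) :=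
    zpow_le_zpow_right₀ (one_lt_residueCard h).le (by omega)
  set g := x⁻¹ * γ * y with hg
  obtain ⟨hgK, h1, h2⟩ := (mem_toralGroup_iff hδ).1 hxy
  have hmat : (γ : Matrix (Fin 2) (Fin 2) F) * (y : Matrix (Fin 2) (Fin 2) F)
      = (x : Matrix (Fin 2) (Fin 2) F) * (g : Matrix (Fin 2) (Fin 2) F) := by
    rw [← Units.val_mul, ← Units.val_mul, hg]; congr 1; group
  have hent : ∀ i j, γ i 0 * y 0 j + γ i 1 * y 1 j = x i 0 * g 0 j + x i 1 * g 1 j := by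
    intro i j
    have := congrFun (congrFun hmat i) j
    rwa [Matrix.mul_apply, Matrix.mul_apply, Fin.sum_univ_two, Fin.sum_univ_two] at this
  have hx10 := hx.2.1.trans hle
  have hx01 := hx.2.2.trans hle
  have hy10 := hy.2.1.trans hle
  have hy01 := hy.2.2.trans hle
  have c00 : ‖γ 0 0 * y 0 0 - x 0 0 * g 0 0‖ ≤ (residueCard F : ℝ) ^ (-(n : ℤ)) := by
    have : γ 0 0 * y 0 0 - x 0 0 * g 0 0 = x 0 1 * g 1 0 - γ 0 1 * y 1 0 := by
      linear_combination hent 0 0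
    rw [this]
    exact norm_sub_le_of (norm_mul_le_of' hx01 (hgK.1 _ _)) (norm_mul_le_of (hγ.1 _ _) hy10)
  have c10 : ‖γ 1 0 * y 0 0 - x 1 1 * g 1 0‖ ≤ (residueCard F : ℝ) ^ (-(n : ℤ)) := by
    have : γ 1 0 * y 0 0 - x 1 1 * g 1 0 = x 1 0 * g 0 0 - γ 1 1 * y 1 0 := by
      linear_combination hent 1 0
    rw [this]
    exact norm_sub_le_of (norm_mul_le_of' hx10 (hgK.1 _ _)) (norm_mul_le_of (hγ.1 _ _) hy10)
  have c01 : ‖γ 0 1 * y 1 1 - x 0 0 * g 0 1‖ ≤ (residueCard F : ℝ) ^ (-(n : ℤ)) := by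
    have : γ 0 1 * y 1 1 - x 0 0 * g 0 1 = x 0 1 * g 1 1 - γ 0 0 * y 0 1 := by
      linear_combination hent 0 1
    rw [this]
    exact norm_sub_le_of (norm_mul_le_of' hx01 (hgK.1 _ _)) (norm_mul_le_of (hγ.1 _ _) hy01)
  have c11 : ‖γ 1 1 * y 1 1 - x 1 1 * g 1 1‖ ≤ (residueCard F : ℝ) ^ (-(n : ℤ)) := by
    have : γ 1 1 * y 1 1 - x 1 1 * g 1 1 = x 1 0 * g 0 1 - γ 1 0 * y 0 1 := by
      linear_combination hent 1 1
    rw [this]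
    exact norm_sub_le_of (norm_mul_le_of' hx10 (hgK.1 _ _)) (norm_mul_le_of (hγ.1 _ _) hy01)
  have p1 : ‖(γ 0 0 * y 0 0) * (γ 1 0 * y 0 0) - (x 0 0 * g 0 0) * (x 1 1 * g 1 0)‖
      ≤ (residueCard F : ℝ) ^ (-(n : ℤ)) :=
    norm_mul_sub_mul_le (norm_mul_le_of (hγ.1 _ _) (hy.1.1 _ _))
      (norm_mul_le_of (hx.1.1 _ _) (hgK.1 _ _)) c00 c10
  have p2 : ‖(γ 0 1 * y 1 1) * (γ 1 1 * y 1 1) - (x 0 0 * g 0 1) * (x 1 1 * g 1 1)‖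
      ≤ (residueCard F : ℝ) ^ (-(n : ℤ)) :=
    norm_mul_sub_mul_le (norm_mul_le_of (hγ.1 _ _) (hy.1.1 _ _))
      (norm_mul_le_of (hx.1.1 _ _) (hgK.1 _ _)) c01 c11
  have p3 : ‖g 0 0 * g 1 0 - g 1 1 * (δ * g 0 1)‖ ≤ (residueCard F : ℝ) ^ (-(n : ℤ)) :=
    norm_mul_sub_mul_le (hgK.1 _ _) (norm_mul_le_of hδ.le (hgK.1 _ _)) h1 h2
  -- Modulo 𝔭^n both x and y are diagonal, so the entries of γy = xg decouple. Multiplying the two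
  -- entries of each column turns g₀₀g₁₀ ≡ δg₀₁g₁₁ into a relation in which x enters only through
  -- x₀₀x₁₁.
  have e : γ 0 0 * γ 1 0 * y 0 0 ^ 2 - δ * (γ 0 1 * γ 1 1) * y 1 1 ^ 2
      = ((γ 0 0 * y 0 0) * (γ 1 0 * y 0 0) - (x 0 0 * g 0 0) * (x 1 1 * g 1 0))
        + (x 0 0 * x 1 1) * (g 0 0 * g 1 0 - g 1 1 * (δ * g 0 1))
        - δ * ((γ 0 1 * y 1 1) * (γ 1 1 * y 1 1) - (x 0 0 * g 0 1) * (x 1 1 * g 1 1)) := by ring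
  rw [e]
  exact norm_sub_le_of (norm_add_le_of p1
    (norm_mul_le_of (norm_mul_le_of (hx.1.1 _ _) (hx.1.1 _ _)) p3)) (norm_mul_le_of hδ.le p2)

/-- Two solutions `(u, w)`, `(u₀, w₀)` of `A u² ≡ B w²` agree up to sign. -/
theorem norm_sub_le_or_norm_add_le (h : NormalizedNorm F) (h2 : ‖(2 : F)‖ = 1) {n j : ℕ}
    (hj : j ≤ n) {A B u w u₀ w₀ : F}
    (hAB : (residueCard F : ℝ) ^ (-(j : ℤ)) ≤ max ‖A‖ ‖B‖)
    (hu : ‖u‖ = 1) (hw : ‖w‖ = 1) (hu₀ : ‖u₀‖ = 1) (hw₀ : ‖w₀‖ = 1)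
    (h₁ : ‖A * u ^ 2 - B * w ^ 2‖ ≤ (residueCard F : ℝ) ^ (-(n : ℤ)))
    (h₀ : ‖A * u₀ ^ 2 - B * w₀ ^ 2‖ ≤ (residueCard F : ℝ) ^ (-(n : ℤ))) :
    ‖u * w₀ - u₀ * w‖ ≤ (residueCard F : ℝ) ^ (-((n - j : ℕ) : ℤ)) ∨
      ‖u * w₀ + u₀ * w‖ ≤ (residueCard F : ℝ) ^ (-((n - j : ℕ) : ℤ)) := by
  have hq := residueCard_pos h
  have hA : ‖A‖ * ‖(u * w₀ - u₀ * w) * (u * w₀ + u₀ * w)‖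
      ≤ (residueCard F : ℝ) ^ (-(n : ℤ)) := by
    have : A * ((u * w₀ - u₀ * w) * (u * w₀ + u₀ * w))
        = w₀ ^ 2 * (A * u ^ 2 - B * w ^ 2) - w ^ 2 * (A * u₀ ^ 2 - B * w₀ ^ 2) := by ring
    rw [← norm_mul, this]
    exact norm_sub_le_of (norm_mul_le_of (by simp [hw₀]) h₁) (norm_mul_le_of (by simp [hw]) h₀)
  have hB : ‖B‖ * ‖(u * w₀ - u₀ * w) * (u * w₀ + u₀ * w)‖
      ≤ (residueCard F : ℝ) ^ (-(n : ℤ)) := by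
    have : B * ((u * w₀ - u₀ * w) * (u * w₀ + u₀ * w))
        = u₀ ^ 2 * (A * u ^ 2 - B * w ^ 2) - u ^ 2 * (A * u₀ ^ 2 - B * w₀ ^ 2) := by ring
    rw [← norm_mul, this]
    exact norm_sub_le_of (norm_mul_le_of (by simp [hu₀]) h₁) (norm_mul_le_of (by simp [hu]) h₀)
  have hprod : ‖u * w₀ - u₀ * w‖ * ‖u * w₀ + u₀ * w‖
      ≤ (residueCard F : ℝ) ^ (-((n - j : ℕ) : ℤ)) := by
    have h3 : (residueCard F : ℝ) ^ (-(j : ℤ)) * ‖(u * w₀ - u₀ * w) * (u * w₀ + u₀ * w)‖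
        ≤ (residueCard F : ℝ) ^ (-(n : ℤ)) := by
      refine (mul_le_mul_of_nonneg_right hAB (norm_nonneg _)).trans ?_
      rcases le_total ‖A‖ ‖B‖ with hle | hle
      · rwa [max_eq_right hle]
      · rwa [max_eq_left hle]
    have h4 : (residueCard F : ℝ) ^ (-(n : ℤ)) = (residueCard F : ℝ) ^ (-(j : ℤ))
        * (residueCard F : ℝ) ^ (-((n - j : ℕ) : ℤ)) := by
      rw [← zpow_add₀ hq.ne']; congr 1; omega
    rw [h4, norm_mul] at h3
    exact le_of_mul_le_mul_left h3 (zpow_pos hq _)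
  -- The factors uw₀ ∓ u₀w differ by the unit 2u₀w, so one has norm at least 1 and the other carries
  -- the whole smallness of the product.
  have hone : 1 ≤ max ‖u * w₀ - u₀ * w‖ ‖u * w₀ + u₀ * w‖ := by
    have h5 : ‖(u * w₀ + u₀ * w) - (u * w₀ - u₀ * w)‖ = 1 := by
      have : (u * w₀ + u₀ * w) - (u * w₀ - u₀ * w) = 2 * (u₀ * w) := by ring
      rw [this, norm_mul, norm_mul, h2, hu₀, hw]; norm_num
    rw [← h5, max_comm]
    exact norm_sub_le_of (le_max_left _ _) (le_max_right _ _)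
  rcases le_max_iff.1 hone with h6 | h6
  · exact Or.inr (by nlinarith [norm_nonneg (u * w₀ + u₀ * w)])
  · exact Or.inl (by nlinarith [norm_nonneg (u * w₀ - u₀ * w)])

theorem mem_heckeGroup_inf_toralGroup (h : NormalizedNorm F) {δ : F} (hδ : ‖δ‖ = 1) {n m : ℕ}
    (hm : m ≤ 2 * n) {g : GL (Fin 2) F} (hg : g ∈ heckeGroup F (2 * n) (2 * n))
    (hgd : ‖g 0 0 - g 1 1‖ ≤ (residueCard F : ℝ) ^ (-(m : ℤ))) :
    g ∈ heckeGroup F (2 * n) (2 * n) ⊓ toralGroup δ m := by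
  have hle : (residueCard F : ℝ) ^ (-((2 * n : ℕ) : ℤ)) ≤ (residueCard F : ℝ) ^ (-(m : ℤ)) :=
    zpow_le_zpow_right₀ (one_lt_residueCard h).le (by omega)
  exact ⟨hg, (mem_toralGroup_iff hδ).2 ⟨hg.1, hgd, norm_sub_le_of (hg.2.1.trans hle)
    (norm_mul_le_of hδ.le (hg.2.2.trans hle))⟩⟩

/-- The elements `y ∈ H` with `x⁻¹ γ y ∈ U` for some `x ∈ H` lie in two cosets. -/
theorem mem_or_mem_of_mem_toralGroup (h : NormalizedNorm F) (h2 : ‖(2 : F)‖ = 1) {δ : F}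
    (hδ : ‖δ‖ = 1) {n j : ℕ} (hn : 1 ≤ n) (hj : j ≤ n) {γ x y x₀ y₀ : GL (Fin 2) F}
    (hγ : γ ∈ maximalCompact F)
    (hγj : (residueCard F : ℝ) ^ (-(j : ℤ)) ≤ max ‖γ 0 0 * γ 1 0‖ ‖γ 0 1 * γ 1 1‖)
    (hx : x ∈ heckeGroup F (2 * n) (2 * n)) (hy : y ∈ heckeGroup F (2 * n) (2 * n))
    (hxy : x⁻¹ * γ * y ∈ toralGroup δ n)
    (hx₀ : x₀ ∈ heckeGroup F (2 * n) (2 * n)) (hy₀ : y₀ ∈ heckeGroup F (2 * n) (2 * n))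
    (hxy₀ : x₀⁻¹ * γ * y₀ ∈ toralGroup δ n) :
    y₀⁻¹ * y ∈ heckeGroup F (2 * n) (2 * n) ⊓ toralGroup δ (n - j) ∨
      (y₀ * upperTri (-1) 1 0)⁻¹ * y ∈ heckeGroup F (2 * n) (2 * n) ⊓ toralGroup δ (n - j) := by
  have hle : (residueCard F : ℝ) ^ (-((2 * n : ℕ) : ℤ))
      ≤ (residueCard F : ℝ) ^ (-((n - j : ℕ) : ℤ)) :=
    zpow_le_zpow_right₀ (one_lt_residueCard h).le (by omega)
  have hyd := norm_diag_eq_one_of_mem_heckeGroup h (by omega) hy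
  have hyd₀ := norm_diag_eq_one_of_mem_heckeGroup h (by omega) hy₀
  have hdet : ‖((y₀ : Matrix (Fin 2) (Fin 2) F).det)⁻¹‖ ≤ 1 := by
    rw [norm_inv, hy₀.1.2, inv_one]
  have key := norm_sub_le_or_norm_add_le h h2 hj
    (hAB := by rw [norm_mul δ, hδ, one_mul]; exact hγj) hyd.1 hyd.2 hyd₀.1 hyd₀.2
    (norm_quadratic_le h hδ hγ hx hy hxy) (norm_quadratic_le h hδ hγ hx₀ hy₀ hxy₀)
  have hs1 : ‖y₀ 0 1 * y 1 0‖ ≤ (residueCard F : ℝ) ^ (-((n - j : ℕ) : ℤ)) :=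
    norm_mul_le_of (hy₀.1.1 _ _) (hy.2.1.trans hle)
  have hs2 : ‖y₀ 1 0 * y 0 1‖ ≤ (residueCard F : ℝ) ^ (-((n - j : ℕ) : ℤ)) :=
    norm_mul_le_of (hy₀.1.1 _ _) (hy.2.2.trans hle)
  refine key.imp (fun hk => ?_) (fun hk => ?_)
  · refine mem_heckeGroup_inf_toralGroup h hδ (by omega) (mul_mem (inv_mem hy₀) hy) ?_
    have e : (y₀⁻¹ * y) 0 0 - (y₀⁻¹ * y) 1 1 = ((y₀ : Matrix (Fin 2) (Fin 2) F).det)⁻¹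
        * ((y 0 0 * y₀ 1 1 - y₀ 0 0 * y 1 1) - (y₀ 0 1 * y 1 0 - y₀ 1 0 * y 0 1)) := by
      rw [Units.val_mul, inv_entries]
      simp [Matrix.mul_apply, Fin.sum_univ_two]
      ring
    rw [e]
    exact norm_mul_le_of hdet (norm_sub_le_of hk (norm_sub_le_of hs1 hs2))
  · refine mem_heckeGroup_inf_toralGroup h hδ (by omega) (mul_mem (inv_mem (mul_mem hy₀
      (upperTri_zero_mem_heckeGroup (by simp) (by simp) _ _))) hy) ?_
    have e : ((y₀ * upperTri (-1) 1 0)⁻¹ * y) 0 0 - ((y₀ * upperTri (-1) 1 0)⁻¹ * y) 1 1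
        = -(((y₀ : Matrix (Fin 2) (Fin 2) F).det)⁻¹
        * ((y 0 0 * y₀ 1 1 + y₀ 0 0 * y 1 1) - (y₀ 0 1 * y 1 0 + y₀ 1 0 * y 0 1))) := by
      rw [_root_.mul_inv_rev, mul_assoc, Units.val_mul, Units.val_mul, inv_entries, inv_entries,
        coe_upperTri, Matrix.eta_fin_two (y : Matrix (Fin 2) (Fin 2) F)]
      simp
      ring
    rw [e, norm_neg]
    exact norm_mul_le_of hdet (norm_sub_le_of hk (norm_add_le_of hs1 hs2))

variable [MeasurableSpace (GL (Fin 2) F)] [BorelSpace (GL (Fin 2) F)]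
  {μ : Measure (GL (Fin 2) F)} [μ.IsHaarMeasure]

/-- Only the dominating indicator has to be integrable: a nonnegative integrand that is not
measurable has Bochner integral 0, so no regularity of f is required. -/
theorem setIntegral_le_of_le_indicator {H W : Set (GL (Fin 2) F)} (hH : MeasurableSet H)
    (hW : MeasurableSet W) (hWμ : μ W ≠ ⊤) {f : GL (Fin 2) F → ℝ} {c : ℝ} (hc : 0 ≤ c)
    (hf0 : ∀ x, 0 ≤ f x) (hf : ∀ x ∈ H, f x ≤ W.indicator (fun _ => c) x) :
    ∫ x in H, f x ∂μ ≤ c * μ.real W := by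
  have hint : Integrable (W.indicator fun _ => c) μ :=
    (integrable_indicator_iff hW).2 (integrableOn_const hWμ)
  calc ∫ x in H, f x ∂μ ≤ ∫ x in H, W.indicator (fun _ => c) x ∂μ :=
        integral_mono_of_nonneg (Filter.Eventually.of_forall hf0) hint.integrableOn
          (ae_restrict_of_forall_mem hH hf)
    _ ≤ ∫ x, W.indicator (fun _ => c) x ∂μ :=
        setIntegral_le_integral hint
          (Filter.Eventually.of_forall fun x => Set.indicator_nonneg (fun _ _ => hc) x)
    _ = c * μ.real W := by
        rw [integral_indicator_const _ hW, smul_eq_mul, mul_comm]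

/-- For fixed y the admissible x ∈ H(2n) form at most one coset of H(2n) ∩ 𝒰, since x₀⁻¹x =
(x₀⁻¹γy)(x⁻¹γy)⁻¹. The inner integral thus gains 2q^(-n), and the outer one the proportion κ of
admissible y. -/
theorem orbitalIntegral_le_of_subset (h : NormalizedNorm F)
    (hμ : μ (maximalCompact F : Set (GL (Fin 2) F)) = 1) {δ : F} (hδ : ‖δ‖ = 1) {n : ℕ}
    {γ : GL (Fin 2) F} {φ : GL (Fin 2) F → ℝ} {c : ℝ} (hc : 0 ≤ c)
    (hφ0 : ∀ g, 0 ≤ φ g)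
    (hφ : ∀ g, φ g ≤ (toralGroup δ n : Set (GL (Fin 2) F)).indicator (fun _ => c) g)
    {W : Set (GL (Fin 2) F)} (hWm : MeasurableSet W) (hWK : W ⊆ maximalCompact F)
    (hW : ∀ y ∈ heckeGroup F (2 * n) (2 * n), ∀ x ∈ heckeGroup F (2 * n) (2 * n),
      x⁻¹ * γ * y ∈ toralGroup δ n → y ∈ W) {κ : ℝ}
    (hκ : μ.real W ≤ κ * μ.real (heckeGroup F (2 * n) (2 * n) : Set (GL (Fin 2) F))) :
    orbitalIntegral μ n γ φ ≤ c * (2 * (residueCard F : ℝ) ^ (-(n : ℤ))) * κ := by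
  have hq := residueCard_pos h
  set H := heckeGroup F (2 * n) (2 * n) with hH
  set B := H ⊓ toralGroup δ n with hB
  have hHm : MeasurableSet (H : Set (GL (Fin 2) F)) :=
    (isOpen_of_principalCongruence_le h (principalCongruence_le_heckeGroup _)).measurableSet
  have hBo : IsOpen (B : Set (GL (Fin 2) F)) := isOpen_of_principalCongruence_le h
    (principalCongruence_le_heckeGroup_inf_toralGroup h hδ (by omega))
  have hHpos : 0 < μ.real (H : Set (GL (Fin 2) F)) :=
    measureReal_pos_of_le h hμ (fun g hg => hg.1) (principalCongruence_le_heckeGroup _)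
  have hBle : μ.real (B : Set (GL (Fin 2) F)) ≤ 2 * (residueCard F : ℝ) ^ (-(n : ℤ))
      * μ.real (H : Set (GL (Fin 2) F)) := by
    have := measureReal_heckeGroup_inf_toralGroup_le h hμ hδ (n := n) (m := n) (by omega)
    rw [_root_.zpow_neg, _root_.zpow_natCast, mul_right_comm, ← div_eq_mul_inv,
      le_div_iff₀ (by positivity), mul_comm]
    exact this
  have hinner : ∀ y ∈ (H : Set (GL (Fin 2) F)),
      ∫ x in (H : Set (GL (Fin 2) F)), φ (x⁻¹ * γ * y) ∂μ
        ≤ W.indicator (fun _ => c * μ.real (B : Set (GL (Fin 2) F))) y := by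
    intro y hy
    by_cases hex : ∃ x₀ ∈ H, x₀⁻¹ * γ * y ∈ toralGroup δ n
    · obtain ⟨x₀, hx₀, hxy₀⟩ := hex
      rw [Set.indicator_of_mem (hW y hy x₀ hx₀ hxy₀)]
      have hsm : μ (x₀ • (B : Set (GL (Fin 2) F))) = μ (B : Set (GL (Fin 2) F)) := measure_smul _ _ _
      refine (setIntegral_le_of_le_indicator (W := x₀ • (B : Set (GL (Fin 2) F))) hHm
        (hBo.smul x₀).measurableSet
        (by rw [hsm]; exact measure_ne_top_of_le hμ fun g hg => hg.1.1) hc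
        (fun x => hφ0 _) fun x hx => ?_).trans (le_of_eq ?_)
      · refine (hφ _).trans ?_
        by_cases hxU : x⁻¹ * γ * y ∈ toralGroup δ n
        · have hmem : x ∈ x₀ • (B : Set (GL (Fin 2) F)) := by
            refine Set.mem_smul_set.2 ⟨x₀⁻¹ * x, ⟨H.mul_mem (H.inv_mem hx₀) hx, ?_⟩, by simp⟩
            have := (toralGroup δ n).mul_mem hxy₀ ((toralGroup δ n).inv_mem hxU)
            have e : x₀⁻¹ * γ * y * (x⁻¹ * γ * y)⁻¹ = x₀⁻¹ * x := by group
            rwa [e] at this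
          rw [Set.indicator_of_mem hmem]
          exact Set.indicator_le_self' (fun _ _ => hc) _
        · rw [Set.indicator_of_notMem (by exact hxU)]
          exact Set.indicator_nonneg (fun _ _ => hc) _
      · rw [measureReal_def, hsm, ← measureReal_def]
    · have : ∀ x ∈ (H : Set (GL (Fin 2) F)), φ (x⁻¹ * γ * y) = 0 := by
        intro x hx
        refine le_antisymm ((hφ _).trans ?_) (hφ0 _)
        rw [Set.indicator_of_notMem fun hxU => hex ⟨x, hx, hxU⟩]
      rw [setIntegral_eq_zero_of_forall_eq_zero this]
      exact Set.indicator_nonneg (fun _ _ => mul_nonneg hc measureReal_nonneg) _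
  have houter := setIntegral_le_of_le_indicator (μ := μ) hHm hWm (measure_ne_top_of_le hμ hWK)
    (mul_nonneg hc measureReal_nonneg)
    (fun y => integral_nonneg fun x => hφ0 (x⁻¹ * γ * y)) hinner
  unfold orbitalIntegral
  rw [inv_mul_le_iff₀ (by positivity)]
  refine houter.trans ?_
  calc c * μ.real (B : Set (GL (Fin 2) F)) * μ.real W
      ≤ c * (2 * (residueCard F : ℝ) ^ (-(n : ℤ)) * μ.real (H : Set (GL (Fin 2) F)))
        * (κ * μ.real (H : Set (GL (Fin 2) F))) := by gcongr
    _ = _ := by ring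

/-- The factor 8 is 2 from the x-coset times 4 from the y-cosets: two signs, each of relative volume
at most 2q^(-(n-j)). -/
theorem orbitalIntegral_le (h : NormalizedNorm F) (h2 : ‖(2 : F)‖ = 1)
    (hμ : μ (maximalCompact F : Set (GL (Fin 2) F)) = 1) {δ : F} (hδ : ‖δ‖ = 1) {n : ℕ}
    (hn : 1 ≤ n) {γ : GL (Fin 2) F} (hγ : γ ∈ maximalCompact F) {φ : GL (Fin 2) F → ℝ} {c : ℝ}
    (hc : 0 ≤ c) (hφ0 : ∀ g, 0 ≤ φ g)
    (hφ : ∀ g, φ g ≤ (toralGroup δ n : Set (GL (Fin 2) F)).indicator (fun _ => c) g) :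
    orbitalIntegral μ n γ φ ≤ 8 * c * (residueCard F : ℝ) ^ (-(n : ℤ))
      * max (decayFactor n γ) (decayFactor n (weyl F * γ)) := by
  have hq := one_lt_residueCard h
  have hq0 := residueCard_pos h
  set H := heckeGroup F (2 * n) (2 * n) with hH
  have hHm : MeasurableSet (H : Set (GL (Fin 2) F)) :=
    (isOpen_of_principalCongruence_le h (principalCongruence_le_heckeGroup _)).measurableSet
  set a := ‖γ 0 0 * γ 1 0‖ with ha
  set b := ‖γ 0 1 * γ 1 1‖ with hb
  have final : ∀ j ≤ n, max a b ≤ (residueCard F : ℝ) ^ (-(j : ℤ)) →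
      orbitalIntegral μ n γ φ ≤ c * (2 * (residueCard F : ℝ) ^ (-(n : ℤ)))
        * (4 * (residueCard F : ℝ) ^ (-((n - j : ℕ) : ℝ) / 2)) →
      orbitalIntegral μ n γ φ ≤ 8 * c * (residueCard F : ℝ) ^ (-(n : ℤ))
        * max (decayFactor n γ) (decayFactor n (weyl F * γ)) := by
    intro j hj hab hI
    have := rpow_le_max_decayFactor h hj hγ ((le_max_left _ _).trans hab)
      ((le_max_right _ _).trans hab)
    calc _ ≤ _ := hI
      _ = 8 * c * (residueCard F : ℝ) ^ (-(n : ℤ))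
        * (residueCard F : ℝ) ^ (-((n - j : ℕ) : ℝ) / 2) := by ring
      _ ≤ _ := mul_le_mul_of_nonneg_left this (by positivity)
  have hmax : ∃ z : F, ‖z‖ = max a b := by
    rcases max_choice a b with hm | hm
    · exact ⟨_, hm.symm⟩
    · exact ⟨_, hm.symm⟩
  obtain ⟨z, hz⟩ := hmax
  have hz1 : ‖z‖ ≤ 1 := by
    rw [hz]
    exact max_le (norm_mul_le_of (hγ.1 _ _) (hγ.1 _ _)) (norm_mul_le_of (hγ.1 _ _) (hγ.1 _ _))
  rcases le_or_gt ‖z‖ ((residueCard F : ℝ) ^ (-(n : ℤ))) with hsmall | hlarge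
  · refine final n le_rfl (hz ▸ hsmall) ?_
    refine (orbitalIntegral_le_of_subset h hμ hδ hc hφ0 hφ hHm (fun g hg => hg.1)
      (fun y hy _ _ _ => hy) (κ := 1) (by rw [one_mul])).trans ?_
    refine mul_le_mul_of_nonneg_left ?_ (by positivity)
    simp
  · obtain ⟨j, hj, hzj⟩ := exists_norm_eq_zpow_neg h hz1 hlarge
    refine final j hj.le (hz ▸ hzj.le) ?_
    -- The count of y saves q^(-(n-j)); only its square root is retained.
    have hpow : 4 * (residueCard F : ℝ) ^ (-((n - j : ℕ) : ℤ))
        ≤ 4 * (residueCard F : ℝ) ^ (-((n - j : ℕ) : ℝ) / 2) := by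
      rw [← Real.rpow_intCast]
      refine mul_le_mul_of_nonneg_left (Real.rpow_le_rpow_of_exponent_le hq.le ?_) (by norm_num)
      have : (0 : ℝ) ≤ (n - j : ℕ) := Nat.cast_nonneg _
      push_cast
      linarith
    refine le_trans ?_ (mul_le_mul_of_nonneg_left hpow (by positivity))
    by_cases hex : ∃ y₀ ∈ H, ∃ x₀ ∈ H, x₀⁻¹ * γ * y₀ ∈ toralGroup δ n
    · obtain ⟨y₀, hy₀, x₀, hx₀, hxy₀⟩ := hex
      set B := H ⊓ toralGroup δ (n - j) with hB
      have hBo : IsOpen (B : Set (GL (Fin 2) F)) := isOpen_of_principalCongruence_le h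
        (principalCongruence_le_heckeGroup_inf_toralGroup h hδ (by omega))
      have hsm : ∀ k : GL (Fin 2) F,
          μ.real (k • (B : Set (GL (Fin 2) F))) = μ.real (B : Set (GL (Fin 2) F)) := fun k => by
        rw [measureReal_def, measureReal_def, measure_smul]
      have hy₁ : y₀ * upperTri (-1) 1 0 ∈ H :=
        mul_mem hy₀ (upperTri_zero_mem_heckeGroup (by simp) (by simp) _ _)
      refine orbitalIntegral_le_of_subset h hμ hδ hc hφ0 hφ
        (W := y₀ • (B : Set (GL (Fin 2) F)) ∪ (y₀ * upperTri (-1) 1 0) • (B : Set (GL (Fin 2) F)))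
        ((hBo.smul _).measurableSet.union (hBo.smul _).measurableSet) ?_ ?_ ?_
      · refine Set.union_subset ?_ ?_
        · rintro _ ⟨k, hk, rfl⟩
          exact (mul_mem hy₀ hk.1).1
        · rintro _ ⟨k, hk, rfl⟩
          exact (mul_mem hy₁ hk.1).1
      · intro y hy x hx hxy
        refine (mem_or_mem_of_mem_toralGroup h h2 hδ hn hj.le hγ (hz ▸ hzj.ge) hx hy hxy hx₀ hy₀
          hxy₀).imp (fun hk => ?_) (fun hk => ?_)
        · exact Set.mem_smul_set.2 ⟨_, hk, by rw [smul_eq_mul, mul_inv_cancel_left]⟩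
        · exact Set.mem_smul_set.2 ⟨_, hk, by rw [smul_eq_mul, mul_inv_cancel_left]⟩
      · refine (measureReal_union_le _ _).trans ?_
        rw [hsm, hsm]
        have := measureReal_heckeGroup_inf_toralGroup_le h hμ hδ (n := n) (m := n - j) (by omega)
        rw [_root_.zpow_neg, _root_.zpow_natCast, mul_right_comm, ← div_eq_mul_inv,
          le_div_iff₀ (by positivity)]
        linarith
    · refine orbitalIntegral_le_of_subset h hμ hδ hc hφ0 hφ (W := ∅) MeasurableSet.empty
        (Set.empty_subset _) (fun y hy x hx hxy => hex ⟨y, hy, x, hx, hxy⟩) ?_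
      rw [measureReal_empty]
      exact mul_nonneg (by positivity) measureReal_nonneg

end OrbitalIntegral

end PadicNewform

end

noncomputable section

namespace PadicNewform

/-! ### The dimension of the K₀-type of the new-vector. -/

section Dimension

set_option linter.unusedSectionVars false

variable {F : Type u} [NontriviallyNormedField F] [IsUltrametricDist F]
  {V : Type v} [NormedAddCommGroup V] [InnerProductSpace ℂ V]
  {π : Representation ℂ (GL (Fin 2) F) V}

/-- K(m) is normal in K₀, so invariance passes to all K₀-translates and their span. -/
theorem fixed_of_mem_generatedType {m : ℕ} {v : V}
    (hv : ∀ g ∈ principalCongruence F m, π g v = v) {w : V} (hw : w ∈ generatedType π v) :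
    ∀ g ∈ principalCongruence F m, π g w = w := by
  intro g hg
  induction hw using Submodule.span_induction with
  | mem w hw =>
    obtain ⟨k, hk, rfl⟩ := hw
    have h1 := hv _ (conj_mem_principalCongruence (inv_mem hk) hg)
    rw [inv_inv, map_mul_apply, map_mul_apply] at h1
    rw [← map_apply_inv_apply π k (π g _), h1]
  | zero => rw [map_zero]
  | add x y _ _ hx hy => rw [map_add, hx, hy]
  | smul c x _ hx => rw [map_smul, hx]

/-- The dimension of the `K₀`-type is at most the number of points needed to separate the functions
in a model of `π` that are invariant under a congruence subgroup. -/
theorem finrank_generatedType_le {S : Submodule ℂ (GL (Fin 2) F → ℂ)}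
    (hS : EquivRightTranslation π S) {m : ℕ} {v : V}
    (hv : ∀ g ∈ principalCongruence F m, π g v = v) (s : Finset (GL (Fin 2) F))
    (hs : ∀ f ∈ S, (∀ g, ∀ k ∈ principalCongruence F m, f (g * k) = f g) →
      (∀ g ∈ s, f g = 0) → f = 0) :
    Module.finrank ℂ (generatedType π v) ≤ s.card := by
  obtain ⟨φ, hφ⟩ := hS
  let T : generatedType π v →ₗ[ℂ] (s → ℂ) :=
    { toFun := fun w g => (φ w.1 : GL (Fin 2) F → ℂ) g.1
      map_add' := fun x y => by ext g; simp
      map_smul' := fun c x => by ext g; simp }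
  have hT : Function.Injective T := by
    rw [← LinearMap.ker_eq_bot, LinearMap.ker_eq_bot']
    intro w hw
    have h0 : (φ w.1 : GL (Fin 2) F → ℂ) = 0 := by
      refine hs _ (φ w.1).2 (fun g k hk => ?_) (fun g hg => congrFun hw ⟨g, hg⟩)
      rw [← hφ, fixed_of_mem_generatedType hv w.2 k hk]
    have h1 : φ w.1 = 0 := Subtype.ext h0
    exact Subtype.ext ((LinearEquiv.map_eq_zero_iff φ).1 h1)
  have := LinearMap.finrank_le_finrank_of_injective hT
  rwa [Module.finrank_fintype_fun_eq_card, Fintype.card_coe] at this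

/-- The lower triangular unipotent matrix with entry `x`. -/
def lowerUnipotent (x : F) : GL (Fin 2) F :=
  GeneralLinearGroup.mkOfDetNeZero !![1, 0; x, 1] (by simp [Matrix.det_fin_two])

/-- The matrix with rows `(0, -1)` and `(1, x)`. -/
def weylUnipotent (x : F) : GL (Fin 2) F :=
  GeneralLinearGroup.mkOfDetNeZero !![0, -1; 1, x] (by simp [Matrix.det_fin_two])

theorem coe_lowerUnipotent (x : F) :
    ((lowerUnipotent x : GL (Fin 2) F) : Matrix (Fin 2) (Fin 2) F) = !![1, 0; x, 1] := rfl

theorem coe_weylUnipotent (x : F) :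
    ((weylUnipotent x : GL (Fin 2) F) : Matrix (Fin 2) (Fin 2) F) = !![0, -1; 1, x] := rfl

theorem det_coe_ne_zero (g : GL (Fin 2) F) : (g : Matrix (Fin 2) (Fin 2) F).det ≠ 0 :=
  g.det.ne_zero

/-- By left covariance a function lives on the projective line of bottom rows, covered by two
integral charts according to which entry is larger; K(m)-invariance leaves q^m points in each. -/
theorem finrank_generatedType_principalSeries_le (h : NormalizedNorm F) {χ : Fˣ →* Circle}
    (hS : EquivRightTranslation π (principalSeries χ)) {m : ℕ} {v : V}
    (hv : ∀ g ∈ principalCongruence F m, π g v = v) :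
    Module.finrank ℂ (generatedType π v) ≤ 2 * residueCard F ^ m := by
  classical
  obtain ⟨R, hR⟩ := exists_residueSystem h m
  refine (finrank_generatedType_le hS hv (R.image lowerUnipotent ∪ R.image weylUnipotent)
    ?_).trans ?_
  · rintro f ⟨-, hf⟩ hinv h0
    funext g
    have hdet := det_coe_ne_zero g
    rcases le_total ‖g 1 0‖ ‖g 1 1‖ with hle | hle
    · have hd : g 1 1 ≠ 0 := by
        intro hd
        rw [hd, norm_zero, norm_le_zero_iff] at hle
        rw [Matrix.det_fin_two, hd, hle] at hdet
        simp at hdet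
      obtain ⟨r, hr, hxr⟩ := hR.complete (g 1 0 / g 1 1)
        (by rw [norm_div]; exact div_le_one_of_le₀ hle (norm_nonneg _))
      have hk : lowerUnipotent (g 1 0 / g 1 1 - r) ∈ principalCongruence F m := by
        refine mem_principalCongruence_iff.2 ⟨mem_maximalCompact_iff.2 ⟨?_, ?_⟩, ?_⟩
        · rw [coe_lowerUnipotent]
          exact EntriesLE.of (by simp) (by simp) (hxr.trans (zpow_neg_le_one h m)) (by simp)
        · simp [coe_lowerUnipotent, Matrix.det_fin_two]
        · rw [coe_lowerUnipotent]
          exact EntriesLE.of (by simp) (by simp) (by simpa using hxr) (by simp)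
      have hg : g = upperTri (Units.mk0 ((g : Matrix (Fin 2) (Fin 2) F).det / g 1 1)
          (div_ne_zero hdet hd)) (Units.mk0 (g 1 1) hd) (g 0 1)
          * (lowerUnipotent r * lowerUnipotent (g 1 0 / g 1 1 - r)) := by
        refine Units.ext ?_
        rw [Units.val_mul, Units.val_mul, coe_upperTri, coe_lowerUnipotent, coe_lowerUnipotent]
        ext i j
        fin_cases i <;> fin_cases j <;> simp [Matrix.det_fin_two] <;> field_simp
        ring
      rw [hg, hf, hinv _ _ hk, h0 _ (Finset.mem_union_left _ (Finset.mem_image_of_mem _ hr)),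
        mul_zero]
      rfl
    · have hd : g 1 0 ≠ 0 := by
        intro hd
        rw [hd, norm_zero, norm_le_zero_iff] at hle
        rw [Matrix.det_fin_two, hd, hle] at hdet
        simp at hdet
      obtain ⟨r, hr, hxr⟩ := hR.complete (g 1 1 / g 1 0)
        (by rw [norm_div]; exact div_le_one_of_le₀ hle (norm_nonneg _))
      have hk : upperTri 1 1 (g 1 1 / g 1 0 - r) ∈ principalCongruence F m := by
        refine mem_principalCongruence_iff.2 ⟨upperTri_mem_maximalCompact (by simp) (by simp)
          (hxr.trans (zpow_neg_le_one h m)), ?_⟩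
        rw [coe_upperTri]
        exact EntriesLE.of (by simp) (by simpa using hxr) (by simp) (by simp)
      have hg : g = upperTri (Units.mk0 ((g : Matrix (Fin 2) (Fin 2) F).det / g 1 0)
          (div_ne_zero hdet hd)) (Units.mk0 (g 1 0) hd) (g 0 0)
          * (weylUnipotent r * upperTri 1 1 (g 1 1 / g 1 0 - r)) := by
        refine Units.ext ?_
        rw [Units.val_mul, Units.val_mul, coe_upperTri, coe_upperTri, coe_weylUnipotent]
        ext i j
        fin_cases i <;> fin_cases j <;> simp [Matrix.det_fin_two] <;> field_simp
        ring
      rw [hg, hf, hinv _ _ hk, h0 _ (Finset.mem_union_right _ (Finset.mem_image_of_mem _ hr)),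
        mul_zero]
      rfl
  · refine (Finset.card_union_le _ _).trans ?_
    rw [two_mul, ← hR.card_eq]
    exact add_le_add Finset.card_image_le Finset.card_image_le

variable {ψ : AddChar F Circle} {δ : F} {θ : quadraticTorus δ →* Circle} {n : ℕ}
  {β : Matrix (Fin 2) (Fin 2) F} {f : GL (Fin 2) F → ℂ}

theorem latticeCharacter_one : latticeCharacter ψ β (1 : GL (Fin 2) F) = 1 := by
  simp [latticeCharacter]

theorem compactInduction_torus_mul (hf : f ∈ compactInduction ψ n θ β) (x : quadraticTorus δ)
    (g : GL (Fin 2) F) : f ((x : GL (Fin 2) F) * g) = (θ x : ℂ) * f g := by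
  have := hf.2.1 x 1 (one_mem _) g
  rwa [mul_one, latticeCharacter_one, Circle.coe_one, mul_one] at this

theorem compactInduction_principalCongruence_mul (hf : f ∈ compactInduction ψ n θ β)
    {k : GL (Fin 2) F} (hk : k ∈ principalCongruence F n) (g : GL (Fin 2) F) :
    f (k * g) = (latticeCharacter ψ β k : ℂ) * f g := by
  have := hf.2.1 1 k hk g
  rwa [OneMemClass.coe_one, one_mul, map_one, Circle.coe_one, one_mul] at this

/-- Functions in the compactly induced representation invariant under `K(2n)` vanish at the
primitive integral matrices whose determinant is not a unit. -/
theorem compactInduction_eq_zero (h : NormalizedNorm F) [CompleteSpace F] (h2 : ‖(2 : F)‖ = 1)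
    (hψ : IsUnramified ψ) (hn : 1 ≤ n) (hδ : ‖δ‖ = 1) (hsq : ¬ IsSquare δ) {β₀ β₁ : F}
    (hβ₀ : ‖β₀‖ ≤ (residueCard F : ℝ) ^ n) (hβ₁ : (residueCard F : ℝ) ^ (2 * n) ≤ ‖β₁‖)
    (hf : f ∈ compactInduction ψ n θ !![β₀, β₁; β₁ * δ, β₀])
    (hinv : ∀ g, ∀ k ∈ principalCongruence F (2 * n), f (g * k) = f g) {g : GL (Fin 2) F}
    (hg : EntriesLE (g : Matrix (Fin 2) (Fin 2) F) 1) (hg1 : ∃ i j, ‖g i j‖ = 1)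
    (hdet : ‖(g : Matrix (Fin 2) (Fin 2) F).det‖ < 1) : f g = 0 := by
  have hq := one_lt_residueCard h
  have hq0 := residueCard_pos h
  by_contra hfg
  set β : Matrix (Fin 2) (Fin 2) F := !![β₀, β₁; β₁ * δ, β₀] with hβ
  have hdet' : ‖(g : Matrix (Fin 2) (Fin 2) F).det‖ ≤ (residueCard F : ℝ) ^ (-1 : ℤ) :=
    norm_le_zpow_of_lt h (k := 0) (by simpa using hdet)
  have hdet0 := det_coe_ne_zero g
  have hadj : (g : Matrix (Fin 2) (Fin 2) F).adjugate
      = (g : Matrix (Fin 2) (Fin 2) F).det • ((g⁻¹ : GL (Fin 2) F) : Matrix (Fin 2) (Fin 2) F) := by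
    rw [inv_entries, smul_smul, mul_inv_cancel₀ hdet0, one_smul, Matrix.adjugate_fin_two]
  have hM : EntriesLE ((g : Matrix (Fin 2) (Fin 2) F).adjugate * β
      * (g : Matrix (Fin 2) (Fin 2) F)) ((residueCard F : ℝ) ^ (2 * n - 1 : ℤ)) := by
    refine entriesLE_of_forall_addChar_trace_eq_one h hψ fun Y hY => ?_
    -- For Y ∈ 𝔭^(2n-1) the element k = 1 + gY·adj(g) satisfies g⁻¹kg = 1 + det(g)Y ∈ K(2n). So k
    -- acts at g both through θ_β and trivially, and f(g) ≠ 0 forces θ_β(k) = 1.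
    have hY' : EntriesLE ((g : Matrix (Fin 2) (Fin 2) F) * Y
        * (g : Matrix (Fin 2) (Fin 2) F).adjugate) ((residueCard F : ℝ) ^ (-(n : ℤ))) :=
      ((hg.mul_left hY).mul_right hg.adjugate).mono
        (zpow_le_zpow_right₀ hq.le (by omega))
    obtain ⟨k, hk, hkY⟩ := exists_coe_eq_one_add h hn hY'
    have hk' : ((g⁻¹ * k * g : GL (Fin 2) F) : Matrix (Fin 2) (Fin 2) F)
        = 1 + (g : Matrix (Fin 2) (Fin 2) F).det • Y := by
      rw [Units.val_mul, Units.val_mul, hkY, hadj, mul_add, add_mul, mul_one, coe_inv_mul_coe,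
        Matrix.mul_smul, Matrix.mul_smul, Matrix.smul_mul, ← mul_assoc, ← mul_assoc,
        coe_inv_mul_coe, one_mul, mul_assoc, coe_inv_mul_coe, mul_one]
    have hsm : EntriesLE ((g : Matrix (Fin 2) (Fin 2) F).det • Y)
        ((residueCard F : ℝ) ^ (-((2 * n : ℕ) : ℤ))) := by
      refine (hY.smul hdet' (by positivity)).mono (le_of_eq ?_)
      rw [← zpow_add₀ hq0.ne']; congr 1; push_cast; ring
    obtain ⟨k₁, hk₁, hk₁Y⟩ := exists_coe_eq_one_add h (by omega : 1 ≤ 2 * n) hsm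
    have hkk : g⁻¹ * k * g = k₁ := Units.ext (hk'.trans hk₁Y.symm)
    have h3 := compactInduction_principalCongruence_mul hf hk g
    rw [show k * g = g * (g⁻¹ * k * g) by group, hkk, hinv _ _ hk₁] at h3
    have h4 : (latticeCharacter ψ β k : ℂ) = 1 :=
      (mul_right_cancel₀ hfg ((one_mul _).trans h3)).symm
    rw [Circle.coe_eq_one, latticeCharacter, hkY, add_sub_cancel_left] at h4
    rw [← h4, Matrix.trace_mul_comm β]
    congr 1
    rw [mul_assoc _ β, mul_assoc, Matrix.trace_mul_comm]
    simp only [mul_assoc]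
    rw [Matrix.trace_mul_comm]
    simp only [mul_assoc]
  have hA : EntriesLE ((g : Matrix (Fin 2) (Fin 2) F).adjugate * !![0, 1; δ, 0]
      * (g : Matrix (Fin 2) (Fin 2) F)) ((residueCard F : ℝ) ^ (-1 : ℤ)) := by
    have hβ10 : β₁ ≠ 0 := norm_pos_iff.1 ((pow_pos hq0 _).trans_le hβ₁)
    have e : (g : Matrix (Fin 2) (Fin 2) F).adjugate * !![0, 1; δ, 0]
        * (g : Matrix (Fin 2) (Fin 2) F)
        = β₁⁻¹ • ((g : Matrix (Fin 2) (Fin 2) F).adjugate * β * (g : Matrix (Fin 2) (Fin 2) F)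
          - (β₀ * (g : Matrix (Fin 2) (Fin 2) F).det) • 1) := by
      rw [hβ, quadratic_eq_smul_add_smul, mul_add, add_mul, Matrix.mul_smul, Matrix.mul_smul,
        Matrix.smul_mul, Matrix.smul_mul, mul_one, Matrix.adjugate_mul, smul_smul,
        add_sub_cancel_left, smul_smul, inv_mul_cancel₀ hβ10, one_smul]
    rw [e]
    refine ((hM.sub (N := _ • 1) ?_).smul (s := ((residueCard F : ℝ) ^ (2 * n))⁻¹) ?_
      (by positivity)).mono (le_of_eq ?_)
    · have hn' : ‖β₀ * (g : Matrix (Fin 2) (Fin 2) F).det‖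
          ≤ (residueCard F : ℝ) ^ (2 * n - 1 : ℤ) := by
        refine (norm_mul_le_of' hβ₀ hdet.le).trans ?_
        rw [← _root_.zpow_natCast]
        exact zpow_le_zpow_right₀ hq.le (by omega)
      simpa using entriesLE_one.smul hn' (by positivity)
    · rw [norm_inv]; exact inv_anti₀ (by positivity) hβ₁
    · rw [← _root_.zpow_natCast, ← _root_.zpow_neg, ← zpow_add₀ hq0.ne']
      congr 1; push_cast; ring
  have hlt : (residueCard F : ℝ) ^ (-1 : ℤ) < 1 := zpow_neg_lt_one h (m := 1) le_rfl
  rw [Matrix.adjugate_fin_two] at hA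
  -- Up to sign, the off-diagonal entries of adj(g)√δ g are the norm forms of the two columns of g.
  -- Both lie in 𝔭, so anisotropy contradicts primitivity.
  have h01 := norm_lt_one_of_norm_sq_sub_lt h2 hδ hsq (hg 1 1) (hg 0 1) (by
    refine lt_of_le_of_lt (le_of_eq ?_) ((hA 0 1).trans_lt hlt)
    simp only [Matrix.mul_apply, Fin.sum_univ_two]
    congr 1
    simp
    ring)
  have h10 := norm_lt_one_of_norm_sq_sub_lt h2 hδ hsq (hg 1 0) (hg 0 0) (by
    refine lt_of_le_of_lt (le_of_eq ?_) ((hA 1 0).trans_lt hlt)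
    rw [← norm_neg]
    simp only [Matrix.mul_apply, Fin.sum_univ_two]
    congr 1
    simp
    ring)
  obtain ⟨i, j, hij⟩ := hg1
  fin_cases i <;> fin_cases j
  · exact h10.2.ne hij
  · exact h01.2.ne hij
  · exact h10.1.ne hij
  · exact h01.1.ne hij

/-- Outside F^×K₀ the invariant functions vanish by `compactInduction_eq_zero`. On K₀, left
translation by the torus makes the bottom row (0, 1), and left K(n)-equivariance then leaves at most
q^(2n) top rows. -/
theorem finrank_generatedType_compactInduction_le (h : NormalizedNorm F) [CompleteSpace F]
    (h2 : ‖(2 : F)‖ = 1) (hψ : IsUnramified ψ) (hn : 1 ≤ n) (hδ : ‖δ‖ = 1) (hsq : ¬ IsSquare δ)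
    (hθ : ∀ x : quadraticTorus δ, (x : GL (Fin 2) F) 0 1 = 0 → θ x = 1) {β₀ β₁ : F}
    (hβ₀ : ‖β₀‖ ≤ (residueCard F : ℝ) ^ n) (hβ₁ : (residueCard F : ℝ) ^ (2 * n) ≤ ‖β₁‖)
    (hS : EquivRightTranslation π (compactInduction ψ n θ !![β₀, β₁; β₁ * δ, β₀])) {v : V}
    (hv : ∀ g ∈ principalCongruence F (2 * n), π g v = v) :
    Module.finrank ℂ (generatedType π v) ≤ residueCard F ^ (2 * n) := by
  classical
  obtain ⟨R, hR⟩ := exists_residueSystem h n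
  let P : F × F → GL (Fin 2) F := fun p =>
    if ht : p.1 = 0 then 1 else upperTri (Units.mk0 p.1 ht) 1 p.2
  refine (finrank_generatedType_le hS hv ((R ×ˢ R).image P) ?_).trans ?_
  · intro f hf hinv h0
    -- values on `K₀`
    have hK : ∀ k ∈ maximalCompact F, f k = 0 := by
      intro k hk
      set d := (k : Matrix (Fin 2) (Fin 2) F).det with hd
      have hd1 : ‖d‖ = 1 := hk.2
      have hd0 : d ≠ 0 := det_coe_ne_zero k
      have hδ0 : δ ≠ 0 := norm_ne_zero_iff.1 (by rw [hδ]; exact one_ne_zero)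
      have hnorm : ‖k 1 0 ^ 2 - δ * k 0 0 ^ 2‖ = 1 := by
        refine le_antisymm (norm_sub_le_of ?_ (norm_mul_le_of hδ.le ?_)) (not_lt.1 fun hlt => ?_)
        · rw [norm_pow]; exact pow_le_one₀ (norm_nonneg _) (hk.1 _ _)
        · rw [norm_pow]; exact pow_le_one₀ (norm_nonneg _) (hk.1 _ _)
        · obtain ⟨h3, h4⟩ := norm_lt_one_of_norm_sq_sub_lt h2 hδ hsq (hk.1 1 0) (hk.1 0 0) hlt
          rcases norm_mul_diag_or_antidiag hk with h5 | h5
          · exact h4.ne h5.1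
          · exact h3.ne h5.2
      -- This is the torus element with the same second row as k⁻¹, so the second row of ek is (0,
      -- 1). Its determinant is a unit because the norm form is anisotropic modulo 𝔭.
      obtain ⟨e, he, heM⟩ := exists_mem_maximalCompact (F := F)
        (M := !![k 0 0 / d, -(k 1 0) / (δ * d); -(k 1 0) / d, k 0 0 / d])
        (EntriesLE.of (by simpa [hd1] using hk.1 0 0) (by simpa [hd1, hδ] using hk.1 1 0)
          (by simpa [hd1] using hk.1 1 0) (by simpa [hd1] using hk.1 0 0)) (by
          have : (!![k 0 0 / d, -(k 1 0) / (δ * d); -(k 1 0) / d, k 0 0 / d]).det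
              = -((k 1 0 ^ 2 - δ * k 0 0 ^ 2) / (δ * d ^ 2)) := by
            rw [Matrix.det_fin_two_of]; field_simp; ring
          rw [this, norm_neg, norm_div, hnorm]
          simp [hδ, hd1])
      have heT : e ∈ quadraticTorus δ := by
        refine ⟨?_, ?_⟩
        · rw [heM]; simp
        · rw [heM]; simp; field_simp
      have hek : e * k ∈ maximalCompact F := mul_mem he hk
      have hek10 : (e * k) 1 0 = 0 := by
        rw [Units.val_mul, heM, Matrix.mul_apply, Fin.sum_univ_two]
        simp; ring
      have hek11 : (e * k) 1 1 = 1 := by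
        rw [Units.val_mul, heM, Matrix.mul_apply, Fin.sum_univ_two]
        have hd' := hd
        rw [Matrix.det_fin_two] at hd'
        simp
        field_simp
        rw [hd']; ring
      obtain ⟨t, ht, htr⟩ := hR.complete _ (hek.1 0 0)
      obtain ⟨y, hy, hyr⟩ := hR.complete _ (hek.1 0 1)
      have hek00 : ‖(e * k) 0 0‖ = 1 := by
        have := hek.2
        rwa [Matrix.det_fin_two, hek10, hek11, mul_one, mul_zero, sub_zero] at this
      have ht1 : ‖t‖ = 1 := by
        refine norm_eq_one_of_norm_sub_lt hek00 ?_
        rw [norm_sub_rev]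
        exact htr.trans_lt (zpow_neg_lt_one h hn)
      have ht0 : t ≠ 0 := norm_ne_zero_iff.1 (by rw [ht1]; exact one_ne_zero)
      set r : GL (Fin 2) F := upperTri (Units.mk0 t ht0) 1 y with hr
      have hrK : r ∈ maximalCompact F :=
        upperTri_mem_maximalCompact ht1 (by simp) (hR.norm_le y hy)
      have hrP : r = P (t, y) := by simp only [P, dif_neg ht0, hr]
      have hfr : f r = 0 := h0 _ (by
        rw [hrP]; exact Finset.mem_image_of_mem _ (Finset.mem_product.2 ⟨ht, hy⟩))
      have hκ : r⁻¹ * (e * k) ∈ principalCongruence F n := by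
        refine inv_mul_mem_principalCongruence hrK hek ?_
        rw [hr, coe_upperTri]
        refine EntriesLE.of ?_ ?_ ?_ ?_
        · exact htr
        · exact hyr
        · rw [Matrix.sub_apply, hek10]; simp
        · rw [Matrix.sub_apply, hek11]; simp
      have hκ' := conj_mem_principalCongruence hrK hκ
      have h5 := compactInduction_principalCongruence_mul hf hκ' r
      rw [hfr, mul_zero, show r * (r⁻¹ * (e * k)) * r⁻¹ * r = e * k by group] at h5
      have h6 := compactInduction_torus_mul hf ⟨e, heT⟩ k
      rw [h5] at h6
      exact (mul_eq_zero.1 h6.symm).resolve_left (Circle.coe_ne_zero _)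
    -- values elsewhere, after scaling
    funext g
    obtain ⟨⟨i, j⟩, hij⟩ := Finite.exists_max fun p : Fin 2 × Fin 2 => ‖g p.1 p.2‖
    simp only [Prod.forall] at hij
    have hgij : g i j ≠ 0 := by
      intro hz
      rw [hz, norm_zero] at hij
      have : (g : Matrix (Fin 2) (Fin 2) F) = 0 := by
        ext a b; simpa using hij a b
      exact det_coe_ne_zero g (by rw [this]; simp)
    -- Scaling by the inverse of a largest entry makes g primitive integral, and θ is trivial on the
    -- centre.
    set z : Fˣ := (Units.mk0 _ hgij)⁻¹ with hz
    have hzg : ∀ a b, (upperTri z z 0 * g) a b = g a b / g i j := by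
      intro a b
      rw [Units.val_mul, coe_upperTri, Matrix.mul_apply, Fin.sum_univ_two]
      fin_cases a <;> simp [hz] <;> field_simp
    have hle : EntriesLE ((upperTri z z 0 * g : GL (Fin 2) F) : Matrix (Fin 2) (Fin 2) F) 1 := by
      intro a b
      rw [hzg, norm_div]
      exact div_le_one_of_le₀ (hij a b) (norm_nonneg _)
    have hT : upperTri z z 0 ∈ quadraticTorus δ := by
      refine ⟨?_, ?_⟩ <;> simp [coe_upperTri]
    have hfz : f (upperTri z z 0 * g) = 0 := by
      by_cases hdet : ‖((upperTri z z 0 * g : GL (Fin 2) F) : Matrix (Fin 2) (Fin 2) F).det‖ = 1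
      · exact hK _ ⟨hle, hdet⟩
      · refine compactInduction_eq_zero h h2 hψ hn hδ hsq hβ₀ hβ₁ hf hinv hle ⟨i, j, ?_⟩
          (lt_of_le_of_ne ?_ hdet)
        · rw [hzg, div_self hgij, norm_one]
        · rw [Matrix.det_fin_two]
          exact norm_sub_le_of (norm_mul_le_of (hle _ _) (hle _ _))
            (norm_mul_le_of (hle _ _) (hle _ _))
    have h6 := compactInduction_torus_mul hf ⟨_, hT⟩ g
    rw [hfz, hθ ⟨_, hT⟩ (by simp [coe_upperTri]), Circle.coe_one, one_mul] at h6
    exact h6.symm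
  · refine Finset.card_image_le.trans (le_of_eq ?_)
    rw [Finset.card_product, hR.card_eq]; ring

end Dimension

end PadicNewform

end

noncomputable section

namespace PadicNewform

/-! ### Microlocal lifts and minimal vectors as eigenvectors of one shape. -/

section TestVectors

set_option linter.unusedSectionVars false

variable {F : Type u} [NontriviallyNormedField F] [IsUltrametricDist F]
  {V : Type v} [NormedAddCommGroup V] [InnerProductSpace ℂ V]
  {π : Representation ℂ (GL (Fin 2) F) V} {ψ : AddChar F Circle}

theorem decayFactor_max_nonneg (h : NormalizedNorm F) (n : ℕ) {γ : GL (Fin 2) F}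
    (hγ : γ ∈ maximalCompact F) : 0 ≤ max (decayFactor n γ) (decayFactor n (weyl F * γ)) := by
  refine le_trans ?_ (rpow_le_max_decayFactor h (Nat.zero_le n) hγ ?_ ?_)
  · positivity
  · simpa using mul_le_one₀ (hγ.1 0 0) (norm_nonneg _) (hγ.1 1 0)
  · simpa using mul_le_one₀ (hγ.1 0 1) (norm_nonneg _) (hγ.1 1 1)

/-- The constant is 32 = 8·4, where 4 bounds dim(V_new)·vol(𝒰): the factors q^(2n) and q^(-2n)
cancel. -/
theorem orbitalIntegral_testFunction_le (h : NormalizedNorm F) (h2 : ‖(2 : F)‖ = 1)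
    (hψ : IsUnramified ψ) {n : ℕ} (hn : 1 ≤ n)
    (hu : ∀ (g : GL (Fin 2) F) (v w : V), inner ℂ (π g v) (π g w) = inner ℂ v w)
    [MeasurableSpace (GL (Fin 2) F)] [BorelSpace (GL (Fin 2) F)]
    (μ : Measure (GL (Fin 2) F)) [μ.IsHaarMeasure]
    (hμ : μ (maximalCompact F : Set (GL (Fin 2) F)) = 1) {γ : GL (Fin 2) F}
    (hγ : γ ∈ maximalCompact F) {δ β₀ β₁ : F} (hδ : ‖δ‖ = 1)
    (hβ₁ : (residueCard F : ℝ) ^ (2 * n) ≤ ‖β₁‖) {vnew v : V} (hv1 : ‖v‖ = 1)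
    (hv : ∀ k ∈ principalCongruence F n,
      π k v = (latticeCharacter ψ !![β₀, β₁; β₁ * δ, β₀] k : ℂ) • v)
    (hdim : Module.finrank ℂ (generatedType π vnew) ≤ 2 * residueCard F ^ (2 * n)) :
    orbitalIntegral μ n γ (fun g => ‖testFunction π vnew v g‖) ≤
      32 * ((residueCard F : ℝ) ^ (1 - (n : ℤ)) / μ.real (thickenedTorus (quadraticTorus δ) n)) *
        max (decayFactor n γ) (decayFactor n (weyl F * γ)) := by
  classical
  have hq := one_lt_residueCard h
  have hq0 := residueCard_pos h
  rw [thickenedTorus_quadraticTorus h hδ hn]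
  have hU : 0 < μ.real (toralGroup δ n : Set (GL (Fin 2) F)) :=
    measureReal_pos_of_le h hμ (fun g hg => hg.1) (principalCongruence_le_toralGroup hδ n)
  have hvol := measureReal_toralGroup_le h hμ hδ n
  set d : ℝ := ((Module.finrank ℂ (generatedType π vnew) : ℕ) : ℝ) with hd
  have hd0 : 0 ≤ d := Nat.cast_nonneg _
  have hdU : d * μ.real (toralGroup δ n : Set (GL (Fin 2) F)) ≤ 4 := by
    have : d ≤ 2 * (residueCard F : ℝ) ^ (2 * n) := by
      rw [hd]; exact_mod_cast hdim
    nlinarith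
  refine (orbitalIntegral_le h h2 hμ hδ hn hγ hd0 (fun g => norm_nonneg _) fun g => ?_).trans ?_
  · unfold testFunction
    split_ifs with hg
    · by_cases h0 : (inner ℂ (π g v) v : ℂ) = 0
      · rw [h0, mul_zero, norm_zero]
        exact Set.indicator_nonneg (fun _ _ => hd0) _
      · rw [Set.indicator_of_mem (mem_toralGroup_of_inner_ne_zero h hψ hn hu hβ₁ hv hg h0),
          norm_mul, Complex.norm_natCast]
        refine mul_le_of_le_one_right hd0 ((norm_inner_le_norm _ _).trans ?_)
        rw [norm_map_eq hu, hv1, mul_one]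
    · rw [norm_zero]
      exact Set.indicator_nonneg (fun _ _ => hd0) _
  · refine mul_le_mul_of_nonneg_right ?_ (decayFactor_max_nonneg h n hγ)
    rw [← mul_div_assoc, le_div_iff₀ hU]
    -- The argument yields q^(-n), so a factor q is given away here.
    have e : (residueCard F : ℝ) ^ (-(n : ℤ)) ≤ (residueCard F : ℝ) ^ (1 - (n : ℤ)) :=
      zpow_le_zpow_right₀ hq.le (by omega)
    have hpos : 0 < (residueCard F : ℝ) ^ (-(n : ℤ)) := zpow_pos hq0 _
    calc 8 * d * (residueCard F : ℝ) ^ (-(n : ℤ)) * μ.real (toralGroup δ n : Set (GL (Fin 2) F))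
        = 8 * (d * μ.real (toralGroup δ n : Set (GL (Fin 2) F)))
          * (residueCard F : ℝ) ^ (-(n : ℤ)) := by ring
      _ ≤ 8 * 4 * (residueCard F : ℝ) ^ (-(n : ℤ)) := by gcongr
      _ ≤ 32 * (residueCard F : ℝ) ^ (1 - (n : ℤ)) := by linarith

theorem norm_inv_norm_smul {v : V} (hv : v ≠ 0) : ‖((‖v‖⁻¹ : ℝ) : ℂ) • v‖ = 1 := by
  rw [norm_smul, Complex.norm_real, norm_inv, norm_norm, inv_mul_cancel₀ (norm_ne_zero_iff.2 hv)]

theorem coe_shiftMatrix [CharZero F] (b : Fˣ) :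
    ((shiftMatrix b : GL (Fin 2) F) : Matrix (Fin 2) (Fin 2) F)
      = !![(b : F), -(1 / 2); 1, 1 / (2 * (b : F))] := rfl

theorem det_shiftMatrix [CharZero F] (b : Fˣ) :
    ((shiftMatrix b : GL (Fin 2) F) : Matrix (Fin 2) (Fin 2) F).det = 1 := by
  have hb : (b : F) ≠ 0 := b.ne_zero
  have h2 : (2 : F) ≠ 0 := two_ne_zero
  rw [coe_shiftMatrix, Matrix.det_fin_two_of]; field_simp; norm_num

theorem shiftMatrix_mem_maximalCompact [CharZero F] (h2 : ‖(2 : F)‖ = 1) {b : Fˣ}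
    (hb : ‖(b : F)‖ = 1) : shiftMatrix b ∈ maximalCompact F := by
  refine mem_maximalCompact_iff.2 ⟨?_, by rw [det_shiftMatrix, norm_one]⟩
  rw [coe_shiftMatrix]
  exact EntriesLE.of hb.le (by simp [h2]) (by simp) (by simp [h2, hb])

/-- The matrix c₁ is chosen for this: it carries the diagonal torus to the standard quadratic shape
with δ = b⁻², and diag(b, -b) to b²√δ. -/
theorem map_conj_diagonalTorus [CharZero F] (b : Fˣ) :
    (diagonalTorus F).map (MulAut.conj (shiftMatrix b)).toMonoidHom
      = quadraticTorus ((b : F) ^ 2)⁻¹ := by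
  have hb : (b : F) ≠ 0 := b.ne_zero
  have h2 : (2 : F) ≠ 0 := two_ne_zero
  ext g
  constructor
  · rintro ⟨d, ⟨hd1, hd2⟩, rfl⟩
    have e : ((shiftMatrix b * d * (shiftMatrix b)⁻¹ : GL (Fin 2) F) : Matrix (Fin 2) (Fin 2) F)
        = !![(d 0 0 + d 1 1) / 2, b * (d 0 0 - d 1 1) / 2;
          (d 0 0 - d 1 1) / (2 * b), (d 0 0 + d 1 1) / 2] := by
      rw [Units.val_mul, Units.val_mul, inv_entries, det_shiftMatrix, coe_shiftMatrix,
        Matrix.eta_fin_two (d : Matrix (Fin 2) (Fin 2) F), hd1, hd2]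
      ext i j
      fin_cases i <;> fin_cases j <;> simp <;> field_simp <;> ring
    refine ⟨?_, ?_⟩
    · change (shiftMatrix b * d * (shiftMatrix b)⁻¹) 1 1
        = (shiftMatrix b * d * (shiftMatrix b)⁻¹) 0 0
      rw [e]; simp
    · change (shiftMatrix b * d * (shiftMatrix b)⁻¹) 1 0
        = (shiftMatrix b * d * (shiftMatrix b)⁻¹) 0 1 * _
      rw [e]; simp; field_simp
  · rintro ⟨hg1, hg2⟩
    refine ⟨(shiftMatrix b)⁻¹ * g * shiftMatrix b, ⟨?_, ?_⟩, ?_⟩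
    · rw [Units.val_mul, Units.val_mul, inv_entries, det_shiftMatrix, coe_shiftMatrix,
        Matrix.eta_fin_two (g : Matrix (Fin 2) (Fin 2) F), hg1, hg2]
      simp; field_simp; ring
    · rw [Units.val_mul, Units.val_mul, inv_entries, det_shiftMatrix, coe_shiftMatrix,
        Matrix.eta_fin_two (g : Matrix (Fin 2) (Fin 2) F), hg1, hg2]
      simp; field_simp; ring
    · change shiftMatrix b * ((shiftMatrix b)⁻¹ * g * shiftMatrix b) * (shiftMatrix b)⁻¹ = g
      group

/-- The shifted microlocal lift vector is an eigenvector of `K(n)`. -/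
theorem map_shiftMatrix_eigenvector [CharZero F] (h2 : ‖(2 : F)‖ = 1) {b : Fˣ}
    (hb : ‖(b : F)‖ = 1) {c : F} {n : ℕ} {w : V}
    (hw : ∀ k ∈ principalCongruence F n,
      π k w = (latticeCharacter ψ (c • !![(b : F), 0; 0, -(b : F)]) k : ℂ) • w) :
    ∀ k ∈ principalCongruence F n, π k (π (shiftMatrix b) w)
      = (latticeCharacter ψ !![0, c * b ^ 2; c * b ^ 2 * ((b : F) ^ 2)⁻¹, 0] k : ℂ)
        • π (shiftMatrix b) w := by
  have hb0 : (b : F) ≠ 0 := b.ne_zero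
  have h20 : (2 : F) ≠ 0 := two_ne_zero
  intro k hk
  have hk' : (shiftMatrix b)⁻¹ * k * shiftMatrix b ∈ principalCongruence F n := by
    simpa using conj_mem_principalCongruence (inv_mem (shiftMatrix_mem_maximalCompact h2 hb)) hk
  have e : !![0, c * b ^ 2; c * b ^ 2 * ((b : F) ^ 2)⁻¹, 0]
      = ((shiftMatrix b : GL (Fin 2) F) : Matrix (Fin 2) (Fin 2) F)
        * (c • !![(b : F), 0; 0, -(b : F)])
        * (((shiftMatrix b)⁻¹ : GL (Fin 2) F) : Matrix (Fin 2) (Fin 2) F) := by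
    rw [inv_entries, det_shiftMatrix, coe_shiftMatrix]
    ext i j
    fin_cases i <;> fin_cases j <;> simp <;> field_simp <;> ring
  have hchar : latticeCharacter ψ (c • !![(b : F), 0; 0, -(b : F)])
      ((shiftMatrix b)⁻¹ * k * shiftMatrix b)
      = latticeCharacter ψ !![0, c * b ^ 2; c * b ^ 2 * ((b : F) ^ 2)⁻¹, 0] k := by
    have h3 := conj_sub_one (shiftMatrix b)⁻¹ k
    rw [inv_inv] at h3
    unfold latticeCharacter
    rw [h3, e]
    congr 1
    simp only [mul_assoc]
    rw [Matrix.trace_mul_comm ((shiftMatrix b : GL (Fin 2) F) : Matrix (Fin 2) (Fin 2) F)]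
    simp only [mul_assoc]
  rw [← map_mul_apply, show k * shiftMatrix b
    = shiftMatrix b * ((shiftMatrix b)⁻¹ * k * shiftMatrix b) by group, map_mul_apply, hw _ hk',
    map_smul, hchar]

/-- On scalars 1 + d with d ∈ 𝔭^n, triviality of θ on F^× reads ψ(2dβ₀) = 1, and 2 is a unit. -/
theorem norm_le_of_quadraticCharacter (h : NormalizedNorm F) (h2 : ‖(2 : F)‖ = 1)
    (hψ : IsUnramified ψ) {n : ℕ} (hn : 1 ≤ n) {δ : F} {θ : quadraticTorus δ →* Circle}
    {β₀ β₁ : F} (hθF : ∀ x : quadraticTorus δ, (x : GL (Fin 2) F) 0 1 = 0 → θ x = 1)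
    (hθβ : ∀ x : quadraticTorus δ, (x : GL (Fin 2) F) ∈ principalCongruence F n →
      θ x = latticeCharacter ψ !![β₀, β₁; β₁ * δ, β₀] (x : GL (Fin 2) F)) :
    ‖β₀‖ ≤ (residueCard F : ℝ) ^ n := by
  have key : ‖2 * β₀‖ ≤ (residueCard F : ℝ) ^ (n : ℤ) := by
    refine norm_le_of_forall_addChar_eq_one h hψ fun d hd => ?_
    have hY : EntriesLE (d • (1 : Matrix (Fin 2) (Fin 2) F)) ((residueCard F : ℝ) ^ (-(n : ℤ))) := by
      simpa using entriesLE_one.smul hd (by positivity)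
    obtain ⟨k, hk, hkY⟩ := exists_coe_eq_one_add h hn hY
    have hkT : k ∈ quadraticTorus δ := by
      refine ⟨?_, ?_⟩ <;> rw [hkY] <;> simp
    have h1 := hθβ ⟨k, hkT⟩ hk
    rw [hθF ⟨k, hkT⟩ (by change k 0 1 = 0; rw [hkY]; simp)] at h1
    have h3 : latticeCharacter ψ !![β₀, β₁; β₁ * δ, β₀] k = ψ (d * (2 * β₀)) := by
      rw [latticeCharacter, hkY, add_sub_cancel_left, Matrix.trace_fin_two]
      congr 1
      simp [Matrix.mul_apply, Fin.sum_univ_two]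
      ring
    rw [← h3]; exact h1.symm
  rwa [norm_mul, h2, one_mul, _root_.zpow_natCast] at key

/-- With β₀ ∈ 𝔭^(-n), a smaller β₁ would make θ trivial at level 2n - 1, which is still at least n,
where the formula for θ applies. -/
theorem le_norm_of_hasQuadraticCondExp (h : NormalizedNorm F)
    (hψ : IsUnramified ψ) {n : ℕ} (hn : 1 ≤ n) {δ : F} (hδ : ‖δ‖ = 1)
    {θ : quadraticTorus δ →* Circle} {β₀ β₁ : F} (hβ₀ : ‖β₀‖ ≤ (residueCard F : ℝ) ^ n)
    (hθ : HasQuadraticCondExp θ (2 * n))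
    (hθβ : ∀ x : quadraticTorus δ, (x : GL (Fin 2) F) ∈ principalCongruence F n →
      θ x = latticeCharacter ψ !![β₀, β₁; β₁ * δ, β₀] (x : GL (Fin 2) F)) :
    (residueCard F : ℝ) ^ (2 * n) ≤ ‖β₁‖ := by
  have hq := one_lt_residueCard h
  have hq0 := residueCard_pos h
  by_contra! hlt
  rw [← _root_.zpow_natCast] at hlt
  have hβ₁ := norm_le_zpow_of_lt h hlt
  have hle := hθ.2 (show 2 * n - 1 ∈ _ from fun x hx => ?_)
  · omega
  · rw [hθβ x (principalCongruence_anti h (by omega) hx), latticeCharacter]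
    refine hψ.1 _ ?_
    have hmul : ∀ {a b : F} {k l : ℤ}, ‖a‖ ≤ (residueCard F : ℝ) ^ k →
        ‖b‖ ≤ (residueCard F : ℝ) ^ l → k + l ≤ 0 → ‖a * b‖ ≤ 1 := by
      intro a b k l ha hb hkl
      rw [norm_mul]
      refine (mul_le_mul ha hb (norm_nonneg _) (zpow_pos hq0 _).le).trans ?_
      rw [← zpow_add₀ hq0.ne']
      exact zpow_le_one_of_nonpos₀ hq.le hkl
    rw [← _root_.zpow_natCast] at hβ₀
    rw [Matrix.trace_fin_two, Matrix.mul_apply, Matrix.mul_apply, Fin.sum_univ_two,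
      Fin.sum_univ_two]
    have hβδ : ‖β₁ * δ‖ ≤ (residueCard F : ℝ) ^ (((2 * n : ℕ) : ℤ) - 1) :=
      norm_mul_le_of' hβ₁ hδ.le
    exact norm_add_le_of
      (norm_add_le_of (hmul hβ₀ (hx.2 0 0) (by omega)) (hmul hβ₁ (hx.2 1 0) (by omega)))
      (norm_add_le_of (hmul hβδ (hx.2 0 1) (by omega)) (hmul hβ₀ (hx.2 1 1) (by omega)))

theorem orbitalIntegral_microlocalLift_le [CharZero F] (h : NormalizedNorm F)
    (h2 : ‖(2 : F)‖ = 1) (hψ : IsUnramified ψ) {ϖ : F} (hϖ : ‖ϖ‖ = (residueCard F : ℝ)⁻¹)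
    {n : ℕ} (hn : 1 ≤ n)
    (hu : ∀ (g : GL (Fin 2) F) (v w : V), inner ℂ (π g v) (π g w) = inner ℂ v w)
    {vnew : V} (hvnew : IsNewVector π n vnew)
    [MeasurableSpace (GL (Fin 2) F)] [BorelSpace (GL (Fin 2) F)]
    (μ : Measure (GL (Fin 2) F)) [μ.IsHaarMeasure]
    (hμ : μ (maximalCompact F : Set (GL (Fin 2) F)) = 1) {γ : GL (Fin 2) F}
    (hγ : γ ∈ maximalCompact F) {v : V} {T : Subgroup (GL (Fin 2) F)}
    (htest : IsMicrolocalLiftTest ψ ϖ π n v T) :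
    orbitalIntegral μ n γ (fun g => ‖testFunction π vnew v g‖) ≤
      32 * ((residueCard F : ℝ) ^ (1 - (n : ℤ)) / μ.real (thickenedTorus T n)) *
        max (decayFactor n γ) (decayFactor n (weyl F * γ)) := by
  obtain ⟨χ, b, w, -, -, hS, hb, -, hw0, hw, rfl, rfl⟩ := htest
  have hq0 := residueCard_pos h
  have hwk : ∀ k ∈ principalCongruence F n, π k w
      = (latticeCharacter ψ (ϖ ^ (-(2 * n : ℤ)) • !![(b : F), 0; 0, -(b : F)]) k : ℂ) • w := by
    intro k hk
    have h1 := hw 1 1 (by simp) (by simp) k hk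
    have h3 : upperTri (1 : Fˣ) 1 0 = 1 := by
      refine Units.ext ?_
      rw [coe_upperTri]
      ext i j; fin_cases i <;> fin_cases j <;> simp
    rwa [h3, one_mul, div_one, map_one, Circle.coe_one, one_mul] at h1
  rw [map_conj_diagonalTorus]
  refine orbitalIntegral_testFunction_le h h2 hψ hn hu μ hμ hγ (β₀ := 0)
    (β₁ := ϖ ^ (-(2 * n : ℤ)) * b ^ 2) (by simp [hb]) (le_of_eq ?_) ?_ ?_
    (finrank_generatedType_principalSeries_le h hS hvnew.fixed_principalCongruence)
  · rw [norm_mul, norm_pow, hb, one_pow, mul_one, norm_zpow, hϖ, _root_.inv_zpow', neg_neg]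
    have := (_root_.zpow_natCast (residueCard F : ℝ) (2 * n)).symm
    push_cast at this
    exact this
  · rw [norm_smul, norm_map_eq hu, Complex.norm_real, norm_inv, norm_norm,
      inv_mul_cancel₀ (norm_ne_zero_iff.2 hw0)]
  · intro k hk
    rw [map_smul, map_shiftMatrix_eigenvector h2 hb hwk k hk, smul_comm]

theorem orbitalIntegral_minimalVector_le [CompleteSpace F] (h : NormalizedNorm F)
    (h2 : ‖(2 : F)‖ = 1) (hψ : IsUnramified ψ) {n : ℕ} (hn : 1 ≤ n)
    (hu : ∀ (g : GL (Fin 2) F) (v w : V), inner ℂ (π g v) (π g w) = inner ℂ v w)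
    {vnew : V} (hvnew : IsNewVector π n vnew)
    [MeasurableSpace (GL (Fin 2) F)] [BorelSpace (GL (Fin 2) F)]
    (μ : Measure (GL (Fin 2) F)) [μ.IsHaarMeasure]
    (hμ : μ (maximalCompact F : Set (GL (Fin 2) F)) = 1) {γ : GL (Fin 2) F}
    (hγ : γ ∈ maximalCompact F) {v : V} {T : Subgroup (GL (Fin 2) F)}
    (htest : IsMinimalVectorTest ψ π n v T) :
    orbitalIntegral μ n γ (fun g => ‖testFunction π vnew v g‖) ≤
      32 * ((residueCard F : ℝ) ^ (1 - (n : ℤ)) / μ.real (thickenedTorus T n)) *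
        max (decayFactor n γ) (decayFactor n (weyl F * γ)) := by
  obtain ⟨δ, θ, β₀, β₁, w, hδ, hsq, -, hθF, hθ, -, -, hθβ, hS, hw0, hw, rfl, rfl⟩ := htest
  have hβ₀ := norm_le_of_quadraticCharacter h h2 hψ hn hθF hθβ
  have hβ₁ := le_norm_of_hasQuadraticCondExp h hψ hn hδ hβ₀ hθ hθβ
  refine orbitalIntegral_testFunction_le h h2 hψ hn hu μ hμ hγ (β₀ := β₀) hδ hβ₁
    (norm_inv_norm_smul hw0) ?_
    ((finrank_generatedType_compactInduction_le h h2 hψ hn hδ hsq hθF hβ₀ hβ₁ hS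
      hvnew.fixed_principalCongruence).trans (by omega))
  intro k hk
  have h1 := hw 1 (one_mem _) k hk
  rw [OneMemClass.coe_one, one_mul, map_one, Circle.coe_one, one_mul] at h1
  rw [map_smul, h1, smul_comm]

end TestVectors

end PadicNewform

end


/-! ### The main estimates. -/

open PadicNewform in
theorem mainTheorem8 :
    ∃ C : ℝ, 0 < C ∧
      ∀ (F : Type u) [NontriviallyNormedField F] [IsUltrametricDist F] [LocallyCompactSpace F]
        [CharZero F], NormalizedNorm F → ringChar (residueField F) ≠ 2 →
      ∀ (V : Type v) [NormedAddCommGroup V] [InnerProductSpace ℂ V]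
        (π : Representation ℂ (GL (Fin 2) F) V) (n : ℕ), 1 ≤ n →
        IsIrreducibleUnitary π → HasConductor π (4 * n) →
      ∀ vnew : V, IsNewVector π n vnew →
      ∀ γ ∈ maximalCompact F,
        (∀ (ψ : AddChar F Circle) (ϖ : F), IsUnramified ψ → ‖ϖ‖ = (residueCard F : ℝ)⁻¹ →
          ∀ [MeasurableSpace (GL (Fin 2) F)] [BorelSpace (GL (Fin 2) F)]
            (μ : MeasureTheory.Measure (GL (Fin 2) F)) [μ.IsHaarMeasure],
            μ (maximalCompact F : Set (GL (Fin 2) F)) = 1 →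
          ∀ (v : V) (T : Subgroup (GL (Fin 2) F)),
            IsMicrolocalLiftTest ψ ϖ π n v T ∨ IsMinimalVectorTest ψ π n v T →
            orbitalIntegral μ n γ (fun g => ‖testFunction π vnew v g‖) ≤
              C * ((residueCard F : ℝ) ^ (1 - (n : ℤ)) / μ.real (thickenedTorus T n)) *
                max (decayFactor n γ) (decayFactor n (weyl F * γ))) ∧
        ‖(inner ℂ (π γ vnew) vnew : ℂ)‖ ≤
          C * (residueCard F : ℝ) * max (decayFactor n γ) (decayFactor n (weyl F * γ)) := by
  -- The orbital integral determines the constant; the new-vector bound already holds with 1.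
  refine ⟨32, by norm_num, ?_⟩
  intro F _ _ _ _ h hchar V _ _ π n hn hπ hcond vnew hvnew γ hγ
  -- Local compactness supplies the completeness used to extract square roots in the minimal-vector
  -- case.
  have : ProperSpace F := ProperSpace.of_locallyCompactSpace F
  have h2 := norm_two hchar
  refine ⟨fun ψ ϖ hψ hϖ _ _ μ _ hμ v T htest => ?_, ?_⟩
  · rcases htest with htest | htest
    · exact orbitalIntegral_microlocalLift_le h h2 hψ hϖ hn hπ.unitary hvnew μ hμ hγ htest
    · exact orbitalIntegral_minimalVector_le h h2 hψ hn hπ.unitary hvnew μ hμ hγ htest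
  · refine (norm_inner_newVector_le h h2 hn hπ.unitary hcond hvnew hγ).trans ?_
    have := decayFactor_max_nonneg h n hγ
    have := residueCard_pos h
    gcongr
    linarith
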